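/- **Distributions and PARS.** A distribution on a set $A$ is $\mu:A\to[0,1]$ with $\sum_a\mu(a)\le 1$. A PARS is a set $A$ with a relation $a\to\mu$ between elements and finitely supported distributions; $a$ is terminal if $a\to\mu$ for no $\mu$. Write $\mu=\mu^\circ+\bar\mu$, with $\mu^\circ$ the restriction of $\mu$ to terminal elements; $\mathcal T(\mu)=\sum_a\mu^\circ(a)$ is the degree of termination. Let $\mu\rightrightarrows\mu^\circ+\sum_{a\in\mathrm{supp}\,\bar\mu}\mu(a)\rho_a$ whenever $a\to\rho_a$ for every $a\in\mathrm{supp}\,\bar\mu$; $\rightrightarrows^n$, $\rightrightarrows^*$ are its iterates. Let $\looparrowright$ be the least relation such that $a\to\mu$ implies $a\looparrowright\mu$; $a\looparrowright\{a^1\}$; and $a\looparrowright\mu+\{b^p\}$, $b\looparrowright\rho$, $b\notin\mathrm{supp}\,\mu$ imply $a\looparrowright\mu+p\rho$. **Memory structures.** Let $I$ be a countably infinite set of addresses, $M$ a nominal set over the finitary permutations of $I$, $\mathcal L$ a finite set of operations with arities, with equivariant maps $\mathrm{test}:I\times M\to\mathrm{Dist}(\mathrm{Bool}\times M)$ (at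 most one memory of positive probability for each boolean) and $\mathrm{update}:I^*\times\mathcal L\times M\rightharpoonup M$, the latter defined exactly on tuples of pairwise distinct addresses of the right arity; tests of distinct addresses, updates on disjoint tuples, and a test and an update not involving the tested address, commute. **Program nets.** Let $R$ be an SMEYLL net: a correct (switching acyclic, at every depth) constant-only MELL proof net with nodes $\mathsf{ax}$, cut, $\mathsf{one}$, $\otimes$, $\parr$, $?d,?w,?c$, sync nodes with positive types $P::=1\mid P\otimes P$ named in $\mathcal L$ (arity = number of $1$'s in the premises), $!$-boxes, $Y$-boxes (content $A,?A^\perp,?\Gamma$; conclusions $!A,?\Gamma$), and $\bot$-boxes with a left and a right content $(\mathsf{bot},S_i)$, $S_i$ of conclusions $\Gamma\ne\emptyset$. Let $\mathbf m\in M$, and let $\mathrm{ind}_R$ be an injective partial map to $I$ from the conclusions of surface $\mathsf{one}$ nodes and the occurrences of $\bot$ in the conclusions of $R$, total on the latter. Let $\mathbf R=(R,\mathrm{ind}_R,\mathbf m)$. **Token machine.** Signatures are $\sigma::=*\mid l(\sigma)\mid r(\sigma)\mid\langle\sigma,\sigma\rangle\mid y(\sigma,\sigma)$. A position is $(e,s,t)$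 with $e$ an edge (at any depth), $s$ a formula stack on the type of $e$ (either $\delta$ or a stack indicating an occurrence of a unit, or of a modality, the latter stacks ending in $\sigma.\delta$), and $t$ a stack of as many signatures as there are exponential boxes around $e$. It is stable if $s=\delta$ or $e$ is the conclusion of a $\mathsf{bot}$ node; otherwise it goes up if $s$ indicates $\bot$ or $!$, down if $s$ indicates $1$ or $?$. Starting positions: upward positions on the conclusions of $R$ (initial ones), $(e,\epsilon,t)$ below $\mathsf{one}$ nodes, $(e,*.\delta,t)$ below $?d$ nodes. A token state $T$ is a set of positions (tokens) with an injective map $\mathrm{orig}$ to starting positions. $\mathrm{Copies}_T(S)$ is $\{\epsilon\}$ if $S=R$, and if $S$ is a content of a box it is the set of $t$ such that a stable token $(e,s,t)$ is on the premise, on the side of $S$, of the principal door of the box. Transitions keep the origins of tokens; a token moves in its direction by $\mathsf{ax}$, cut: $s,t$ unchanged; $\otimes,\parr$ (downwards): $(s,t)\mapsto(l.s,t)$ or $(r.s,t)$; $?d$ (downwards): $(s,t)\mapsto(*.s,t)$; $?c$ (downwards): $(\sigma.s,t)\mapsto(l(\sigma).s,t)$ or $(r(\sigma).s,t)$; principal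 door of a $!$-box or, for $\sigma\ne y(\cdot,\cdot)$, of a $Y$-box (downwards): $(s,\sigma.t)\mapsto(\sigma.s,t)$; their auxiliary doors (downwards): $(\tau.s,\sigma.t)\mapsto(\langle\sigma,\tau\rangle.s,t)$; $Y$-box, from $?A^\perp$ to the principal premise $A$: $(\tau.s,\sigma.t)\mapsto(s,y(\sigma,\tau).t)$; auxiliary doors of a $\bot$-box: $s,t$ unchanged; each of these also in the reverse sense, except that a token with box stack $t$ enters the content $S_i$ of a $\bot$-box by an auxiliary door only if $t\in\mathrm{Copies}_T(S_i)$. Moreover: all the tokens on the premises of a sync node with a common $t$ (one on each occurrence of $1$) cross it simultaneously; a token in a position $p=(e,\cdot,t)$ below a $\mathsf{one}$ or $?d$ node is added, with $\mathrm{orig}(p)=p$, if $p\notin\mathrm{orig}(T)$ and $t\in\mathrm{Copies}_T(S)$, $S$ the structure of $e$; a token $(e,\epsilon,t)$ on the principal conclusion of a $\bot$-box can move to the left or to the right premise of the principal door. **The MSIAM $\mathcal M_{\mathbf R}$.** A raw state is $(T,\mathrm{ind}_T,\mathbf m)$ with $T$ a token state, $\mathrm{ind}_T$ an injective partial map from starting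 positions to $I$, and $\mathbf m\in M$. States are raw states up to the finitary permutations of $I$ that fix the addresses in the range of $\mathrm{ind}_R$. Adding the token of a $\mathsf{one}$ node gives its position the address $\mathrm{ind}_R(x)$ if the conclusion $x$ of the node is in the domain of $\mathrm{ind}_R$, and otherwise an address fresh for $\mathrm{ind}_T$, $\mathbf m$ and $\mathrm{ind}_R$. Crossing a sync node updates the memory by its name, at the addresses of the origins of its tokens. When $(e,\epsilon,t)$ is at the principal conclusion of a $\bot$-box and its origin has address $i$, the transition is to $\mathrm{test}(i,\mathbf m)$, outcome false moving the token to the left premise, true to the right one. All other transitions leave addresses and memory unchanged. The initial state $\mathbf I_{\mathbf R}$ has one token in each initial position, those indicating an occurrence $x$ of $\bot$ having address $\mathrm{ind}_R(x)$, and memory $\mathbf m$; assume that this assignment of addresses is injective (equivalently, that no $\bot$ lies under a modality in the conclusions of $R$). A state is reachable if it is in the support of some $\mu$ with $\mathbf I_{\mathbf R}\looparrowright\mu$. Two states are in conflict if, for some $\bot$-box and some stacks $s,t$, one has a token $(e_0,s,t)$ and the other a token $(e_1,s,t)$, with $e_0,e_1$ the left and right premises of its principal door. Let $\mathcal D$ be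 the set of all distributions on reachable states, and $\mathcal C\subseteq\mathcal D$ the set of those in whose support any two distinct states are in conflict. **Claim.** For every memory structure and every such $\mathbf R$: 1. $\mathcal C$ contains $\{\mathbf T^1\}$ for every reachable $\mathbf T$ and is closed under $\rightrightarrows$ (so it contains all distributions $\mu$ with $\mathbf I_{\mathbf R}\rightrightarrows^*\mu$). 2. (Diamond) If $\mu\in\mathcal C$, $\mu\rightrightarrows\nu$ and $\mu\rightrightarrows\xi$, then $\nu^\circ=\xi^\circ$ and there is $\rho$ with $\nu\rightrightarrows\rho$ and $\xi\rightrightarrows\rho$. 3. (Confluence) If $\tau\in\mathcal C$, $\tau\rightrightarrows^*\mu$ and $\tau\rightrightarrows^*\xi$, then there is $\rho$ with $\mu\rightrightarrows^*\rho$ and $\xi\rightrightarrows^*\rho$. 4. (Uniqueness of normal forms) If $\mu\in\mathcal D$, $\mu\rightrightarrows^k\rho$ and $\mu\rightrightarrows^k\tau$, then $\rho^\circ=\tau^\circ$. 5. (Uniformity) If $\mu\in\mathcal D$, $p\in[0,1]$ and $\mu\rightrightarrows^*\rho$ for some $\rho$ with $\mathcal T(\rho)\ge p$, then there is $n$ such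 that $\mathcal T(\rho)\ge p$ for all $\rho$ with $\mu\rightrightarrows^n\rho$. 6. (Same degree of termination) If $\mathbf I_{\mathbf R}\rightrightarrows^k\rho$ and $\mathbf I_{\mathbf R}\rightrightarrows^k\tau$ then $\mathcal T(\rho)=\mathcal T(\tau)$; and with $p=\sup\{\mathcal T(\rho):\mathbf I_{\mathbf R}\rightrightarrows^*\rho\}$, $\lim_n\mathcal T(\rho_n)=p$ for every sequence $\{\mathbf I_{\mathbf R}^1\}=\rho_0\rightrightarrows\rho_1\rightrightarrows\rho_2\rightrightarrows\cdots$. -/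

import Mathlib

open scoped ENNReal Topology
open Filter

/-! ## Probability (sub)distributions and probabilistic abstract reduction systems -/

/-- A distribution on `A`: a function with values in `[0,1]` whose sum is at most `1`. -/
@[ext]
structure SubDist (A : Type*) where
  toFun : A → ℝ≥0∞
  sum_le : ∑' a, toFun a ≤ 1

namespace SubDist

variable {A B : Type*}

instance : CoeFun (SubDist A) (fun _ => A → ℝ≥0∞) := ⟨SubDist.toFun⟩

/-- The support of a distribution. -/
def support (μ : SubDist A) : Set A := {a | μ a ≠ 0}

open Classical in
/-- The distribution `{a¹}`. -/
noncomputable def dirac (a : A) : SubDist A where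
  toFun := fun x => if x = a then 1 else 0
  sum_le := by rw [tsum_ite_eq]

open Classical in
/-- The image of a distribution under a function. -/
noncomputable def map (f : A → B) (μ : SubDist A) : SubDist B where
  toFun := fun b => ∑' a, if b = f a then μ a else 0
  sum_le := by
    rw [ENNReal.tsum_comm]
    refine le_trans (le_of_eq ?_) μ.sum_le
    exact tsum_congr fun a => tsum_ite_eq (f a) _

theorem support_dirac_finite (a : A) : (dirac a).support.Finite := by
  refine (Set.finite_singleton a).subset fun x hx => ?_
  by_contra h
  exact hx (if_neg h)

theorem support_map_finite (f : A → B) (μ : SubDist A) (h : μ.support.Finite) :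
    (map f μ).support.Finite := by
  classical
  refine (h.image f).subset fun b hb => ?_
  by_contra hcon
  apply hb
  change (∑' a, if b = f a then μ a else 0) = 0
  refine ENNReal.tsum_eq_zero.2 fun a => ?_
  by_cases hba : b = f a
  · rw [if_pos hba]
    by_contra ha
    exact hcon ⟨a, ha, hba.symm⟩
  · rw [if_neg hba]

end SubDist

/-- A probabilistic abstract reduction system on `A`. -/
structure PARS (A : Type*) where
  rel : A → SubDist A → Prop
  finite_support : ∀ a μ, rel a μ → μ.support.Finite

namespace PARS

variable {A : Type*} (P : PARS A)

/-- Normal forms. -/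
def Terminal (a : A) : Prop := ∀ μ, ¬ P.rel a μ

open Classical in
/-- `μ°`, the part of `μ` on terminal elements. -/
noncomputable def term (μ : SubDist A) : SubDist A where
  toFun := fun a => if P.Terminal a then μ a else 0
  sum_le := by
    refine le_trans (ENNReal.tsum_le_tsum fun a => ?_) μ.sum_le
    split_ifs
    · exact le_rfl
    · exact zero_le

open Classical in
/-- `μ - μ°`, the part of `μ` on reducible elements. -/
noncomputable def cont (μ : SubDist A) (a : A) : ℝ≥0∞ := if P.Terminal a then 0 else μ a

/-- The degree of termination of `μ`. -/
noncomputable def nf (μ : SubDist A) : ℝ≥0∞ := ∑' a, P.term μ a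

/-- The lifting `μ ⇉ ν` of `→` to distributions: every non-terminal element of the support of `μ`
is reduced by one step. -/
def Lift (μ ν : SubDist A) : Prop :=
  ∃ ρ : A → SubDist A, (∀ a, P.cont μ a ≠ 0 → P.rel a (ρ a)) ∧
    ∀ b, ν b = P.term μ b + ∑' a, P.cont μ a * ρ a b

/-- `μ ⇉ⁿ ν`. -/
def LiftN : ℕ → SubDist A → SubDist A → Prop
  | 0, μ, ν => μ = ν
  | n + 1, μ, ν => ∃ ξ, P.Lift μ ξ ∧ LiftN n ξ ν

/-- `μ ⇉* ν`. -/
def LiftStar (μ ν : SubDist A) : Prop := ∃ n, P.LiftN n μ ν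

open Classical in
/-- `a` reaches `μ`. In the last rule `μ` is split as `(μ without b) + {b^(μ b)}`. -/
inductive Reach : A → SubDist A → Prop
  | single {a μ} : P.rel a μ → Reach a μ
  | refl (a) : Reach a (SubDist.dirac a)
  | trans {a b μ ρ ν} : Reach a μ → Reach b ρ →
      (∀ x, SubDist.toFun ν x = (if x = b then 0 else μ x) + μ b * ρ x) → Reach a ν

/-- The diamond property at all distributions of the class `D`. -/
def DiamondOn (D : Set (SubDist A)) : Prop :=
  ∀ μ ∈ D, ∀ ν ξ, P.Lift μ ν → P.Lift μ ξ →
    P.term ν = P.term ξ ∧ ∃ ρ, P.Lift ν ρ ∧ P.Lift ξ ρ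

/-- Confluence at all distributions of the class `D`. -/
def ConfluentOn (D : Set (SubDist A)) : Prop :=
  ∀ τ ∈ D, ∀ μ ξ, P.LiftStar τ μ → P.LiftStar τ ξ → ∃ ρ, P.LiftStar μ ρ ∧ P.LiftStar ξ ρ

/-- Uniqueness of normal forms at all distributions of the class `D`. -/
def UniqueNFOn (D : Set (SubDist A)) : Prop :=
  ∀ μ ∈ D, ∀ k ρ τ, P.LiftN k μ ρ → P.LiftN k μ τ → P.term ρ = P.term τ

def WeaklyNormalizes (p : ℝ≥0∞) (μ : SubDist A) : Prop := ∃ ρ, P.LiftStar μ ρ ∧ p ≤ P.nf ρ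

def StronglyNormalizes (p : ℝ≥0∞) (μ : SubDist A) : Prop :=
  ∃ n, ∀ ρ, P.LiftN n μ ρ → p ≤ P.nf ρ

/-- Uniformity at all distributions of the class `D`. -/
def UniformOn (D : Set (SubDist A)) : Prop :=
  ∀ p ≤ 1, ∀ μ ∈ D, P.WeaklyNormalizes p μ → P.StronglyNormalizes p μ

/-- `μ` converges with probability `p`. -/
def Converges (μ : SubDist A) (p : ℝ≥0∞) : Prop := IsLUB {q | ∃ ρ, P.LiftStar μ ρ ∧ q = P.nf ρ} p

end PARS

/-! ## Memory structures -/

/-- The group of finitary permutations of `I`. -/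
def finPerm (I : Type*) : Subgroup (Equiv.Perm I) where
  carrier := {σ | {i | σ i ≠ i}.Finite}
  mul_mem' := by
    intro σ τ hσ hτ
    refine (hσ.union hτ).subset fun i hi => ?_
    by_contra h
    simp only [Set.mem_union, Set.mem_ofPred_eq, not_or, not_not] at h
    exact hi (by rw [Equiv.Perm.mul_apply, h.2, h.1])
  one_mem' := by simp
  inv_mem' := by
    intro σ hσ
    refine Set.Finite.subset hσ fun i hi h => hi ?_
    rw [Equiv.Perm.inv_eq_iff_eq]
    exact h.symm

section Nominal

variable {I M : Type*} [MulAction (finPerm I) M]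

def Supports (S : Set I) (m : M) : Prop :=
  ∀ σ : finPerm I, (∀ i ∈ S, σ.1 i = i) → σ • m = m

/-- `i` is fresh for `m`: it is outside the smallest finite support of `m`
(the intersection of all finite supports). -/
def IsFresh (i : I) (m : M) : Prop := ∃ S : Set I, S.Finite ∧ Supports S m ∧ i ∉ S

end Nominal

/-- A memory structure with addresses `I`, memories `M` (a nominal set) and operations `L`.
A test has at most one resulting memory for each of its two boolean outcomes. -/
structure MemoryStructure (I M L : Type*) [MulAction (finPerm I) M] where
  nominal : ∀ m : M, ∃ S : Set I, S.Finite ∧ Supports S m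
  test : I → M → SubDist (Bool × M)
  update : List I → L → M → Option M
  arity : L → ℕ
  test_unique : ∀ i m b n n', test i m (b, n) ≠ 0 → test i m (b, n') ≠ 0 → n = n'
  test_equivariant : ∀ (σ : finPerm I) i m b n,
    test (σ.1 i) (σ • m) (b, σ • n) = test i m (b, n)
  update_equivariant : ∀ (σ : finPerm I) v x m,
    update (v.map σ.1) x (σ • m) = (update v x m).map (σ • ·)
  update_defined : ∀ v x m, (update v x m).isSome ↔ v.Nodup ∧ v.length = arity x
  update_update : ∀ v x v' x' m, v.Disjoint v' →
    (update v' x' m).bind (update v x) = (update v x m).bind (update v' x')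
  test_test : ∀ i j m b c n, i ≠ j →
    ∑' m', test i m (b, m') * test j m' (c, n) = ∑' m', test j m (c, m') * test i m' (b, n)
  test_update : ∀ j v x m m' b n, j ∉ v → update v x m = some m' →
    test j m' (b, n) = ∑' m₀ : {m₀ : M // update v x m₀ = some n}, test j m (b, m₀.1)

theorem MemoryStructure.test_finite {I M L : Type*} [MulAction (finPerm I) M]
    (𝓜 : MemoryStructure I M L) (i : I) (m : M) : (𝓜.test i m).support.Finite := by
  refine Set.Finite.of_finite_fibers Prod.fst (Set.toFinite _) fun b _ => ?_
  refine Set.Subsingleton.finite ?_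
  rintro ⟨b₁, n₁⟩ ⟨h₁, hb₁⟩ ⟨b₂, n₂⟩ ⟨h₂, hb₂⟩
  simp only [Set.mem_preimage, Set.mem_singleton_iff] at hb₁ hb₂
  subst hb₁ hb₂
  rw [𝓜.test_unique i m _ n₁ n₂ h₁ h₂]

/-! ## Formulas, signatures, stacks -/

inductive Formula
  | one
  | bot
  | tensor (A B : Formula)
  | par (A B : Formula)
  | bang (A : Formula)
  | quest (A : Formula)

namespace Formula

def dual : Formula → Formula
  | one => bot
  | bot => one
  | tensor A B => par A.dual B.dual
  | par A B => tensor A.dual B.dual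
  | bang A => quest A.dual
  | quest A => bang A.dual

inductive Positive : Formula → Prop
  | one : Positive one
  | tensor {A B} : Positive A → Positive B → Positive (tensor A B)

end Formula

/-- Exponential signatures. -/
inductive Sig
  | star
  | l (σ : Sig)
  | r (σ : Sig)
  | pair (σ τ : Sig)
  | y (σ τ : Sig)

/-- Formula stacks. Box stacks are lists of exponential signatures. -/
inductive Stk
  | nil
  | delta
  | l (s : Stk)
  | r (s : Stk)
  | sig (σ : Sig) (s : Stk)

/-- What a formula stack may indicate: an occurrence of a unit or of a modality. -/
inductive Occ
  | one
  | bot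
  | bang
  | quest

/-- The symbol of the occurrence which the stack `s ≠ δ` indicates in a formula, if any. -/
def Stk.indicates : Stk → Formula → Option Occ
  | .nil, .one => some .one
  | .nil, .bot => some .bot
  | .sig _ .delta, .bang _ => some .bang
  | .sig _ .delta, .quest _ => some .quest
  | .sig _ s, .bang B => s.indicates B
  | .sig _ s, .quest B => s.indicates B
  | .l s, .tensor B _ => s.indicates B
  | .l s, .par B _ => s.indicates B
  | .r s, .tensor _ C => s.indicates C
  | .r s, .par _ C => s.indicates C
  | _, _ => none

/-- Steps of a path in the syntax tree of a formula: left, right, below a modality. -/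
inductive PathStep
  | l
  | r
  | mod

/-- The path followed in a formula by a stack that indicates a unit. -/
def Stk.path : Stk → List PathStep
  | .nil => []
  | .delta => []
  | .l s => .l :: s.path
  | .r s => .r :: s.path
  | .sig _ s => .mod :: s.path

/-- The stacks indicating the units of a positive formula, from left to right. -/
def Formula.atoms : Formula → List Stk
  | .one => [.nil]
  | .tensor A B => A.atoms.map .l ++ B.atoms.map .r
  | _ => []

/-! ## Nets

A net is given with all its edges and nodes, at every depth. The *structures* are the net itself
(the root) and the contents of the boxes; each edge and each node belongs to one structure. -/

/-- The sorts of nodes, with the edges and the contents attached to them.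
Premises are listed before conclusions.
* `sync l ports`: a sync node of name `l`; `ports` lists its pairs (premise, conclusion);
* `bang S a e aux`: a `!`-box with content `S`; `a` and `e` are the premise and the conclusion of
  its principal door, `aux` lists the pairs (premise, conclusion) of its auxiliary doors;
* `ybox S a f e aux`: a `Y`-box; `a` (of type `A`) is the premise of the principal door and `f`
  (of type `?A^⊥`) the conclusion of the content through which the box calls itself;
* `botbox S₀ S₁ e₀ e₁ e aux`: a `⊥`-box with left content `S₀` and right content `S₁`, left premise
  `e₀`, right premise `e₁` and conclusion `e` of the principal door; `aux` lists the triples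
  (left premise, right premise, conclusion) of the auxiliary doors. -/
inductive NodeSpec (E S L : Type*)
  | ax (a b : E)
  | cut (a b : E)
  | one (c : E)
  | bot (c : E)
  | tensor (a b c : E)
  | par (a b c : E)
  | der (a c : E)
  | weak (c : E)
  | contr (a b c : E)
  | sync (l : L) (ports : List (E × E))
  | bang (content : S) (a e : E) (aux : List (E × E))
  | ybox (content : S) (a f e : E) (aux : List (E × E))
  | botbox (S₀ S₁ : S) (e₀ e₁ e : E) (aux : List (E × E × E))

namespace NodeSpec

variable {E S L : Type*}

def prems : NodeSpec E S L → List E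
  | cut a b => [a, b]
  | tensor a b _ => [a, b]
  | par a b _ => [a, b]
  | der a _ => [a]
  | contr a b _ => [a, b]
  | sync _ ports => ports.map Prod.fst
  | _ => []

def concls : NodeSpec E S L → List E
  | ax a b => [a, b]
  | cut _ _ => []
  | one c => [c]
  | bot c => [c]
  | tensor _ _ c => [c]
  | par _ _ c => [c]
  | der _ c => [c]
  | weak c => [c]
  | contr _ _ c => [c]
  | sync _ ports => ports.map Prod.snd
  | bang _ _ e aux => e :: aux.map Prod.snd
  | ybox _ _ _ e aux => e :: aux.map Prod.snd
  | botbox _ _ _ _ e aux => e :: aux.map (fun x => x.2.2)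

/-- The conclusions of the contents of a box, each with the content to which it belongs. -/
def doors : NodeSpec E S L → List (S × E)
  | bang T a _ aux => (T, a) :: aux.map (fun x => (T, x.1))
  | ybox T a f _ aux => (T, a) :: (T, f) :: aux.map (fun x => (T, x.1))
  | botbox S₀ S₁ e₀ e₁ _ aux =>
      (S₀, e₀) :: (S₁, e₁) :: (aux.map (fun x => (S₀, x.1)) ++ aux.map (fun x => (S₁, x.2.1)))
  | _ => []

/-- The edges which end in a node: its premises and the edges inside it which end in its doors. -/
def targets (n : NodeSpec E S L) : List E := n.prems ++ n.doors.map Prod.snd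

def contents : NodeSpec E S L → List S
  | bang T _ _ _ => [T]
  | ybox T _ _ _ _ => [T]
  | botbox S₀ S₁ _ _ _ _ => [S₀, S₁]
  | _ => []

/-- Only exponential boxes add an entry to the box stack. -/
def boxInc : NodeSpec E S L → ℕ
  | bang _ _ _ _ => 1
  | ybox _ _ _ _ _ => 1
  | _ => 0

/-- The typing constraints of the nodes. -/
def Typed (ty : E → Formula) : NodeSpec E S L → Prop
  | ax a b => ty b = (ty a).dual
  | cut a b => ty b = (ty a).dual
  | one c => ty c = .one
  | bot c => ty c = .bot
  | tensor a b c => ty c = .tensor (ty a) (ty b)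
  | par a b c => ty c = .par (ty a) (ty b)
  | der a c => ty c = .quest (ty a)
  | weak c => ∃ A, ty c = .quest A
  | contr a b c => ∃ A, ty a = .quest A ∧ ty b = .quest A ∧ ty c = .quest A
  | sync _ ports => ∀ x ∈ ports, (ty x.1).Positive ∧ ty x.2 = ty x.1
  | bang _ a e aux => ty e = .bang (ty a) ∧ ∀ x ∈ aux, ∃ A, ty x.1 = .quest A ∧ ty x.2 = .quest A
  | ybox _ a f e aux => ty e = .bang (ty a) ∧ ty f = .quest (ty a).dual ∧
      ∀ x ∈ aux, ∃ A, ty x.1 = .quest A ∧ ty x.2 = .quest A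
  | botbox _ _ e₀ e₁ e aux => ty e = .bot ∧ ty e₀ = .bot ∧ ty e₁ = .bot ∧ aux ≠ [] ∧
      ∀ x ∈ aux, ty x.1 = ty x.2.2 ∧ ty x.2.1 = ty x.2.2

/-- The nodes of which a switching path may use only one premise. -/
def IsSwitch : NodeSpec E S L → Prop
  | par _ _ _ => True
  | contr _ _ _ => True
  | _ => False

def IsSync : NodeSpec E S L → Prop
  | sync _ _ => True
  | _ => False

end NodeSpec

/-- Pre-nets whose sync nodes are named in `L`. The functions `depth` (number of boxes around a
structure) and `expDepth` (number of exponential boxes around it) are determined by the net. -/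
structure PreNet (L : Type*) where
  Str : Type
  Edge : Type
  Node : Type
  finite_str : Finite Str
  finite_edge : Finite Edge
  finite_node : Finite Node
  root : Str
  ty : Edge → Formula
  strE : Edge → Str
  strN : Node → Str
  spec : Node → NodeSpec Edge Str L
  depth : Str → ℕ
  expDepth : Str → ℕ
  typed : ∀ n, (spec n).Typed ty
  concls_nodup : ∀ n, (spec n).concls.Nodup
  targets_nodup : ∀ n, (spec n).targets.Nodup
  /-- each edge is a conclusion of exactly one node -/
  source : ∀ e, ∃! n, e ∈ (spec n).concls
  /-- each edge ends in at most one node -/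
  target_unique : ∀ e n n', e ∈ (spec n).targets → e ∈ (spec n').targets → n = n'
  /-- the conclusions of the content of a box end in the doors of the box -/
  target_inner : ∀ e, strE e ≠ root → ∃ n, e ∈ (spec n).targets
  str_prems : ∀ n, ∀ e ∈ (spec n).prems, strE e = strN n
  str_concls : ∀ n, ∀ e ∈ (spec n).concls, strE e = strN n
  str_doors : ∀ n, ∀ x ∈ (spec n).doors, strE x.2 = x.1
  contents_nodup : ∀ n, (spec n).contents.Nodup
  /-- each structure but the root is a content of exactly one box -/
  box_unique : ∀ S, S ≠ root → ∃! n, S ∈ (spec n).contents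
  depth_root : depth root = 0
  depth_content : ∀ n, ∀ S ∈ (spec n).contents, depth S = depth (strN n) + 1
  expDepth_root : expDepth root = 0
  expDepth_content : ∀ n, ∀ S ∈ (spec n).contents, expDepth S = expDepth (strN n) + (spec n).boxInc
  /-- the premises of the principal door of a `⊥`-box are conclusions of `bot` nodes … -/
  bot_of_box : ∀ n S₀ S₁ e₀ e₁ e aux, spec n = .botbox S₀ S₁ e₀ e₁ e aux →
    (∃ k, spec k = .bot e₀) ∧ ∃ k, spec k = .bot e₁
  /-- … and `bot` nodes occur nowhere else -/
  box_of_bot : ∀ k c, spec k = .bot c → ∃ n S₀ S₁ e₀ e₁ e aux,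
    spec n = .botbox S₀ S₁ e₀ e₁ e aux ∧ (c = e₀ ∨ c = e₁)

namespace PreNet

variable {L : Type*} (R : PreNet L)

/-- The conclusions of the net. -/
def IsConcl (e : R.Edge) : Prop := R.strE e = R.root ∧ ∀ n, e ∉ (R.spec n).targets

/-- The edge `e` joins the nodes `n` and `n'`. -/
def Joins (e : R.Edge) (n n' : R.Node) : Prop :=
  (e ∈ (R.spec n).concls ∧ e ∈ (R.spec n').prems) ∨
    (e ∈ (R.spec n').concls ∧ e ∈ (R.spec n).prems)

/-- A cyclic switching path (with `k + 1` nodes) in one of the structures of the net: it uses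
neither two premises of a `⅋` or `?c` node nor two conclusions of a sync node. -/
def SwitchingCycle (k : ℕ) (e : Fin (k + 1) → R.Edge) (n : Fin (k + 1) → R.Node) : Prop :=
  Function.Injective e ∧ Function.Injective n ∧ (∀ i, R.Joins (e i) (n i) (n (i + 1))) ∧
    ∀ i, e i ≠ e (i + 1) →
      ¬ ((R.spec (n (i + 1))).IsSwitch ∧
          e i ∈ (R.spec (n (i + 1))).prems ∧ e (i + 1) ∈ (R.spec (n (i + 1))).prems) ∧
      ¬ ((R.spec (n (i + 1))).IsSync ∧
          e i ∈ (R.spec (n (i + 1))).concls ∧ e (i + 1) ∈ (R.spec (n (i + 1))).concls)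

/-- The correctness criterion. -/
def Correct : Prop := ∀ k e n, ¬ R.SwitchingCycle k e n

end PreNet

/-! ## The multi-token machine of a net -/

/-- Triples (edge, formula stack, box stack). -/
@[ext]
structure Pos (E : Type*) where
  edge : E
  stk : Stk
  box : List Sig

inductive Dir
  | up
  | down
  | stable

namespace PreNet

variable {L : Type*} (R : PreNet L)

/-- The positions of the net. -/
def IsPos (p : Pos R.Edge) : Prop :=
  (p.stk = .delta ∨ (p.stk.indicates (R.ty p.edge)).isSome) ∧
    p.box.length = R.expDepth (R.strE p.edge)

open Classical in
/-- The direction of a position. -/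
noncomputable def dir (p : Pos R.Edge) : Option Dir :=
  if p.stk = .delta ∨ ∃ n, R.spec n = .bot p.edge then some .stable
  else match p.stk.indicates (R.ty p.edge) with
    | some .bang => some .up
    | some .bot => some .up
    | some .quest => some .down
    | some .one => some .down
    | none => none

def IsInit (p : Pos R.Edge) : Prop :=
  R.IsPos p ∧ R.IsConcl p.edge ∧ p.box = [] ∧ R.dir p = some .up

def IsOnes (p : Pos R.Edge) : Prop :=
  R.IsPos p ∧ (∃ n, R.spec n = .one p.edge) ∧ p.stk = .nil

def IsDer (p : Pos R.Edge) : Prop :=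
  R.IsPos p ∧ (∃ n a, R.spec n = .der a p.edge) ∧ p.stk = .sig .star .delta

/-- The starting positions. -/
def IsStart (p : Pos R.Edge) : Prop := R.IsInit p ∨ R.IsOnes p ∨ R.IsDer p

/-- A state of the machine: a set of positions with an injective map `orig` from it to the starting
positions, given by the graph of that map: `(p, o) ∈ tok` means that there is a token in `p`, and
that `orig p = o`. -/
@[ext]
structure State where
  tok : Set (Pos R.Edge × Pos R.Edge)
  isPos : ∀ p o, (p, o) ∈ tok → R.IsPos p
  isStart : ∀ p o, (p, o) ∈ tok → R.IsStart o
  functional : ∀ p o o', (p, o) ∈ tok → (p, o') ∈ tok → o = o'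
  injective : ∀ p p' o, (p, o) ∈ tok → (p', o) ∈ tok → p = p'

variable {R}

namespace State

/-- There is a token in `p`. -/
def On (T : R.State) (p : Pos R.Edge) : Prop := ∃ o, (p, o) ∈ T.tok

/-- The edge `e` is the premise, on the side of the content `S`, of the principal door of the box
of `S`. -/
def _root_.PreNet.IsPrincipal (R : PreNet L) (S : R.Str) (e : R.Edge) : Prop :=
  (∃ n b aux, R.spec n = .bang S e b aux) ∨
  (∃ n f b aux, R.spec n = .ybox S e f b aux) ∨
  (∃ n S₁ e₁ b aux, R.spec n = .botbox S S₁ e e₁ b aux) ∨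
  (∃ n S₀ e₀ b aux, R.spec n = .botbox S₀ S e₀ e b aux)

/-- The copies of the structure `S` which are open in the state `T`. -/
def Copies (T : R.State) (S : R.Str) : Set (List Sig) :=
  {t | (S = R.root ∧ t = []) ∨
    ∃ e s, R.IsPrincipal S e ∧ R.dir ⟨e, s, t⟩ = some .stable ∧ T.On ⟨e, s, t⟩}

/-- The transitions `p ⟶ q` of a single token from a position `p` of direction `d`,
depending on the state `T` only for tokens that enter a `⊥`-box by an auxiliary door. -/
inductive Move (T : R.State) : Dir → Pos R.Edge → Pos R.Edge → Prop
  | ax_l {n a b s t} : R.spec n = .ax a b → Move T .up ⟨a, s, t⟩ ⟨b, s, t⟩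
  | ax_r {n a b s t} : R.spec n = .ax a b → Move T .up ⟨b, s, t⟩ ⟨a, s, t⟩
  | cut_l {n a b s t} : R.spec n = .cut a b → Move T .down ⟨a, s, t⟩ ⟨b, s, t⟩
  | cut_r {n a b s t} : R.spec n = .cut a b → Move T .down ⟨b, s, t⟩ ⟨a, s, t⟩
  | tensor_dl {n a b c s t} : R.spec n = .tensor a b c → Move T .down ⟨a, s, t⟩ ⟨c, .l s, t⟩
  | tensor_dr {n a b c s t} : R.spec n = .tensor a b c → Move T .down ⟨b, s, t⟩ ⟨c, .r s, t⟩
  | tensor_ul {n a b c s t} : R.spec n = .tensor a b c → Move T .up ⟨c, .l s, t⟩ ⟨a, s, t⟩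
  | tensor_ur {n a b c s t} : R.spec n = .tensor a b c → Move T .up ⟨c, .r s, t⟩ ⟨b, s, t⟩
  | par_dl {n a b c s t} : R.spec n = .par a b c → Move T .down ⟨a, s, t⟩ ⟨c, .l s, t⟩
  | par_dr {n a b c s t} : R.spec n = .par a b c → Move T .down ⟨b, s, t⟩ ⟨c, .r s, t⟩
  | par_ul {n a b c s t} : R.spec n = .par a b c → Move T .up ⟨c, .l s, t⟩ ⟨a, s, t⟩
  | par_ur {n a b c s t} : R.spec n = .par a b c → Move T .up ⟨c, .r s, t⟩ ⟨b, s, t⟩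
  | der_d {n a c s t} : R.spec n = .der a c → Move T .down ⟨a, s, t⟩ ⟨c, .sig .star s, t⟩
  | der_u {n a c s t} : R.spec n = .der a c → Move T .up ⟨c, .sig .star s, t⟩ ⟨a, s, t⟩
  | contr_dl {n a b c σ s t} : R.spec n = .contr a b c →
      Move T .down ⟨a, .sig σ s, t⟩ ⟨c, .sig (.l σ) s, t⟩
  | contr_dr {n a b c σ s t} : R.spec n = .contr a b c →
      Move T .down ⟨b, .sig σ s, t⟩ ⟨c, .sig (.r σ) s, t⟩
  | contr_ul {n a b c σ s t} : R.spec n = .contr a b c →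
      Move T .up ⟨c, .sig (.l σ) s, t⟩ ⟨a, .sig σ s, t⟩
  | contr_ur {n a b c σ s t} : R.spec n = .contr a b c →
      Move T .up ⟨c, .sig (.r σ) s, t⟩ ⟨b, .sig σ s, t⟩
  | bang_d {n S a e aux σ s t} : R.spec n = .bang S a e aux →
      Move T .down ⟨a, s, σ :: t⟩ ⟨e, .sig σ s, t⟩
  | bang_u {n S a e aux σ s t} : R.spec n = .bang S a e aux →
      Move T .up ⟨e, .sig σ s, t⟩ ⟨a, s, σ :: t⟩
  | bang_aux_d {n S a e aux x σ τ s t} : R.spec n = .bang S a e aux → x ∈ aux →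
      Move T .down ⟨x.1, .sig τ s, σ :: t⟩ ⟨x.2, .sig (.pair σ τ) s, t⟩
  | bang_aux_u {n S a e aux x σ τ s t} : R.spec n = .bang S a e aux → x ∈ aux →
      Move T .up ⟨x.2, .sig (.pair σ τ) s, t⟩ ⟨x.1, .sig τ s, σ :: t⟩
  | ybox_d {n S a f e aux σ s t} : R.spec n = .ybox S a f e aux → (∀ σ₁ σ₂, σ ≠ .y σ₁ σ₂) →
      Move T .down ⟨a, s, σ :: t⟩ ⟨e, .sig σ s, t⟩
  | ybox_u {n S a f e aux σ s t} : R.spec n = .ybox S a f e aux → (∀ σ₁ σ₂, σ ≠ .y σ₁ σ₂) →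
      Move T .up ⟨e, .sig σ s, t⟩ ⟨a, s, σ :: t⟩
  | ybox_call {n S a f e aux σ τ s t} : R.spec n = .ybox S a f e aux →
      Move T .down ⟨f, .sig τ s, σ :: t⟩ ⟨a, s, .y σ τ :: t⟩
  | ybox_return {n S a f e aux σ τ s t} : R.spec n = .ybox S a f e aux →
      Move T .down ⟨a, s, .y σ τ :: t⟩ ⟨f, .sig τ s, σ :: t⟩
  | ybox_aux_d {n S a f e aux x σ τ s t} : R.spec n = .ybox S a f e aux → x ∈ aux →
      Move T .down ⟨x.1, .sig τ s, σ :: t⟩ ⟨x.2, .sig (.pair σ τ) s, t⟩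
  | ybox_aux_u {n S a f e aux x σ τ s t} : R.spec n = .ybox S a f e aux → x ∈ aux →
      Move T .up ⟨x.2, .sig (.pair σ τ) s, t⟩ ⟨x.1, .sig τ s, σ :: t⟩
  | bot_d0 {n S₀ S₁ e₀ e₁ e aux x s t} : R.spec n = .botbox S₀ S₁ e₀ e₁ e aux → x ∈ aux →
      Move T .down ⟨x.1, s, t⟩ ⟨x.2.2, s, t⟩
  | bot_d1 {n S₀ S₁ e₀ e₁ e aux x s t} : R.spec n = .botbox S₀ S₁ e₀ e₁ e aux → x ∈ aux →
      Move T .down ⟨x.2.1, s, t⟩ ⟨x.2.2, s, t⟩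
  | bot_u0 {n S₀ S₁ e₀ e₁ e aux x s t} : R.spec n = .botbox S₀ S₁ e₀ e₁ e aux → x ∈ aux →
      t ∈ T.Copies S₀ → Move T .up ⟨x.2.2, s, t⟩ ⟨x.1, s, t⟩
  | bot_u1 {n S₀ S₁ e₀ e₁ e aux x s t} : R.spec n = .botbox S₀ S₁ e₀ e₁ e aux → x ∈ aux →
      t ∈ T.Copies S₁ → Move T .up ⟨x.2.2, s, t⟩ ⟨x.2.1, s, t⟩

/-- The state `U` results from `T` by moving tokens along `r`; tokens in positions which are not
in the domain of `r` stay, and origins are kept. -/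
def MovesTo (T : R.State) (r : Pos R.Edge → Pos R.Edge → Prop) (U : R.State) : Prop :=
  U.tok = {x | ∃ p, (p, x.2) ∈ T.tok ∧ (r p x.1 ∨ (x.1 = p ∧ ∀ q, ¬ r p q))}

/-- A single token crosses a node or a door. -/
def MoveStep (T U : R.State) : Prop :=
  ∃ d p q, T.On p ∧ R.dir p = some d ∧ T.Move d p q ∧ T.MovesTo (fun x y => x = p ∧ y = q) U

/-- A new token is added in the starting position `p`. -/
def GenStep (T : R.State) (p : Pos R.Edge) (U : R.State) : Prop :=
  (∀ q, (q, p) ∉ T.tok) ∧ p.box ∈ T.Copies (R.strE p.edge) ∧ U.tok = insert (p, p) T.tok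

/-- The positions on the premises of a sync node, for the box stack `t`. -/
def _root_.PreNet.syncPositions (R : PreNet L) (ports : List (R.Edge × R.Edge)) (t : List Sig) :
    List (Pos R.Edge) :=
  ports.flatMap fun x => (R.ty x.1).atoms.map fun s => ⟨x.1, s, t⟩

/-- All tokens on the premises of a sync node with box stack `t` cross it simultaneously. -/
def SyncStep (T : R.State) (ports : List (R.Edge × R.Edge)) (t : List Sig) (U : R.State) : Prop :=
  (∀ p ∈ R.syncPositions ports t, T.On p) ∧
    T.MovesTo (fun p q => ∃ x ∈ ports, ∃ s ∈ (R.ty x.1).atoms,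
      p = ⟨x.1, s, t⟩ ∧ q = ⟨x.2, s, t⟩) U

/-- The token on the conclusion `e` of the principal door of a `⊥`-box, with box stack `t`, moves to
the premise `e'` of that door. -/
def ChoiceStep (T : R.State) (e e' : R.Edge) (t : List Sig) (U : R.State) : Prop :=
  T.On ⟨e, .nil, t⟩ ∧ T.MovesTo (fun x y => x = ⟨e, .nil, t⟩ ∧ y = ⟨e', .nil, t⟩) U

/-- Two states are in conflict if they have made opposite choices in one copy of a `⊥`-box. -/
def Conflict (T U : R.State) : Prop :=
  ∃ n S₀ S₁ e₀ e₁ e aux s t, R.spec n = .botbox S₀ S₁ e₀ e₁ e aux ∧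
    ((T.On ⟨e₀, s, t⟩ ∧ U.On ⟨e₁, s, t⟩) ∨ (T.On ⟨e₁, s, t⟩ ∧ U.On ⟨e₀, s, t⟩))

end State

end PreNet

/-! ## Program nets and the machine with memory -/

/-- Candidates for inputs of a net: an edge, or an edge with a path in its type. -/
inductive Input (E : Type*)
  | one (e : E)
  | bot (e : E) (path : List PathStep)

/-- The inputs of a net: the conclusions of its `one` nodes at the surface, and the occurrences of
`⊥` in its conclusions. -/
def PreNet.IsInput {L : Type*} (R : PreNet L) : Input R.Edge → Prop
  | .one e => R.strE e = R.root ∧ ∃ n, R.spec n = .one e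
  | .bot e w => R.IsConcl e ∧ ∃ s : Stk, s.path = w ∧ s.indicates (R.ty e) = some .bot

/-- Raw program nets on a memory structure. -/
structure RawProgramNet {I M L : Type*} [MulAction (finPerm I) M] (𝓜 : MemoryStructure I M L) where
  net : PreNet L
  correct : net.Correct
  arity_sync : ∀ n l ports, net.spec n = .sync l ports →
    (net.syncPositions ports []).length = 𝓜.arity l
  ind : Input net.Edge → Option I
  ind_input : ∀ x i, ind x = some i → net.IsInput x
  ind_injective : ∀ x y i, ind x = some i → ind y = some i → x = y
  ind_total : ∀ e w, net.IsInput (.bot e w) → (ind (.bot e w)).isSome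
  mem : M

namespace RawProgramNet

variable {I M L : Type*} [MulAction (finPerm I) M] {𝓜 : MemoryStructure I M L}
  (N : RawProgramNet 𝓜)

/-- Raw states of the machine with memory. -/
@[ext]
structure RawState where
  siam : N.net.State
  addr : Pos N.net.Edge → Option I
  addr_start : ∀ p i, addr p = some i → N.net.IsStart p
  addr_injective : ∀ p q i, addr p = some i → addr q = some i → p = q
  mem : M

variable {N}

/-- Transitions on raw states. In `test`, outcome `false` selects the left content and outcome
`true` the right content. -/
inductive RawStep : N.RawState → SubDist N.RawState → Prop
  | link_active {T U : N.RawState} {n e t i} : N.net.spec n = .one e →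
      T.siam.GenStep ⟨e, .nil, t⟩ U.siam →
      N.ind (.one e) = some i →
      (∀ q, U.addr q = open Classical in if q = ⟨e, .nil, t⟩ then some i else T.addr q) →
      U.mem = T.mem → RawStep T (SubDist.dirac U)
  | link_fresh {T U : N.RawState} {n e t i} : N.net.spec n = .one e →
      T.siam.GenStep ⟨e, .nil, t⟩ U.siam →
      N.ind (.one e) = none →
      (∀ q, T.addr q ≠ some i) → IsFresh i T.mem → (∀ x, N.ind x ≠ some i) →
      (∀ q, U.addr q = open Classical in if q = ⟨e, .nil, t⟩ then some i else T.addr q) →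
      U.mem = T.mem → RawStep T (SubDist.dirac U)
  | update {T U : N.RawState} {n l ports t v} : N.net.spec n = .sync l ports →
      T.siam.SyncStep ports t U.siam →
      List.Forall₂ (fun p i => ∃ o, (p, o) ∈ T.siam.tok ∧ T.addr o = some i)
        (N.net.syncPositions ports t) v →
      𝓜.update v l T.mem = some U.mem →
      U.addr = T.addr → RawStep T (SubDist.dirac U)
  | test {T : N.RawState} {n S₀ S₁ e₀ e₁ e aux t o i T₀ T₁} :
      N.net.spec n = .botbox S₀ S₁ e₀ e₁ e aux →
      T.siam.ChoiceStep e e₀ t T₀ → T.siam.ChoiceStep e e₁ t T₁ →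
      (⟨e, .nil, t⟩, o) ∈ T.siam.tok → T.addr o = some i →
      RawStep T ((𝓜.test i T.mem).map fun x =>
        { siam := if x.1 then T₁ else T₀
          addr := T.addr
          addr_start := T.addr_start
          addr_injective := T.addr_injective
          mem := x.2 })
  | der {T U : N.RawState} {p} : N.net.IsDer p → T.siam.GenStep p U.siam →
      U.addr = T.addr → U.mem = T.mem → RawStep T (SubDist.dirac U)
  | move {T U : N.RawState} : T.siam.MoveStep U.siam →
      U.addr = T.addr → U.mem = T.mem → RawStep T (SubDist.dirac U)

theorem RawStep.finite_support {T : N.RawState} {μ : SubDist N.RawState} (h : RawStep T μ) :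
    μ.support.Finite := by
  cases h
  case test => exact SubDist.support_map_finite _ _ (𝓜.test_finite _ _)
  all_goals exact SubDist.support_dirac_finite _

variable (N)

/-- Two raw states are equivalent if they differ by a finitary permutation of the addresses which
fixes the addresses already assigned by the program net. -/
def stateSetoid : Setoid N.RawState where
  r T U := ∃ σ : finPerm I, (∀ x i, N.ind x = some i → σ.1 i = i) ∧ U.siam = T.siam ∧
    (∀ p, U.addr p = (T.addr p).map σ.1) ∧ U.mem = σ • T.mem
  iseqv := by
    refine ⟨fun T => ⟨1, ?_, rfl, ?_, ?_⟩, ?_, ?_⟩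
    · intro x i _
      rfl
    · intro p
      change T.addr p = (T.addr p).map id
      rw [Option.map_id, id]
    · rw [one_smul]
    · rintro T U ⟨σ, h₁, h₂, h₃, h₄⟩
      refine ⟨σ⁻¹, ?_, h₂.symm, ?_, ?_⟩
      · intro x i hi
        change σ.1⁻¹ i = i
        rw [Equiv.Perm.inv_eq_iff_eq]
        exact (h₁ x i hi).symm
      · intro p
        rw [h₃ p, Option.map_map]
        have : ((σ⁻¹ : finPerm I).1 : I → I) ∘ σ.1 = id := by
          funext i
          change σ.1⁻¹ (σ.1 i) = i
          simp
        rw [this, Option.map_id, id]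
      · rw [h₄, inv_smul_smul]
    · rintro T U V ⟨σ, h₁, h₂, h₃, h₄⟩ ⟨τ, k₁, k₂, k₃, k₄⟩
      refine ⟨τ * σ, ?_, k₂.trans h₂, ?_, ?_⟩
      · intro x i hi
        change τ.1 (σ.1 i) = i
        rw [h₁ x i hi, k₁ x i hi]
      · intro p
        rw [k₃ p, h₃ p, Option.map_map]
        rfl
      · rw [k₄, h₄, mul_smul]

/-- States of the machine with memory. -/
def MState : Type _ := Quotient N.stateSetoid

variable {N}

def MState.mk (T : N.RawState) : N.MState := Quotient.mk N.stateSetoid T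

/-- The underlying token state. -/
def MState.siam (T : N.MState) : N.net.State :=
  Quotient.lift (s := N.stateSetoid) (fun T : N.RawState => T.siam)
    (fun _ _ h => by obtain ⟨_, _, h, _⟩ := h; exact h.symm) T

variable (N)

/-- The machine with memory of the program net `N`, as a probabilistic abstract reduction system. -/
def machine : PARS N.MState where
  rel a μ := ∃ (T : N.RawState) (ν : SubDist N.RawState),
    MState.mk T = a ∧ RawStep T ν ∧ μ = ν.map MState.mk
  finite_support := by
    rintro a μ ⟨T, ν, _, h, rfl⟩
    exact SubDist.support_map_finite _ _ h.finite_support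

open Classical in
/-- The addresses of the initial positions: an initial position that indicates an occurrence of `⊥`
has the address of that occurrence. -/
noncomputable def initAddr (p : Pos N.net.Edge) : Option I :=
  if N.net.IsInit p ∧ p.stk.indicates (N.net.ty p.edge) = some .bot then
    N.ind (.bot p.edge p.stk.path)
  else none

/-- Distinct initial positions have distinct addresses. -/
def InitInjective : Prop := ∀ p q i, N.initAddr p = some i → N.initAddr q = some i → p = q

/-- The initial state of the token machine: a token in each initial position. -/
def _root_.PreNet.initState {L : Type*} (R : PreNet L) : R.State where
  tok := {x | R.IsInit x.1 ∧ x.2 = x.1}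
  isPos := fun _ _ h => h.1.1
  isStart := fun p o h => by
    obtain ⟨h₁, h₂⟩ := h
    change o = p at h₂
    subst h₂
    exact Or.inl h₁
  functional := fun p o o' h h' => by
    have h₁ : o = p := h.2
    have h₂ : o' = p := h'.2
    rw [h₁, h₂]
  injective := fun p p' o h h' => by
    have h₁ : o = p := h.2
    have h₂ : o = p' := h'.2
    rw [← h₁, ← h₂]

/-- The initial raw state. -/
noncomputable def rawInit (h : N.InitInjective) : N.RawState where
  siam := N.net.initState
  addr := N.initAddr
  addr_start := fun p i hp => by
    unfold initAddr at hp
    split_ifs at hp with h'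
    exact Or.inl h'.1
  addr_injective := h
  mem := N.mem

/-- The initial state of the machine. -/
noncomputable def init (h : N.InitInjective) : N.MState := MState.mk (N.rawInit h)

/-- The states reached by the runs of the machine. -/
def Reachable (h : N.InitInjective) (T : N.MState) : Prop :=
  ∃ μ, N.machine.Reach (N.init h) μ ∧ T ∈ μ.support

/-- The distributions on the states reached by the runs of the machine. -/
def reachableDists (h : N.InitInjective) : Set (SubDist N.MState) :=
  {μ | ∀ T ∈ μ.support, N.Reachable h T}

/-- The distributions on the states reached by the runs of the machine, in which any two distinct
states are in conflict. -/
def conflictDists (h : N.InitInjective) : Set (SubDist N.MState) :=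
  {μ | μ ∈ N.reachableDists h ∧
    ∀ T ∈ μ.support, ∀ U ∈ μ.support, T ≠ U → T.siam.Conflict U.siam}

end RawProgramNet

/-! The statements about distributions reduce to two facts about single states, combined in
`PARS.IsConflict.main`. Local joinability: two reductions of a reachable state are equal, or are
joined by one more step of every outcome (`Possible.joined`). Conflict: distinct outcomes of a
reduction are in conflict, conflict persists along reductions, and no reachable state is in conflict
with itself (`isConflict_reachable`). A lifting reduces each state of the support in a single way,
even a state that comes from several states of the previous support, so joins found separately at
different states might be incompatible. In a conflict distribution they never are: a common
successor of two distinct states would be in conflict with itself (`PARS.IsConflict.glue`). This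
gives the diamond property, and tiling gives confluence. Iterated liftings are linear
(`PARS.LiftN.exists_bind`), so uniqueness of normal forms passes from Dirac masses, which are
conflict distributions, to all distributions on reachable states. Uniformity and the common limit
follow, since the degree of termination never decreases.

Local joinability rests on the set of positions that tokens have left (`History`). Crossing a node
is injective, except that the auxiliary doors of a `⊥`-box merge its two contents
(`NodeSpec.Cross.back_det`). These contents are never both open for one box stack: the premises of
the principal door are reached only from its conclusion, which is left only once. Starting positions
are never reached by a crossing. Hence a moving token lands in a position never visited before
(`History.fire_fresh`), tokens do not collide, and changes of different tokens commute
(`Change.commute`). Stable tokens never move, so open copies stay open and no transition disables an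
independent one. Two events that move a common token are equal (`Possible.move_move`).

On the memory, independent events use the addresses of distinct tokens, so they commute by the
axioms of memory structures (`MemAct.commute_of_disjoint`). Choices of fresh addresses are
reconciled by transpositions, which do not change the class of a state (`fresh_swap`). -/

/-! ### Distributions as a monad. -/

namespace SubDist

variable {A B C : Type*}

theorem ext_apply {μ ν : SubDist A} (h : ∀ a, μ a = ν a) : μ = ν := SubDist.ext (funext h)

theorem dirac_self (a : A) : dirac a a = 1 := if_pos rfl

theorem dirac_ne {a b : A} (h : b ≠ a) : dirac a b = 0 := if_neg h

theorem mem_support_dirac {a b : A} : b ∈ (dirac a).support ↔ b = a := by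
  constructor
  · intro h
    by_contra hb
    exact h (dirac_ne hb)
  · rintro rfl
    change dirac b b ≠ 0
    rw [dirac_self]
    exact one_ne_zero

theorem tsum_dirac_mul (a : A) (f : A → ℝ≥0∞) : ∑' x, dirac a x * f x = f a := by
  rw [tsum_eq_single a, dirac_self, one_mul]
  intro b hb
  rw [dirac_ne hb, zero_mul]

theorem tsum_mul_dirac (μ : SubDist A) (b : A) : ∑' a, μ a * dirac a b = μ b := by
  rw [tsum_eq_single b, dirac_self, mul_one]
  intro a ha
  rw [dirac_ne ha.symm, mul_zero]

/-- The average of the distributions `F a`, weighted by `μ`. -/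
noncomputable def bind (μ : SubDist A) (F : A → SubDist B) : SubDist B where
  toFun := fun b => ∑' a, μ a * F a b
  sum_le := by
    rw [ENNReal.tsum_comm]
    refine le_trans (ENNReal.tsum_le_tsum fun a => ?_) μ.sum_le
    rw [ENNReal.tsum_mul_left]
    exact mul_le_of_le_one_right' (F a).sum_le

theorem bind_apply (μ : SubDist A) (F : A → SubDist B) (b : B) :
    μ.bind F b = ∑' a, μ a * F a b := rfl

theorem dirac_bind (a : A) (F : A → SubDist B) : (dirac a).bind F = F a :=
  ext_apply fun b => tsum_dirac_mul a fun x => F x b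

theorem bind_dirac (μ : SubDist A) : μ.bind dirac = μ :=
  ext_apply fun b => tsum_mul_dirac μ b

theorem bind_assoc (μ : SubDist A) (F : A → SubDist B) (G : B → SubDist C) :
    (μ.bind F).bind G = μ.bind fun a => (F a).bind G := by
  refine ext_apply fun c => ?_
  simp only [bind_apply, ← ENNReal.tsum_mul_right, ← ENNReal.tsum_mul_left, mul_assoc]
  rw [ENNReal.tsum_comm]

theorem mem_support_bind {μ : SubDist A} {F : A → SubDist B} {b : B} :
    b ∈ (μ.bind F).support ↔ ∃ a ∈ μ.support, b ∈ (F a).support := by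
  change (∑' a, μ a * F a b) ≠ 0 ↔ _
  rw [Ne, ENNReal.tsum_eq_zero, not_forall]
  exact exists_congr fun a => by rw [mul_eq_zero, not_or]; rfl

theorem bind_congr {μ : SubDist A} {F G : A → SubDist B} (h : ∀ a ∈ μ.support, F a = G a) :
    μ.bind F = μ.bind G := by
  refine ext_apply fun b => tsum_congr fun a => ?_
  by_cases ha : μ a = 0
  · rw [ha, zero_mul, zero_mul]
  · rw [h a ha]

end SubDist

/-! ### Liftings of a PARS, and what a conflict relation implies for them. -/

namespace PARS

open SubDist

variable {A : Type*} (P : PARS A)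

/-- One step of the lifting of a PARS, at a single element: terminal elements are left unchanged. -/
def StepOrStay (a : A) (κ : SubDist A) : Prop := (P.Terminal a ∧ κ = dirac a) ∨ P.rel a κ

theorem exists_stepOrStay (a : A) : ∃ κ, P.StepOrStay a κ := by
  by_cases h : P.Terminal a
  · exact ⟨_, .inl ⟨h, rfl⟩⟩
  · simp only [Terminal, not_forall, not_not] at h
    exact h.imp fun κ hκ => .inr hκ

/-- Letting terminal elements stay put turns a lifting into the average of one kernel, to which the
monad laws apply. -/
theorem lift_iff {μ ν : SubDist A} :
    P.Lift μ ν ↔ ∃ F : A → SubDist A, (∀ a ∈ μ.support, P.StepOrStay a (F a)) ∧ ν = μ.bind F := by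
  classical
  constructor
  · rintro ⟨ρ, h, hν⟩
    refine ⟨fun a => if P.Terminal a then dirac a else ρ a, fun a ha => ?_, ext_apply fun b => ?_⟩
    · change P.StepOrStay a (if P.Terminal a then dirac a else ρ a)
      by_cases ht : P.Terminal a
      · exact .inl ⟨ht, if_pos ht⟩
      · rw [if_neg ht]
        refine .inr (h a ?_)
        rwa [cont, if_neg ht]
    · rw [hν, bind_apply, ← tsum_mul_dirac (P.term μ), ← ENNReal.tsum_add]
      refine tsum_congr fun a => ?_
      by_cases ht : P.Terminal a
      · simp [cont, term, ht]
      · simp [cont, term, ht]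
  · rintro ⟨F, h, rfl⟩
    refine ⟨F, fun a ha => ?_, fun b => ?_⟩
    · have ht : ¬ P.Terminal a := fun ht => ha (by rw [cont, if_pos ht])
      rw [cont, if_neg ht] at ha
      exact (h a ha).resolve_left fun h => ht h.1
    · rw [bind_apply, ← tsum_mul_dirac (P.term μ), ← ENNReal.tsum_add]
      refine tsum_congr fun a => ?_
      by_cases ht : P.Terminal a
      · by_cases ha : μ a = 0
        · simp [cont, term, ha]
        · rcases h a ha with h | h
          · simp [cont, term, ht, h.2]
          · exact absurd h (ht _)
      · simp [cont, term, ht]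

theorem lift_exists (μ : SubDist A) : ∃ ν, P.Lift μ ν := by
  choose F hF using P.exists_stepOrStay
  exact ⟨_, P.lift_iff.2 ⟨F, fun a _ => hF a, rfl⟩⟩

theorem liftN_exists (n : ℕ) (μ : SubDist A) : ∃ ν, P.LiftN n μ ν := by
  induction n generalizing μ with
  | zero => exact ⟨μ, rfl⟩
  | succ n ih =>
    obtain ⟨ξ, hξ⟩ := P.lift_exists μ
    obtain ⟨ν, hν⟩ := ih ξ
    exact ⟨ν, ξ, hξ, hν⟩

theorem LiftN.trans {P : PARS A} {m n : ℕ} {μ ν ξ : SubDist A} (h : P.LiftN m μ ν)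
    (h' : P.LiftN n ν ξ) : P.LiftN (m + n) μ ξ := by
  induction m generalizing μ with
  | zero =>
    have : μ = ν := h
    subst this
    rwa [Nat.zero_add]
  | succ m ih =>
    obtain ⟨μ', h₁, h₂⟩ := h
    rw [Nat.add_right_comm]
    exact ⟨μ', h₁, ih h₂⟩

theorem LiftN.succ {P : PARS A} {n : ℕ} {μ ν ξ : SubDist A} (h : P.LiftN n μ ν)
    (h' : P.Lift ν ξ) : P.LiftN (n + 1) μ ξ :=
  h.trans (n := 1) ⟨ξ, h', rfl⟩

theorem term_apply_bind (μ : SubDist A) (F : A → SubDist A) :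
    P.term (μ.bind F) = μ.bind fun a => P.term (F a) := by
  refine ext_apply fun b => ?_
  by_cases h : P.Terminal b <;> simp [term, bind_apply, h]

/-- Iterated liftings are linear. -/
theorem LiftN.exists_bind {P : PARS A} {n : ℕ} {μ ρ : SubDist A} (h : P.LiftN n μ ρ) :
    ∃ R : A → SubDist A, ρ = μ.bind R ∧
      ∀ ν : SubDist A, ν.support ⊆ μ.support → P.LiftN n ν (ν.bind R) := by
  induction n generalizing μ with
  | zero =>
    have : μ = ρ := h
    subst this
    exact ⟨dirac, (bind_dirac μ).symm, fun ν _ => (bind_dirac ν).symm⟩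
  | succ n ih =>
    obtain ⟨ξ, h₁, h₂⟩ := h
    obtain ⟨F, hF, rfl⟩ := P.lift_iff.1 h₁
    obtain ⟨R, rfl, hR⟩ := ih h₂
    -- The choices of reductions made for `μ` serve every distribution with smaller support, in
    -- particular a Dirac mass at one of its elements.
    refine ⟨fun a => (F a).bind R, bind_assoc _ _ _, fun ν hν => ?_⟩
    refine ⟨ν.bind F, P.lift_iff.2 ⟨F, fun a ha => hF a (hν ha), rfl⟩, ?_⟩
    rw [← bind_assoc]
    refine hR _ fun b hb => ?_
    obtain ⟨a, ha, hb⟩ := mem_support_bind.1 hb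
    exact mem_support_bind.2 ⟨a, hν ha, hb⟩

/-- A row of diamonds; stability of `D` under liftings keeps their upper corners in `D`. -/
theorem DiamondOn.strip {P : PARS A} {D : Set (SubDist A)} (hD : P.DiamondOn D)
    (hc : ∀ μ ∈ D, ∀ ν, P.Lift μ ν → ν ∈ D) {n : ℕ} {μ ν ξ : SubDist A} (hμ : μ ∈ D)
    (h : P.Lift μ ν) (h' : P.LiftN n μ ξ) : ∃ ρ, P.LiftN n ν ρ ∧ P.Lift ξ ρ := by
  induction n generalizing μ ν with
  | zero =>
    have : μ = ξ := h'
    subst this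
    exact ⟨ν, rfl, h⟩
  | succ n ih =>
    obtain ⟨μ', h₁, h₂⟩ := h'
    obtain ⟨-, κ, hκ, hκ'⟩ := hD μ hμ ν μ' h h₁
    obtain ⟨ρ, hρ, hρ'⟩ := ih (hc μ hμ μ' h₁) hκ' h₂
    exact ⟨ρ, ⟨κ, hκ, hρ⟩, hρ'⟩

theorem DiamondOn.confluentOn {P : PARS A} {D : Set (SubDist A)} (hD : P.DiamondOn D)
    (hc : ∀ μ ∈ D, ∀ ν, P.Lift μ ν → ν ∈ D) : P.ConfluentOn D := by
  rintro τ hτ μ ξ ⟨m, hm⟩ ⟨n, hn⟩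
  induction m generalizing τ ξ n with
  | zero =>
    have : τ = μ := hm
    subst this
    exact ⟨ξ, ⟨n, hn⟩, 0, rfl⟩
  | succ m ih =>
    obtain ⟨τ', h₁, h₂⟩ := hm
    obtain ⟨κ, hκ, hκ'⟩ := hD.strip hc hτ h₁ hn
    obtain ⟨ρ, hρ, k, hk⟩ := ih τ' (hc τ hτ τ' h₁) κ h₂ n hκ
    exact ⟨ρ, hρ, k + 1, κ, hκ', hk⟩

theorem DiamondOn.term_eq {P : PARS A} {D : Set (SubDist A)} (hD : P.DiamondOn D)
    (hc : ∀ μ ∈ D, ∀ ν, P.Lift μ ν → ν ∈ D) : P.UniqueNFOn D := by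
  intro μ hμ k ρ τ hρ hτ
  induction k generalizing μ ρ τ with
  | zero => rw [← show μ = ρ from hρ, ← show μ = τ from hτ]
  | succ k ih =>
    obtain ⟨ρ', h₁, h₂⟩ := hρ
    obtain ⟨τ', h₃, h₄⟩ := hτ
    obtain ⟨ht, κ, hκ, hκ'⟩ := hD μ hμ ρ' τ' h₁ h₃
    -- After a single step the diamond already identifies the terminal parts. Otherwise the common
    -- reduct `κ` is prolonged by arbitrary steps up to the same length, and both sequences are
    -- compared with this prolongation.
    cases k with
    | zero => rwa [← show ρ' = ρ from h₂, ← show τ' = τ from h₄]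
    | succ k =>
      obtain ⟨ω, hω⟩ := P.liftN_exists k κ
      exact (ih ρ' (hc μ hμ _ h₁) ρ ω h₂ ⟨κ, hκ, hω⟩).trans
        (ih τ' (hc μ hμ _ h₃) ω τ ⟨κ, hκ', hω⟩ h₄)

/-- By linearity every element of the support evolves on its own, so no condition relating different
elements of the support is needed. -/
theorem uniqueNFOn_of_dirac {Q : A → Prop}
    (h : ∀ a, Q a → P.UniqueNFOn {dirac a}) : P.UniqueNFOn {μ | ∀ a ∈ μ.support, Q a} := by
  intro μ hμ k ρ τ hρ hτ
  obtain ⟨R, rfl, hR⟩ := hρ.exists_bind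
  obtain ⟨S, rfl, hS⟩ := hτ.exists_bind
  rw [P.term_apply_bind, P.term_apply_bind]
  refine bind_congr fun a ha => ?_
  have hsub : (dirac a).support ⊆ μ.support := fun b hb => by
    rw [mem_support_dirac.1 hb]
    exact ha
  have h₁ := hR _ hsub
  have h₂ := hS _ hsub
  rw [dirac_bind] at h₁ h₂
  exact h a (hμ a ha) _ rfl k _ _ h₁ h₂

/-- The length of the given sequence works for all sequences, as their terminal parts agree at that
length. -/
theorem UniqueNFOn.uniformOn {P : PARS A} {D : Set (SubDist A)} (h : P.UniqueNFOn D) :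
    P.UniformOn D := by
  rintro p - μ hμ ⟨ρ, ⟨n, hn⟩, hp⟩
  refine ⟨n, fun ρ' hρ' => ?_⟩
  rwa [nf, h μ hμ n ρ' ρ hρ' hn]

theorem nf_le_one (μ : SubDist A) : P.nf μ ≤ 1 := (P.term μ).sum_le

/-- Mass on terminal elements stays where it is. -/
theorem Lift.nf_le {P : PARS A} {μ ν : SubDist A} (h : P.Lift μ ν) : P.nf μ ≤ P.nf ν := by
  obtain ⟨ρ, -, h⟩ := h
  refine ENNReal.tsum_le_tsum fun a => ?_
  by_cases ht : P.Terminal a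
  · have h₁ : P.term ν a = ν a := if_pos ht
    rw [h₁, h]
    exact le_self_add
  · exact (if_neg ht : P.term μ a = 0).trans_le zero_le

/-- Along a sequence the degrees increase, and the `n`-th one is that of every reduct in `n` steps.
A single sequence therefore exhausts the supremum over all reducts. -/
theorem UniqueNFOn.converges {P : PARS A} {D : Set (SubDist A)} (h : P.UniqueNFOn D)
    {μ : SubDist A} (hμ : μ ∈ D) : ∃ p ≤ 1, P.Converges μ p ∧
      ∀ ρ : ℕ → SubDist A, ρ 0 = μ → (∀ n, P.Lift (ρ n) (ρ (n + 1))) →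
        Tendsto (fun n => P.nf (ρ n)) atTop (𝓝 p) := by
  have hlub := isLUB_sSup {q | ∃ ρ, P.LiftStar μ ρ ∧ q = P.nf ρ}
  refine ⟨_, ?_, hlub, fun ρ h₀ hρ => ?_⟩
  · refine hlub.2 ?_
    rintro _ ⟨ρ, -, rfl⟩
    exact P.nf_le_one ρ
  · have hN : ∀ n, P.LiftN n μ (ρ n) := fun n => by
      induction n with
      | zero => exact h₀.symm
      | succ n ih => exact ih.succ (hρ n)
    refine tendsto_atTop_isLUB (monotone_nat_of_le_succ fun n => (hρ n).nf_le) ⟨?_, fun q hq => ?_⟩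
    · rintro _ ⟨n, rfl⟩
      exact hlub.1 ⟨ρ n, ⟨n, hN n⟩, rfl⟩
    · refine hlub.2 ?_
      rintro _ ⟨ν, ⟨n, hn⟩, rfl⟩
      rw [nf, h μ hμ n ν (ρ n) hn (hN n)]
      exact hq ⟨n, rfl⟩

/-- Two distributions are joined by one step of all the elements of their supports. -/
def Joined (μ ξ : SubDist A) : Prop :=
  ∃ F G : A → SubDist A, (∀ b ∈ μ.support, P.rel b (F b)) ∧ (∀ b ∈ ξ.support, P.rel b (G b)) ∧
    μ.bind F = ξ.bind G

/-- A conflict relation on the elements that satisfy an invariant: it persists along reductions,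
and distinct outcomes of a reduction are in conflict. -/
structure IsConflict (Q : A → Prop) (conf : A → A → Prop) : Prop where
  closed : ∀ {a μ b}, Q a → P.rel a μ → b ∈ μ.support → Q b
  symm : ∀ {a b}, conf a b → conf b a
  irrefl : ∀ {a}, Q a → ¬ conf a a
  persist : ∀ {a c μ b}, Q a → conf a c → P.rel a μ → b ∈ μ.support → conf b c
  outcomes : ∀ {a μ b c}, Q a → P.rel a μ → b ∈ μ.support → c ∈ μ.support → b ≠ c → conf b c

/-- The distributions on elements that satisfy `Q` in whose support any two distinct elements are
in conflict. -/
def conflictClass (Q : A → Prop) (conf : A → A → Prop) : Set (SubDist A) :=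
  {μ | (∀ a ∈ μ.support, Q a) ∧ ∀ a ∈ μ.support, ∀ b ∈ μ.support, a ≠ b → conf a b}

namespace IsConflict

variable {P} {Q : A → Prop} {conf : A → A → Prop}

theorem closed' (hQ : P.IsConflict Q conf) {a : A} {κ : SubDist A} {b : A} (ha : Q a)
    (h : P.StepOrStay a κ) (hb : b ∈ κ.support) : Q b := by
  rcases h with ⟨-, rfl⟩ | h
  · rwa [mem_support_dirac.1 hb]
  · exact hQ.closed ha h hb

theorem persist' (hQ : P.IsConflict Q conf) {a c : A} {κ : SubDist A} {b : A} (ha : Q a)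
    (hc : conf a c) (h : P.StepOrStay a κ) (hb : b ∈ κ.support) : conf b c := by
  rcases h with ⟨-, rfl⟩ | h
  · rwa [mem_support_dirac.1 hb]
  · exact hQ.persist ha hc h hb

theorem persist₂ (hQ : P.IsConflict Q conf) {a a' : A} {κ κ' : SubDist A} {b b' : A} (ha : Q a)
    (ha' : Q a') (hc : conf a a') (h : P.StepOrStay a κ) (h' : P.StepOrStay a' κ')
    (hb : b ∈ κ.support) (hb' : b' ∈ κ'.support) : conf b b' :=
  hQ.symm (hQ.persist' ha' (hQ.symm (hQ.persist' ha hc h hb)) h' hb')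

theorem dirac_mem {a : A} (ha : Q a) : dirac a ∈ conflictClass Q conf := by
  refine ⟨fun b hb => ?_, fun b hb c hc hbc => ?_⟩
  · rwa [mem_support_dirac.1 hb]
  · exact absurd ((mem_support_dirac.1 hb).trans (mem_support_dirac.1 hc).symm) hbc

theorem lift_mem (hQ : P.IsConflict Q conf) {μ ν : SubDist A} (hμ : μ ∈ conflictClass Q conf)
    (h : P.Lift μ ν) : ν ∈ conflictClass Q conf := by
  obtain ⟨F, hF, rfl⟩ := P.lift_iff.1 h
  refine ⟨fun b hb => ?_, fun b hb c hc hbc => ?_⟩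
  · obtain ⟨a, ha, hb⟩ := mem_support_bind.1 hb
    exact hQ.closed' (hμ.1 a ha) (hF a ha) hb
  · obtain ⟨a, ha, hb⟩ := mem_support_bind.1 hb
    obtain ⟨a', ha', hc⟩ := mem_support_bind.1 hc
    by_cases haa : a = a'
    · subst haa
      rcases hF a ha with ⟨-, h⟩ | h
      · rw [h] at hb hc
        exact absurd ((mem_support_dirac.1 hb).trans (mem_support_dirac.1 hc).symm) hbc
      · exact hQ.outcomes (hμ.1 a ha) h hb hc hbc
    · exact hQ.persist₂ (hμ.1 a ha) (hμ.1 a' ha') (hμ.2 a ha a' ha' haa) (hF a ha) (hF a' ha') hb hc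

/-- If the two distributions are properly joined, all elements of their supports reduce and both
terminal parts vanish; if they are equal, any common continuation will do. -/
theorem joined_stepOrStay (hJ : ∀ a, Q a → ∀ μ ξ, P.rel a μ → P.rel a ξ → μ = ξ ∨ P.Joined μ ξ)
    {a : A} (ha : Q a) {κ κ' : SubDist A} (h : P.StepOrStay a κ) (h' : P.StepOrStay a κ') :
    P.term κ = P.term κ' ∧ ∃ f g : A → SubDist A, (∀ b ∈ κ.support, P.StepOrStay b (f b)) ∧
      (∀ b ∈ κ'.support, P.StepOrStay b (g b)) ∧ κ.bind f = κ'.bind g := by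
  have key : κ = κ' ∨ P.Joined κ κ' := by
    rcases h with ⟨ht, rfl⟩ | h
    · rcases h' with ⟨-, rfl⟩ | h'
      · exact .inl rfl
      · exact absurd h' (ht _)
    · rcases h' with ⟨ht, -⟩ | h'
      · exact absurd h (ht _)
      · exact hJ a ha κ κ' h h'
  rcases key with rfl | ⟨f, g, hf, hg, hfg⟩
  · choose F hF using P.exists_stepOrStay
    exact ⟨rfl, F, F, fun b _ => hF b, fun b _ => hF b, rfl⟩
  · have zero : ∀ {ν : SubDist A} {k : A → SubDist A}, (∀ b ∈ ν.support, P.rel b (k b)) → ∀ b,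
        P.term ν b = 0 := by
      intro ν k hk b
      by_cases ht : P.Terminal b
      · by_contra hb
        have : P.term ν b = ν b := if_pos ht
        rw [this] at hb
        exact ht _ (hk b hb)
      · exact if_neg ht
    exact ⟨ext_apply fun b => (zero hf b).trans (zero hg b).symm, f, g, fun b hb => .inr (hf b hb),
      fun b hb => .inr (hg b hb), hfg⟩

/-- Completions chosen for each element of `μ` can be glued along a lifting of `μ`, as no element
is reached from two elements of the support of `μ`. -/
theorem glue (hQ : P.IsConflict Q conf) {μ : SubDist A} (hμ : μ ∈ conflictClass Q conf)
    {F : A → SubDist A} (hF : ∀ a ∈ μ.support, P.StepOrStay a (F a)) {f : A → A → SubDist A}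
    (hf : ∀ a ∈ μ.support, ∀ b ∈ (F a).support, P.StepOrStay b (f a b)) :
    P.Lift (μ.bind F) (μ.bind fun a => (F a).bind (f a)) := by
  classical
  -- Two sources of the same `b` would be in conflict, and by persistence `b` would be in conflict
  -- with itself. So `b` determines its source, and thereby the completion to be applied to it.
  have huniq : ∀ a ∈ μ.support, ∀ a' ∈ μ.support, ∀ b ∈ (F a).support, b ∈ (F a').support →
      a = a' := by
    intro a ha a' ha' b hb hb'
    by_contra hne
    exact hQ.irrefl (hQ.closed' (hμ.1 a ha) (hF a ha) hb)
      (hQ.persist₂ (hμ.1 a ha) (hμ.1 a' ha') (hμ.2 a ha a' ha' hne) (hF a ha) (hF a' ha') hb hb')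
  let Φ : A → SubDist A := fun b =>
    if h : ∃ a ∈ μ.support, b ∈ (F a).support then f h.choose b else dirac b
  have hΦ : ∀ a ∈ μ.support, ∀ b ∈ (F a).support, Φ b = f a b := by
    intro a ha b hb
    have h : ∃ a ∈ μ.support, b ∈ (F a).support := ⟨a, ha, hb⟩
    have h₁ : Φ b = f h.choose b := dif_pos h
    rw [h₁, huniq a ha _ h.choose_spec.1 b hb h.choose_spec.2]
  refine P.lift_iff.2 ⟨Φ, fun b hb => ?_, ?_⟩
  · obtain ⟨a, ha, hb⟩ := mem_support_bind.1 hb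
    rw [hΦ a ha b hb]
    exact hf a ha b hb
  · rw [bind_assoc]
    exact bind_congr fun a ha => bind_congr fun b hb => (hΦ a ha b hb).symm

/-- The joins chosen at each element are glued along both liftings. The two glued averages agree
because they agree element by element. -/
theorem diamondOn (hQ : P.IsConflict Q conf)
    (hJ : ∀ a, Q a → ∀ μ ξ, P.rel a μ → P.rel a ξ → μ = ξ ∨ P.Joined μ ξ) :
    P.DiamondOn (conflictClass Q conf) := by
  intro μ hμ ν ξ hν hξ
  obtain ⟨F, hF, rfl⟩ := P.lift_iff.1 hν
  obtain ⟨G, hG, rfl⟩ := P.lift_iff.1 hξ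
  have key := fun (a : A) (ha : a ∈ μ.support) =>
    joined_stepOrStay hJ (hμ.1 a ha) (hF a ha) (hG a ha)
  refine ⟨?_, ?_⟩
  · rw [P.term_apply_bind, P.term_apply_bind]
    exact bind_congr fun a ha => (key a ha).1
  · have key' : ∀ a, ∃ f g : A → SubDist A, a ∈ μ.support →
        (∀ b ∈ (F a).support, P.StepOrStay b (f b)) ∧
        (∀ b ∈ (G a).support, P.StepOrStay b (g b)) ∧ (F a).bind f = (G a).bind g := by
      intro a
      by_cases ha : a ∈ μ.support
      · obtain ⟨f, g, h⟩ := (key a ha).2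
        exact ⟨f, g, fun _ => h⟩
      · exact ⟨dirac, dirac, fun h => absurd h ha⟩
    choose f g hfg using key'
    refine ⟨_, hQ.glue hμ hF fun a ha => (hfg a ha).1, ?_⟩
    rw [bind_congr fun a ha => (hfg a ha).2.2]
    exact hQ.glue hμ hG fun a ha => (hfg a ha).2.1

end IsConflict

/-- All the properties of the lifting that follow from a conflict relation and from joinability of
the reductions of an element. -/
theorem IsConflict.main {P : PARS A} {Q : A → Prop} {conf : A → A → Prop}
    (hQ : P.IsConflict Q conf)
    (hJ : ∀ a, Q a → ∀ μ ξ, P.rel a μ → P.rel a ξ → μ = ξ ∨ P.Joined μ ξ) :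
    P.DiamondOn (conflictClass Q conf) ∧ P.ConfluentOn (conflictClass Q conf) ∧
      P.UniqueNFOn {μ | ∀ a ∈ μ.support, Q a} := by
  have hD := hQ.diamondOn hJ
  have hc : ∀ μ ∈ conflictClass Q conf, ∀ ν, P.Lift μ ν → ν ∈ conflictClass Q conf :=
    fun μ hμ ν h => hQ.lift_mem hμ h
  refine ⟨hD, hD.confluentOn hc, P.uniqueNFOn_of_dirac fun a ha μ hμ => ?_⟩
  rw [Set.mem_singleton_iff.1 hμ]
  exact hD.term_eq hc _ (IsConflict.dirac_mem ha)

end PARS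

/-! ### Crossings of nodes: determinism in both directions. -/

/-- The crossings of a node or of a door by a token: it leaves the position `p` in the direction `d`
and arrives in `q` with the direction `d'`. The tokens enter a `⊥`-box by an auxiliary door only in
the copies selected by `C`. -/
inductive NodeSpec.Cross {E S L : Type*} (C : S → List Sig → Prop) :
    NodeSpec E S L → Dir → Pos E → Dir → Pos E → Prop
  | ax_l {a b s t} : Cross C (.ax a b) .up ⟨a, s, t⟩ .down ⟨b, s, t⟩
  | ax_r {a b s t} : Cross C (.ax a b) .up ⟨b, s, t⟩ .down ⟨a, s, t⟩
  | cut_l {a b s t} : Cross C (.cut a b) .down ⟨a, s, t⟩ .up ⟨b, s, t⟩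
  | cut_r {a b s t} : Cross C (.cut a b) .down ⟨b, s, t⟩ .up ⟨a, s, t⟩
  | tensor_dl {a b c s t} : Cross C (.tensor a b c) .down ⟨a, s, t⟩ .down ⟨c, .l s, t⟩
  | tensor_dr {a b c s t} : Cross C (.tensor a b c) .down ⟨b, s, t⟩ .down ⟨c, .r s, t⟩
  | tensor_ul {a b c s t} : Cross C (.tensor a b c) .up ⟨c, .l s, t⟩ .up ⟨a, s, t⟩
  | tensor_ur {a b c s t} : Cross C (.tensor a b c) .up ⟨c, .r s, t⟩ .up ⟨b, s, t⟩
  | par_dl {a b c s t} : Cross C (.par a b c) .down ⟨a, s, t⟩ .down ⟨c, .l s, t⟩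
  | par_dr {a b c s t} : Cross C (.par a b c) .down ⟨b, s, t⟩ .down ⟨c, .r s, t⟩
  | par_ul {a b c s t} : Cross C (.par a b c) .up ⟨c, .l s, t⟩ .up ⟨a, s, t⟩
  | par_ur {a b c s t} : Cross C (.par a b c) .up ⟨c, .r s, t⟩ .up ⟨b, s, t⟩
  | der_d {a c s t} : Cross C (.der a c) .down ⟨a, s, t⟩ .down ⟨c, .sig .star s, t⟩
  | der_u {a c s t} : Cross C (.der a c) .up ⟨c, .sig .star s, t⟩ .up ⟨a, s, t⟩
  | contr_dl {a b c σ s t} :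
      Cross C (.contr a b c) .down ⟨a, .sig σ s, t⟩ .down ⟨c, .sig (.l σ) s, t⟩
  | contr_dr {a b c σ s t} :
      Cross C (.contr a b c) .down ⟨b, .sig σ s, t⟩ .down ⟨c, .sig (.r σ) s, t⟩
  | contr_ul {a b c σ s t} :
      Cross C (.contr a b c) .up ⟨c, .sig (.l σ) s, t⟩ .up ⟨a, .sig σ s, t⟩
  | contr_ur {a b c σ s t} :
      Cross C (.contr a b c) .up ⟨c, .sig (.r σ) s, t⟩ .up ⟨b, .sig σ s, t⟩
  | sync {l ports s t} {x : E × E} : x ∈ ports →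
      Cross C (.sync l ports) .down ⟨x.1, s, t⟩ .down ⟨x.2, s, t⟩
  | bang_d {S a e aux σ s t} :
      Cross C (.bang S a e aux) .down ⟨a, s, σ :: t⟩ .down ⟨e, .sig σ s, t⟩
  | bang_u {S a e aux σ s t} :
      Cross C (.bang S a e aux) .up ⟨e, .sig σ s, t⟩ .up ⟨a, s, σ :: t⟩
  | bang_aux_d {S a e aux σ τ s t} {x : E × E} : x ∈ aux →
      Cross C (.bang S a e aux) .down ⟨x.1, .sig τ s, σ :: t⟩ .down ⟨x.2, .sig (.pair σ τ) s, t⟩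
  | bang_aux_u {S a e aux σ τ s t} {x : E × E} : x ∈ aux →
      Cross C (.bang S a e aux) .up ⟨x.2, .sig (.pair σ τ) s, t⟩ .up ⟨x.1, .sig τ s, σ :: t⟩
  | ybox_d {S a f e aux σ s t} : (∀ σ₁ σ₂, σ ≠ .y σ₁ σ₂) →
      Cross C (.ybox S a f e aux) .down ⟨a, s, σ :: t⟩ .down ⟨e, .sig σ s, t⟩
  | ybox_u {S a f e aux σ s t} : (∀ σ₁ σ₂, σ ≠ .y σ₁ σ₂) →
      Cross C (.ybox S a f e aux) .up ⟨e, .sig σ s, t⟩ .up ⟨a, s, σ :: t⟩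
  | ybox_call {S a f e aux σ τ s t} :
      Cross C (.ybox S a f e aux) .down ⟨f, .sig τ s, σ :: t⟩ .up ⟨a, s, .y σ τ :: t⟩
  | ybox_return {S a f e aux σ τ s t} :
      Cross C (.ybox S a f e aux) .down ⟨a, s, .y σ τ :: t⟩ .up ⟨f, .sig τ s, σ :: t⟩
  | ybox_aux_d {S a f e aux σ τ s t} {x : E × E} : x ∈ aux →
      Cross C (.ybox S a f e aux) .down ⟨x.1, .sig τ s, σ :: t⟩ .down ⟨x.2, .sig (.pair σ τ) s, t⟩
  | ybox_aux_u {S a f e aux σ τ s t} {x : E × E} : x ∈ aux →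
      Cross C (.ybox S a f e aux) .up ⟨x.2, .sig (.pair σ τ) s, t⟩ .up ⟨x.1, .sig τ s, σ :: t⟩
  | bot_d0 {S₀ S₁ e₀ e₁ e aux s t} {x : E × E × E} : x ∈ aux →
      Cross C (.botbox S₀ S₁ e₀ e₁ e aux) .down ⟨x.1, s, t⟩ .down ⟨x.2.2, s, t⟩
  | bot_d1 {S₀ S₁ e₀ e₁ e aux s t} {x : E × E × E} : x ∈ aux →
      Cross C (.botbox S₀ S₁ e₀ e₁ e aux) .down ⟨x.2.1, s, t⟩ .down ⟨x.2.2, s, t⟩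
  | bot_u0 {S₀ S₁ e₀ e₁ e aux s t} {x : E × E × E} : x ∈ aux → C S₀ t →
      Cross C (.botbox S₀ S₁ e₀ e₁ e aux) .up ⟨x.2.2, s, t⟩ .up ⟨x.1, s, t⟩
  | bot_u1 {S₀ S₁ e₀ e₁ e aux s t} {x : E × E × E} : x ∈ aux → C S₁ t →
      Cross C (.botbox S₀ S₁ e₀ e₁ e aux) .up ⟨x.2.2, s, t⟩ .up ⟨x.2.1, s, t⟩
  | choice0 {S₀ S₁ e₀ e₁ e aux t} :
      Cross C (.botbox S₀ S₁ e₀ e₁ e aux) .up ⟨e, .nil, t⟩ .up ⟨e₀, .nil, t⟩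
  | choice1 {S₀ S₁ e₀ e₁ e aux t} :
      Cross C (.botbox S₀ S₁ e₀ e₁ e aux) .up ⟨e, .nil, t⟩ .up ⟨e₁, .nil, t⟩

namespace NodeSpec.Cross

variable {E S L : Type*} {C C' : S → List Sig → Prop} {sp : NodeSpec E S L} {d d' : Dir}
  {p q : Pos E}

theorem _root_.List.Nodup.inj_of_map {α β : Type*} {f : α → β} {l : List α} (h : (l.map f).Nodup)
    {x y : α} (hx : x ∈ l) (hy : y ∈ l) (hf : f x = f y) : x = y :=
  List.inj_on_of_nodup_map h hx hy hf

grind_pattern List.Nodup.inj_of_map => (l.map f).Nodup, x ∈ l, y ∈ l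

theorem mono (h : Cross C sp d p d' q) (hC : ∀ S t, C S t → C' S t) : Cross C' sp d p d' q := by
  cases h
  case bot_u0 hx h => exact .bot_u0 hx (hC _ _ h)
  case bot_u1 hx h => exact .bot_u1 hx (hC _ _ h)
  all_goals constructor <;> assumption

/-- As an edge has one source and at most one target, this makes the position and the direction
determine the node that is crossed. -/
theorem exit (h : Cross C sp d p d' q) :
    d = .down ∧ p.edge ∈ sp.targets ∨ d = .up ∧ p.edge ∈ sp.concls := by
  cases h <;> simp [targets, concls, prems, doors] <;> grind

theorem arrive (h : Cross C sp d p d' q) :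
    d' = .up ∧ q.edge ∈ sp.targets ∨ d' = .down ∧ q.edge ∈ sp.concls := by
  cases h <;> simp [targets, concls, prems, doors] <;> grind

-- The stacks record the premise or door by which the token came. In a `Y`-box, the signatures `y`
-- tell a call from an entry by the principal door. Only the auxiliary doors of a `⊥`-box record
-- nothing and so merge the two contents.
set_option maxHeartbeats 4000000 in
theorem back_det (hc : sp.concls.Nodup) (ht : sp.targets.Nodup) {d₂ p₂ q₂}
    (h : Cross C sp d p d' q) (h₂ : Cross C' sp d₂ p₂ d' q₂) (hq : q = q₂) :
    p = p₂ ∨ ∃ S₀ S₁ e₀ e₁ e aux, sp = .botbox S₀ S₁ e₀ e₁ e aux ∧ ∃ x ∈ aux, ∃ s t,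
      (p = ⟨x.1, s, t⟩ ∧ p₂ = ⟨x.2.1, s, t⟩ ∨ p₂ = ⟨x.1, s, t⟩ ∧ p = ⟨x.2.1, s, t⟩) := by
  cases h <;> simp [targets, concls, prems, doors, List.nodup_append, Function.comp_def] at hc ht <;>
    cases h₂ <;> simp only [Pos.mk.injEq, reduceCtorEq, false_and, and_false] at hq <;> grind

end NodeSpec.Cross

namespace NodeSpec.Cross

variable {E S L : Type*} {C C' : S → List Sig → Prop} {sp : NodeSpec E S L} {d d' : Dir}
  {p q : Pos E}

-- The only branchings are at a `⊥`-box: the choice at the principal door, and entry by an auxiliary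
-- door when both contents are open.
set_option maxHeartbeats 1000000 in
theorem fwd_det (hc : sp.concls.Nodup) (ht : sp.targets.Nodup) {p₂ d₂' q₂}
    (h : Cross C sp d p d' q) (h₂ : Cross C sp d p₂ d₂' q₂) (hp : p = p₂) :
    q = q₂ ∨ ∃ S₀ S₁ e₀ e₁ e aux, sp = .botbox S₀ S₁ e₀ e₁ e aux ∧
      (C S₀ p.box ∧ C S₁ p.box ∨ p.edge = e) := by
  cases h <;> simp [targets, concls, prems, doors, List.nodup_append, Function.comp_def] at hc ht <;>
    cases h₂ <;> simp only [Pos.mk.injEq, reduceCtorEq, false_and, and_false] at hp <;> grind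

end NodeSpec.Cross

/-! ### Occurrences indicated by stacks, and duality. -/

def Occ.dual : Occ → Occ
  | one => bot
  | bot => one
  | bang => quest
  | quest => bang

namespace Stk

theorem indicates_sig_bang {s : Stk} (hs : s ≠ .delta) (σ : Sig) (A : Formula) :
    (sig σ s).indicates (.bang A) = s.indicates A := by
  cases s <;> first | rfl | exact absurd rfl hs

theorem indicates_sig_quest {s : Stk} (hs : s ≠ .delta) (σ : Sig) (A : Formula) :
    (sig σ s).indicates (.quest A) = s.indicates A := by
  cases s <;> first | rfl | exact absurd rfl hs

theorem indicates_sig_sig (σ τ : Sig) (s : Stk) (A : Formula) :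
    (sig σ s).indicates (.quest A) = (sig τ s).indicates (.quest A) := by
  cases s <;> rfl

theorem indicates_dual (s : Stk) (A : Formula) :
    s.indicates A.dual = (s.indicates A).map Occ.dual := by
  induction A generalizing s with
  | one | bot =>
    cases s with
    | sig σ s => cases s <;> rfl
    | _ => rfl
  | tensor A B hA hB | par A B hA hB =>
    cases s with
    | sig σ s => cases s <;> rfl
    | l s => exact hA s
    | r s => exact hB s
    | _ => rfl
  | bang A hA =>
    cases s with
    | sig σ s =>
      by_cases hs : s = .delta
      · subst hs; rfl
      · rw [Formula.dual, indicates_sig_quest hs, indicates_sig_bang hs, hA]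
    | _ => rfl
  | quest A hA =>
    cases s with
    | sig σ s =>
      by_cases hs : s = .delta
      · subst hs; rfl
      · rw [Formula.dual, indicates_sig_quest hs, indicates_sig_bang hs, hA]
    | _ => rfl

end Stk

namespace NodeSpec.Cross

variable {E S L : Type*} {C C' : S → List Sig → Prop} {sp : NodeSpec E S L} {d d' : Dir}
  {p q : Pos E}

theorem stk_ne_delta (h : Cross C sp d p .down q) (hp : p.stk ≠ .delta) : q.stk ≠ .delta := by
  cases h <;> first | exact hp | exact Stk.noConfusion

/-- The token keeps pointing at the same occurrence. It is seen in the dual formula exactly when the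
direction is reversed, at axioms, cuts, and calls and returns of a `Y`-box. -/
theorem indicates {ty : E → Formula} (hty : sp.Typed ty) (h : Cross C sp d p d' q)
    (hp : p.stk ≠ .delta) (hq : q.stk ≠ .delta) :
    d = d' ∧ q.stk.indicates (ty q.edge) = p.stk.indicates (ty p.edge) ∨
      d ≠ d' ∧ q.stk.indicates (ty q.edge) = (p.stk.indicates (ty p.edge)).map Occ.dual := by
  have inv : ∀ o : Option Occ, (o.map Occ.dual).map Occ.dual = o := by
    rintro (_ | _ | _ | _ | _) <;> rfl
  cases h
  case ax_l => exact .inr ⟨Dir.noConfusion, by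
    rw [show ty _ = _ from hty]
    exact Stk.indicates_dual _ _⟩
  case ax_r => exact .inr ⟨Dir.noConfusion, by
    dsimp only
    rw [show ty _ = _ from hty, Stk.indicates_dual, inv]⟩
  case cut_l => exact .inr ⟨Dir.noConfusion, by
    rw [show ty _ = _ from hty]
    exact Stk.indicates_dual _ _⟩
  case cut_r => exact .inr ⟨Dir.noConfusion, by
    dsimp only
    rw [show ty _ = _ from hty, Stk.indicates_dual, inv]⟩
  case ybox_call => exact .inr ⟨Dir.noConfusion, by
    dsimp only at hq ⊢
    rw [hty.2.1, Stk.indicates_sig_quest hq, Stk.indicates_dual, inv]⟩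
  case ybox_return => exact .inr ⟨Dir.noConfusion, by
    dsimp only at hp ⊢
    rw [hty.2.1, Stk.indicates_sig_quest hp, Stk.indicates_dual]⟩
  case tensor_dl => exact .inl ⟨rfl, by rw [show ty _ = _ from hty]; rfl⟩
  case tensor_dr => exact .inl ⟨rfl, by rw [show ty _ = _ from hty]; rfl⟩
  case tensor_ul => exact .inl ⟨rfl, by rw [show ty _ = _ from hty]; rfl⟩
  case tensor_ur => exact .inl ⟨rfl, by rw [show ty _ = _ from hty]; rfl⟩
  case par_dl => exact .inl ⟨rfl, by rw [show ty _ = _ from hty]; rfl⟩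
  case par_dr => exact .inl ⟨rfl, by rw [show ty _ = _ from hty]; rfl⟩
  case par_ul => exact .inl ⟨rfl, by rw [show ty _ = _ from hty]; rfl⟩
  case par_ur => exact .inl ⟨rfl, by rw [show ty _ = _ from hty]; rfl⟩
  case der_d => exact .inl ⟨rfl, by
    rw [show ty _ = _ from hty]; exact Stk.indicates_sig_quest hp _ _⟩
  case der_u => exact .inl ⟨rfl, by
    rw [show ty _ = _ from hty]; exact (Stk.indicates_sig_quest hq _ _).symm⟩
  case bang_d => exact .inl ⟨rfl, by
    rw [hty.1]; exact Stk.indicates_sig_bang hp _ _⟩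
  case bang_u => exact .inl ⟨rfl, by
    rw [hty.1]; exact (Stk.indicates_sig_bang hq _ _).symm⟩
  case ybox_d => exact .inl ⟨rfl, by
    rw [hty.1]; exact Stk.indicates_sig_bang hp _ _⟩
  case ybox_u => exact .inl ⟨rfl, by
    rw [hty.1]; exact (Stk.indicates_sig_bang hq _ _).symm⟩
  case sync hx => exact .inl ⟨rfl, by dsimp only; rw [(hty _ hx).2]⟩
  case bot_d0 hx => exact .inl ⟨rfl, by dsimp only; rw [(hty.2.2.2.2 _ hx).1]⟩
  case bot_d1 hx => exact .inl ⟨rfl, by dsimp only; rw [(hty.2.2.2.2 _ hx).2]⟩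
  case bot_u0 hx _ => exact .inl ⟨rfl, by dsimp only; rw [(hty.2.2.2.2 _ hx).1]⟩
  case bot_u1 hx _ => exact .inl ⟨rfl, by dsimp only; rw [(hty.2.2.2.2 _ hx).2]⟩
  case choice0 => exact .inl ⟨rfl, by dsimp only; rw [hty.1, hty.2.1]⟩
  case choice1 => exact .inl ⟨rfl, by dsimp only; rw [hty.1, hty.2.2.1]⟩
  case contr_dl | contr_dr | contr_ul | contr_ur =>
    obtain ⟨A, h₁, h₂, h₃⟩ := hty
    exact .inl ⟨rfl, by dsimp only; simp only [h₁, h₂, h₃]; exact Stk.indicates_sig_sig _ _ _ _⟩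
  case bang_aux_d hx | bang_aux_u hx =>
    obtain ⟨A, h₁, h₂⟩ := hty.2 _ hx
    exact .inl ⟨rfl, by dsimp only; rw [h₁, h₂]; exact Stk.indicates_sig_sig _ _ _ _⟩
  case ybox_aux_d hx | ybox_aux_u hx =>
    obtain ⟨A, h₁, h₂⟩ := hty.2.2 _ hx
    exact .inl ⟨rfl, by dsimp only; rw [h₁, h₂]; exact Stk.indicates_sig_sig _ _ _ _⟩

end NodeSpec.Cross

/-! ### Directions of positions, and arcs between them. -/

namespace PreNet

variable {L : Type*} (R : PreNet L)

theorem source_unique {e : R.Edge} {n n' : R.Node} (h : e ∈ (R.spec n).concls)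
    (h' : e ∈ (R.spec n').concls) : n = n' :=
  (R.source e).unique h h'

theorem content_ne_root {n : R.Node} {S : R.Str} (h : S ∈ (R.spec n).contents) : S ≠ R.root := by
  rintro rfl
  have := R.depth_content n _ h
  rw [R.depth_root] at this
  omega

theorem content_unique {n n' : R.Node} {S : R.Str} (h : S ∈ (R.spec n).contents)
    (h' : S ∈ (R.spec n').contents) : n = n' :=
  (R.box_unique S (R.content_ne_root h)).unique h h'

variable {R}

/-- The direction `up` or `down` is that of the polarity of the occurrence indicated. -/
def _root_.Occ.dir : Occ → Dir
  | .one => .down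
  | .bot => .up
  | .bang => .up
  | .quest => .down

theorem dir_eq_iff {p : Pos R.Edge} {d : Dir} (hd : d ≠ .stable) : R.dir p = some d ↔
    p.stk ≠ .delta ∧ (∀ n, R.spec n ≠ .bot p.edge) ∧
      ∃ o, p.stk.indicates (R.ty p.edge) = some o ∧ o.dir = d := by
  unfold dir
  split_ifs with h
  · refine ⟨fun h' => absurd (Option.some.inj h').symm hd, fun ⟨h₁, h₂, _⟩ => ?_⟩
    rcases h with h | ⟨n, h⟩
    · exact absurd h h₁
    · exact absurd h (h₂ n)
  · rw [not_or, not_exists] at h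
    rcases p.stk.indicates (R.ty p.edge) with _ | _ | _ | _ | _ <;>
      simp [h.1, Occ.dir] <;> intro h' <;> exact h.2

theorem dir_stable_iff {p : Pos R.Edge} :
    R.dir p = some .stable ↔ p.stk = .delta ∨ ∃ n, R.spec n = .bot p.edge := by
  unfold dir
  split_ifs with h
  · exact ⟨fun _ => h, fun _ => rfl⟩
  · refine ⟨fun h' => ?_, fun h' => absurd h' h⟩
    revert h'
    rcases p.stk.indicates (R.ty p.edge) with _ | _ | _ | _ | _ <;> simp

/-- Polarity fixes the direction, and both are reversed by the same crossings. A crossing can end in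
a stable position only upwards: downward ones never produce `δ`, and none of them crosses a `bot`
node. -/
theorem cross_dir {C : R.Str → List Sig → Prop} {n : R.Node} {d d' : Dir} {p q : Pos R.Edge}
    (hd : R.dir p = some d) (h : (R.spec n).Cross C d p d' q) :
    R.dir q = some d' ∨ d' = .up ∧ R.dir q = some .stable := by
  have hne : d ≠ .stable := by
    rcases h.exit with h | h <;> rw [h.1] <;> exact Dir.noConfusion
  have hne' : d' ≠ .stable := by
    rcases h.arrive with h | h <;> rw [h.1] <;> exact Dir.noConfusion
  obtain ⟨hp, -, o, ho, hod⟩ := (dir_eq_iff hne).1 hd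
  by_cases hs : R.dir q = some .stable
  · refine .inr ⟨?_, hs⟩
    rcases h.arrive with h' | ⟨rfl, hq⟩
    · exact h'.1
    · rcases dir_stable_iff.1 hs with h' | ⟨k, hk⟩
      · exact absurd h' (h.stk_ne_delta hp)
      · obtain rfl : k = n := R.source_unique (e := q.edge) (by rw [hk]; simp [NodeSpec.concls]) hq
        rw [hk] at h
        cases h
  · rw [dir_stable_iff, not_or, not_exists] at hs
    refine .inl ((dir_eq_iff hne').2 ⟨hs.1, hs.2, ?_⟩)
    have hdown : d = .up ∨ d = .down := by
      rcases h.exit with h | h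
      · exact .inr h.1
      · exact .inl h.1
    have hdown' : d' = .up ∨ d' = .down := by
      rcases h.arrive with h | h
      · exact .inl h.1
      · exact .inr h.1
    rcases h.indicates (R.typed n) hp hs.1 with ⟨h₁, h₂⟩ | ⟨h₁, h₂⟩
    · exact ⟨o, h₂.trans ho, hod.trans h₁⟩
    · refine ⟨o.dual, by rw [h₂, ho]; rfl, ?_⟩
      subst hod
      cases o <;> rcases hdown' with rfl | rfl <;> first | rfl | exact absurd rfl h₁

/-- The position `q` is reached from the position `p` by crossing one node or one door. -/
def Arc (R : PreNet L) (C : R.Str → List Sig → Prop) (p q : Pos R.Edge) : Prop :=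
  ∃ n d d', R.dir p = some d ∧ (R.spec n).Cross C d p d' q

theorem Arc.mono {C C' : R.Str → List Sig → Prop} (hC : ∀ S t, C S t → C' S t) {p q : Pos R.Edge}
    (h : R.Arc C p q) : R.Arc C' p q := by
  obtain ⟨n, d, d', h₁, h₂⟩ := h
  exact ⟨n, d, d', h₁, h₂.mono hC⟩

theorem Arc.dir_ne {C : R.Str → List Sig → Prop} {p q : Pos R.Edge} (h : R.Arc C p q) :
    R.dir p ≠ some .stable := by
  obtain ⟨n, d, d', h₁, h₂⟩ := h
  rw [h₁]
  rcases h₂.exit with h | h <;> rw [h.1] <;> simp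

/-- The copies of the two contents of a `⊥`-box are never left towards the same position, as long as
they are not both entered. -/
theorem Arc.source_eq {C C' : R.Str → List Sig → Prop} {p p' q : Pos R.Edge}
    (h : R.Arc C p q) (h' : R.Arc C' p' q) : p = p' ∨
      ∃ n S₀ S₁ e₀ e₁ e aux, R.spec n = .botbox S₀ S₁ e₀ e₁ e aux ∧ p.box = p'.box ∧
        (R.strE p.edge = S₀ ∧ R.strE p'.edge = S₁ ∨ R.strE p'.edge = S₀ ∧ R.strE p.edge = S₁) := by
  obtain ⟨n, d, d', hd, hc⟩ := h
  obtain ⟨n₂, d₂, d₂', hd₂, hc₂⟩ := h'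
  -- The direction is a function of the position, and a downward arrival is never stable. So both
  -- crossings arrive in the same direction, hence from the same node.
  have hdd : d' = d₂' ∧ n = n₂ := by
    rcases hc.arrive with ⟨rfl, hq⟩ | ⟨rfl, hq⟩ <;> rcases hc₂.arrive with ⟨rfl, hq₂⟩ | ⟨rfl, hq₂⟩
    · exact ⟨rfl, R.target_unique _ _ _ hq hq₂⟩
    · rcases cross_dir hd hc with h | h <;> rcases cross_dir hd₂ hc₂ with h' | h' <;> simp_all
    · rcases cross_dir hd hc with h | h <;> rcases cross_dir hd₂ hc₂ with h' | h' <;> simp_all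
    · exact ⟨rfl, R.source_unique hq hq₂⟩
  obtain ⟨rfl, rfl⟩ := hdd
  rcases hc.back_det (R.concls_nodup n) (R.targets_nodup n) hc₂ rfl with h | h
  · exact .inl h
  · obtain ⟨S₀, S₁, e₀, e₁, e, aux, hsp, x, hx, s, t, h⟩ := h
    have h₀ : R.strE x.1 = S₀ := R.str_doors n (S₀, x.1) (by
      rw [hsp]; simp only [NodeSpec.doors, List.mem_cons, List.mem_append, List.mem_map]
      exact .inr (.inr (.inl ⟨x, hx, rfl⟩)))
    have h₁ : R.strE x.2.1 = S₁ := R.str_doors n (S₁, x.2.1) (by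
      rw [hsp]; simp only [NodeSpec.doors, List.mem_cons, List.mem_append, List.mem_map]
      exact .inr (.inr (.inr ⟨x, hx, rfl⟩)))
    refine .inr ⟨n, S₀, S₁, e₀, e₁, e, aux, hsp, ?_⟩
    rcases h with ⟨rfl, rfl⟩ | ⟨rfl, rfl⟩
    · exact ⟨rfl, .inl ⟨h₀, h₁⟩⟩
    · exact ⟨rfl, .inr ⟨h₀, h₁⟩⟩

/-- An initial position goes up on an edge that ends in no node; nothing crosses a `one` node; and
`*.δ` below a `?d` node could only come from `δ` above it, which is stable. -/
theorem Arc.target_not_isStart {C : R.Str → List Sig → Prop} {p q : Pos R.Edge}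
    (h : R.Arc C p q) : ¬ R.IsStart q := by
  obtain ⟨n, d, d', hd, hc⟩ := h
  have key : ∀ n' : R.Node, q.edge ∈ (R.spec n').concls → (q.stk ≠ .delta) →
      (∃ o, q.stk.indicates (R.ty q.edge) = some o ∧ o.dir = .down) →
      (∀ k, R.spec k ≠ .bot q.edge) → d' = .down ∧ n = n' := by
    intro n' hq' h₁ h₂ h₃
    have := (dir_eq_iff (p := q) (d := .down) (by exact Dir.noConfusion)).2 ⟨h₁, h₃, h₂⟩
    rcases hc.arrive with ⟨rfl, hq⟩ | ⟨rfl, hq⟩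
    · rcases cross_dir hd hc with h | h
      · rw [this] at h; cases h
      · rw [this] at h; cases h.2
    · exact ⟨rfl, R.source_unique hq hq'⟩
  rintro (⟨-, he, -, hup⟩ | ⟨-, ⟨k, hk⟩, hs⟩ | ⟨-, ⟨k, a, hk⟩, hs⟩)
  · rcases hc.arrive with ⟨rfl, hq⟩ | ⟨rfl, hq⟩
    · exact he.2 n hq
    · rcases cross_dir hd hc with h | h
      · rw [hup] at h; cases h
      · cases h.1
  · have hmem : q.edge ∈ (R.spec k).concls := by rw [hk]; simp [NodeSpec.concls]
    have hty : R.ty q.edge = .one := by have := R.typed k; rwa [hk] at this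
    obtain ⟨rfl, rfl⟩ := key k hmem (by rw [hs]; exact Stk.noConfusion)
      ⟨.one, by rw [hs, hty]; rfl, rfl⟩ (fun j hj => by
        obtain rfl : j = k := R.source_unique (by rw [hj]; simp [NodeSpec.concls]) hmem
        rw [hk] at hj; cases hj)
    rw [hk] at hc
    cases hc
  · have hmem : q.edge ∈ (R.spec k).concls := by rw [hk]; simp [NodeSpec.concls]
    have hty : R.ty q.edge = .quest (R.ty a) := by have := R.typed k; rwa [hk] at this
    obtain ⟨rfl, rfl⟩ := key k hmem (by rw [hs]; exact Stk.noConfusion)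
      ⟨.quest, by rw [hs, hty]; rfl, rfl⟩ (fun j hj => by
        obtain rfl : j = k := R.source_unique (by rw [hj]; simp [NodeSpec.concls]) hmem
        rw [hk] at hj; cases hj)
    rw [hk] at hc
    generalize q.edge = c at *
    obtain ⟨e, s, t⟩ := q
    dsimp only at hs
    subst hs
    cases hc
    exact (dir_eq_iff (by exact Dir.noConfusion)).1 hd |>.1 rfl

end PreNet

/-! ### Token states: open copies, histories and changes. -/

namespace PreNet

variable {L : Type*} {R : PreNet L}

namespace State

theorem copies_principal {T : R.State} {S : R.Str} {t : List Sig} (hS : S ≠ R.root)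
    (h : t ∈ T.Copies S) : ∃ e s, R.IsPrincipal S e ∧ R.dir ⟨e, s, t⟩ = some .stable ∧
      T.On ⟨e, s, t⟩ :=
  h.resolve_left fun h => hS h.1

/-- A content belongs to a single box, whose two contents differ, so `e₀` is the only principal
premise on the side of `S₀`. -/
theorem copies_left {T : R.State} {n S₀ S₁ e₀ e₁ e aux t}
    (hn : R.spec n = .botbox S₀ S₁ e₀ e₁ e aux) (h : t ∈ T.Copies S₀) : ∃ s, T.On ⟨e₀, s, t⟩ := by
  have hmem : S₀ ∈ (R.spec n).contents := by rw [hn]; simp [NodeSpec.contents]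
  have hnd := R.contents_nodup n
  rw [hn] at hnd
  obtain ⟨a, s, ha, -, hon⟩ := copies_principal (R.content_ne_root hmem) h
  have key : ∀ k, S₀ ∈ (R.spec k).contents → k = n := fun k hk => R.content_unique hk hmem
  rcases ha with ⟨k, b, aux', hk⟩ | ⟨k, f, b, aux', hk⟩ | ⟨k, T₁, e₁', b, aux', hk⟩ |
    ⟨k, T₀, e₀', b, aux', hk⟩ <;> (
      obtain rfl := key k (by rw [hk]; simp [NodeSpec.contents])
      rw [hn] at hk
      cases hk)
  · exact ⟨s, hon⟩
  · simp [NodeSpec.contents] at hnd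

theorem copies_right {T : R.State} {n S₀ S₁ e₀ e₁ e aux t}
    (hn : R.spec n = .botbox S₀ S₁ e₀ e₁ e aux) (h : t ∈ T.Copies S₁) : ∃ s, T.On ⟨e₁, s, t⟩ := by
  have hmem : S₁ ∈ (R.spec n).contents := by rw [hn]; simp [NodeSpec.contents]
  have hnd := R.contents_nodup n
  rw [hn] at hnd
  obtain ⟨a, s, ha, -, hon⟩ := copies_principal (R.content_ne_root hmem) h
  have key : ∀ k, S₁ ∈ (R.spec k).contents → k = n := fun k hk => R.content_unique hk hmem
  rcases ha with ⟨k, b, aux', hk⟩ | ⟨k, f, b, aux', hk⟩ | ⟨k, T₁, e₁', b, aux', hk⟩ |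
    ⟨k, T₀, e₀', b, aux', hk⟩ <;> (
      obtain rfl := key k (by rw [hk]; simp [NodeSpec.contents])
      rw [hn] at hk
      cases hk)
  · simp [NodeSpec.contents] at hnd
  · exact ⟨s, hon⟩

theorem _root_.PreNet.IsPrincipal.strE {S : R.Str} {e : R.Edge} (h : R.IsPrincipal S e) :
    R.strE e = S := by
  rcases h with ⟨k, b, aux', hk⟩ | ⟨k, f, b, aux', hk⟩ | ⟨k, T₁, e₁', b, aux', hk⟩ |
    ⟨k, T₀, e₀', b, aux', hk⟩ <;>
      exact R.str_doors k (S, e) (by rw [hk]; simp [NodeSpec.doors])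

/-- Every copy of a content of a `⊥`-box around the copy `t` of the structure `S` is open. -/
inductive Good (T : R.State) : R.Str → List Sig → Prop
  | root (t) : Good T R.root t
  | exp {n S σ t} : S ∈ (R.spec n).contents → (R.spec n).boxInc = 1 → Good T (R.strN n) t →
      Good T S (σ :: t)
  | bot {n S t} : S ∈ (R.spec n).contents → (R.spec n).boxInc = 0 → t ∈ T.Copies S →
      Good T (R.strN n) t → Good T S t

theorem Good.mono {T U : R.State} (h : ∀ S, T.Copies S ⊆ U.Copies S) {S : R.Str} {t : List Sig}
    (hT : T.Good S t) : U.Good S t := by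
  induction hT with
  | root t => exact .root t
  | exp h₁ h₂ _ ih => exact .exp h₁ h₂ ih
  | bot h₁ h₂ h₃ _ ih => exact .bot h₁ h₂ (h _ h₃) ih

theorem Good.of_exp {T : R.State} {n : R.Node} {S : R.Str} {σ : Sig} {t : List Sig}
    (hS : S ∈ (R.spec n).contents) (hn : (R.spec n).boxInc = 1) (h : T.Good S (σ :: t)) :
    T.Good (R.strN n) t := by
  cases h with
  | root => exact absurd rfl (R.content_ne_root hS)
  | exp h₁ _ h₃ => rwa [R.content_unique hS h₁]
  | bot h₁ h₂ => rw [R.content_unique h₁ hS, hn] at h₂; exact absurd h₂ one_ne_zero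

theorem Good.of_bot {T : R.State} {n : R.Node} {S : R.Str} {t : List Sig}
    (hS : S ∈ (R.spec n).contents) (hn : (R.spec n).boxInc = 0) (h : T.Good S t) :
    t ∈ T.Copies S ∧ T.Good (R.strN n) t := by
  cases h with
  | root => exact absurd rfl (R.content_ne_root hS)
  | exp h₁ h₂ => rw [R.content_unique h₁ hS, hn] at h₂; exact absurd h₂ zero_ne_one
  | bot h₁ _ h₃ h₄ => rw [R.content_unique hS h₁]; exact ⟨h₃, h₄⟩

/-- An auxiliary door of a `⊥`-box leads only into open copies. At the principal door the arriving
token itself opens the copy, whence the assumption that `U` has a token in `q`. -/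
theorem Good.cross {U : R.State} {n : R.Node} {d d' : Dir} {p q : Pos R.Edge}
    (hp : U.Good (R.strE p.edge) p.box)
    (h : (R.spec n).Cross (fun S t => t ∈ U.Copies S) d p d' q) (hq : U.On q) :
    U.Good (R.strE q.edge) q.box := by
  have hpre := R.str_prems n
  have hcon := R.str_concls n
  have hdoor := R.str_doors n
  have hin : ∀ S ∈ (R.spec n).contents, ∀ t, (R.spec n).boxInc = 0 → U.Good S t →
      U.Good (R.strN n) t := fun S hS t hn h => (h.of_bot hS hn).2
  have hex : ∀ S ∈ (R.spec n).contents, ∀ σ t, (R.spec n).boxInc = 1 → U.Good S (σ :: t) →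
      U.Good (R.strN n) t := fun S hS σ t hn h => h.of_exp hS hn
  have hex' : ∀ S ∈ (R.spec n).contents, ∀ σ t, (R.spec n).boxInc = 1 → U.Good (R.strN n) t →
      U.Good S (σ :: t) := fun S hS σ t hn h => .exp hS hn h
  have hbot' : ∀ S ∈ (R.spec n).contents, ∀ t, (R.spec n).boxInc = 0 → t ∈ U.Copies S →
      U.Good (R.strN n) t → U.Good S t := fun S hS t hn h h' => .bot hS hn h h'
  have hb : ∀ S₀ S₁ e₀ e₁ e aux, R.spec n = .botbox S₀ S₁ e₀ e₁ e aux →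
      (∀ s t, U.On ⟨e₀, s, t⟩ → t ∈ U.Copies S₀) ∧ ∀ s t, U.On ⟨e₁, s, t⟩ → t ∈ U.Copies S₁ := by
    intro S₀ S₁ e₀ e₁ e aux h
    obtain ⟨h₀, h₁⟩ := R.bot_of_box n _ _ _ _ _ _ h
    exact ⟨fun s t hon => .inr ⟨e₀, s, .inr (.inr (.inl ⟨n, _, _, _, _, h⟩)),
        dir_stable_iff.2 (.inr h₀), hon⟩,
      fun s t hon => .inr ⟨e₁, s, .inr (.inr (.inr ⟨n, _, _, _, _, h⟩)),
        dir_stable_iff.2 (.inr h₁), hon⟩⟩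
  generalize hsp : R.spec n = sp at *
  cases h <;> simp only [NodeSpec.prems, NodeSpec.concls, NodeSpec.doors, NodeSpec.contents,
    NodeSpec.boxInc, List.forall_mem_cons, List.forall_mem_append, List.forall_mem_map,
    List.not_mem_nil, false_imp_iff, implies_true, and_true, forall_const, one_ne_zero,
    zero_ne_one] at hpre hcon hdoor hin hex hex' hbot' hp ⊢
  case choice0 =>
    have hc := (hb _ _ _ _ _ _ rfl).1 _ _ hq
    rw [hcon.1] at hp
    rw [hdoor.1]
    exact hbot'.1 _ hc hp
  case choice1 =>
    have hc := (hb _ _ _ _ _ _ rfl).2 _ _ hq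
    rw [hcon.1] at hp
    rw [hdoor.2.1]
    exact hbot'.2 _ hc hp
  all_goals clear hb hq; grind

/-- The token in `p` can move to `q`. -/
def Fire (T : R.State) (p q : Pos R.Edge) : Prop :=
  T.On p ∧ R.Arc (fun S t => t ∈ T.Copies S) p q ∧ R.IsPos q

/-- The positions in `P` are those that tokens have left in a run that leads to the state `T`. -/
structure History (T : R.State) (P : Set (Pos R.Edge)) : Prop where
  left : ∀ p ∈ P, ¬ T.On p
  visited : ∀ q, q ∈ P ∨ T.On q → (R.IsStart q ∧ ∃ p, (p, q) ∈ T.tok) ∨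
    ∃ p ∈ P, R.Arc (fun _ _ => True) p q
  good : ∀ q, q ∈ P ∨ T.On q → T.Good (R.strE q.edge) q.box
  exclusive : ∀ {n S₀ S₁ e₀ e₁ e aux s s' t}, R.spec n = .botbox S₀ S₁ e₀ e₁ e aux →
    T.On ⟨e₀, s, t⟩ → ¬ T.On ⟨e₁, s', t⟩

namespace History

variable {T : R.State} {P : Set (Pos R.Edge)}

theorem not_both_copies (hT : T.History P) {n S₀ S₁ e₀ e₁ e aux t}
    (hn : R.spec n = .botbox S₀ S₁ e₀ e₁ e aux) (h₀ : t ∈ T.Copies S₀) : t ∉ T.Copies S₁ := by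
  intro h₁
  obtain ⟨s, hs⟩ := copies_left hn h₀
  obtain ⟨s', hs'⟩ := copies_right hn h₁
  exact hT.exclusive hn hs hs'

/-- Distinct predecessors would lie in the two contents of one `⊥`-box with the same box stack;
visited positions lie in open copies, so both copies would be open. -/
theorem arc_injective (hT : T.History P) {C C' : R.Str → List Sig → Prop} {p p' q : Pos R.Edge}
    (hp : p ∈ P ∨ T.On p) (hp' : p' ∈ P ∨ T.On p') (h : R.Arc C p q) (h' : R.Arc C' p' q) :
    p = p' := by
  rcases h.source_eq h' with h | ⟨n, S₀, S₁, e₀, e₁, e, aux, hn, hbox, hs⟩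
  · exact h
  · have h₀ : S₀ ∈ (R.spec n).contents := by rw [hn]; simp [NodeSpec.contents]
    have h₁ : S₁ ∈ (R.spec n).contents := by rw [hn]; simp [NodeSpec.contents]
    have hi : (R.spec n).boxInc = 0 := by rw [hn]; rfl
    have hg := hT.good p hp
    have hg' := hT.good p' hp'
    rcases hs with ⟨rfl, rfl⟩ | ⟨rfl, rfl⟩
    · exact absurd (hg'.of_bot h₁ hi).1 (hT.not_both_copies hn (hbox ▸ (hg.of_bot h₀ hi).1))
    · exact absurd (hg.of_bot h₁ hi).1 (hT.not_both_copies hn (hbox ▸ (hg'.of_bot h₀ hi).1))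

/-- An earlier visit of `q` came from a position that was left. By injectivity that position is `p`,
which still holds a token. -/
theorem fire_fresh (hT : T.History P) {p q : Pos R.Edge} (h : T.Fire p q) : ¬ (q ∈ P ∨ T.On q) := by
  intro hq
  rcases hT.visited q hq with hs | ⟨p', hp', h'⟩
  · exact h.2.1.target_not_isStart hs.1
  · have := hT.arc_injective (.inr h.1) (.inl hp') h.2.1 h'
    subst this
    exact hT.left p hp' h.1

theorem start_fresh (hT : T.History P) {q : Pos R.Edge} (h : R.IsStart q)
    (h' : ∀ p, (p, q) ∉ T.tok) : ¬ (q ∈ P ∨ T.On q) := by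
  intro hq
  rcases hT.visited q hq with ⟨-, p, hp⟩ | ⟨p', hp', ha⟩
  · exact h' p hp
  · exact ha.target_not_isStart h

end History

/-- A change of the tokens of `T`: those in the positions of `D` move along `f`, and one may be
added. -/
structure Change (T : R.State) (D : Set (Pos R.Edge)) (f : Pos R.Edge → Pos R.Edge)
    (new : Option (Pos R.Edge)) : Prop where
  fixed : ∀ p ∉ D, f p = p
  fire : ∀ p ∈ D, T.Fire p (f p)
  new_isPos : ∀ p, new = some p → R.IsPos p
  new_isStart : ∀ p, new = some p → R.IsStart p
  new_orig : ∀ p, new = some p → ∀ q, (q, p) ∉ T.tok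
  new_copies : ∀ p, new = some p → p.box ∈ T.Copies (R.strE p.edge)

/-- The tokens after a change. -/
def changed (T : R.State) (f : Pos R.Edge → Pos R.Edge) (new : Option (Pos R.Edge)) :
    Set (Pos R.Edge × Pos R.Edge) :=
  {x | (∃ p, (p, x.2) ∈ T.tok ∧ x.1 = f p) ∨ (x.1 = x.2 ∧ new = some x.1)}

section Change

variable {T U : R.State} {P D : Set (Pos R.Edge)} {f : Pos R.Edge → Pos R.Edge}
  {new : Option (Pos R.Edge)}

theorem on_changed (hU : U.tok = T.changed f new) {q : Pos R.Edge} :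
    U.On q ↔ (∃ p, T.On p ∧ q = f p) ∨ new = some q := by
  unfold On
  rw [hU]
  constructor
  · rintro ⟨o, ⟨p, hp, h⟩ | ⟨-, h⟩⟩
    · exact .inl ⟨p, ⟨o, hp⟩, h⟩
    · exact .inr h
  · rintro (⟨p, ⟨o, hp⟩, h⟩ | h)
    · exact ⟨o, .inl ⟨p, hp, h⟩⟩
    · exact ⟨q, .inr ⟨rfl, h⟩⟩

namespace Change

theorem injective (hT : T.History P) (hc : T.Change D f new) {p p' : Pos R.Edge} (hp : T.On p)
    (hp' : T.On p') (h : f p = f p') : p = p' := by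
  by_cases hd : p ∈ D <;> by_cases hd' : p' ∈ D
  · have h₁ := hc.fire p hd
    have h₂ := hc.fire p' hd'
    rw [h] at h₁
    exact hT.arc_injective (.inr hp) (.inr hp') h₁.2.1 h₂.2.1
  · have h₁ := hc.fire p hd
    rw [h, hc.fixed p' hd'] at h₁
    exact absurd (.inr hp') (hT.fire_fresh h₁)
  · have h₁ := hc.fire p' hd'
    rw [← h, hc.fixed p hd] at h₁
    exact absurd (.inr hp) (hT.fire_fresh h₁)
  · rwa [hc.fixed p hd, hc.fixed p' hd'] at h

theorem ne_new (hT : T.History P) (hc : T.Change D f new) {p : Pos R.Edge} (hp : T.On p) :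
    new ≠ some (f p) := by
  intro h
  by_cases hd : p ∈ D
  · exact (hc.fire p hd).2.1.target_not_isStart (hc.new_isStart _ h)
  · rw [hc.fixed p hd] at h
    exact hT.start_fresh (hc.new_isStart _ h) (hc.new_orig _ h) (.inr hp)

/-- Moved tokens land in distinct positions, free in `T` and different from the new one, so origins
remain a well-defined injective map. -/
theorem exists_state (hT : T.History P) (hc : T.Change D f new) :
    ∃ U : R.State, U.tok = T.changed f new := by
  refine ⟨⟨T.changed f new, ?_, ?_, ?_, ?_⟩, rfl⟩
  · rintro p o (⟨q, hq, h⟩ | ⟨h₁, h⟩)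
    · dsimp only at hq h
      subst h
      by_cases hd : q ∈ D
      · exact (hc.fire q hd).2.2
      · rw [hc.fixed q hd]
        exact T.isPos _ _ hq
    · exact hc.new_isPos p h
  · rintro p o (⟨q, hq, h⟩ | ⟨h₁, h⟩)
    · exact T.isStart _ _ hq
    · dsimp only at h₁ h
      subst h₁
      exact hc.new_isStart p h
  · rintro p o o' (⟨q, hq, h⟩ | ⟨h₁, h⟩) (⟨q', hq', h'⟩ | ⟨h₁', h'⟩) <;>
      dsimp only at *
    · obtain rfl := hc.injective hT ⟨_, hq⟩ ⟨_, hq'⟩ (h.symm.trans h')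
      exact T.functional _ _ _ hq hq'
    · exact absurd (h ▸ h') (hc.ne_new hT ⟨_, hq⟩)
    · exact absurd (h' ▸ h) (hc.ne_new hT ⟨_, hq'⟩)
    · exact h₁.symm.trans h₁'
  · rintro p p' o (⟨q, hq, h⟩ | ⟨h₁, h⟩) (⟨q', hq', h'⟩ | ⟨h₁', h'⟩) <;>
      dsimp only at *
    · rw [h, h', T.injective _ _ _ hq hq']
    · subst h₁'
      exact absurd hq (hc.new_orig _ h' _)
    · subst h₁
      exact absurd hq' (hc.new_orig _ h _)
    · exact h₁.trans h₁'.symm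

theorem on_stable (hc : T.Change D f new) (hU : U.tok = T.changed f new) {p : Pos R.Edge}
    (hp : T.On p) (hs : R.dir p = some .stable) : U.On p := by
  refine (on_changed hU).2 (.inl ⟨p, hp, (hc.fixed p fun hd => ?_).symm⟩)
  exact (hc.fire p hd).2.1.dir_ne hs

/-- Copies are opened by stable tokens, and these never move. -/
theorem copies_subset (hc : T.Change D f new) (hU : U.tok = T.changed f new) (S : R.Str) :
    T.Copies S ⊆ U.Copies S := by
  rintro t (h | ⟨e, s, h₁, h₂, h₃⟩)
  · exact .inl h
  · exact .inr ⟨e, s, h₁, h₂, hc.on_stable hU h₃ h₂⟩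

/-- The premises of the principal door of a `⊥`-box are only reached from its conclusion. -/
theorem _root_.PreNet.Arc.to_principal {C : R.Str → List Sig → Prop} {p : Pos R.Edge}
    {n S₀ S₁ e₀ e₁ e aux e' s t} (hn : R.spec n = .botbox S₀ S₁ e₀ e₁ e aux)
    (he : e' = e₀ ∨ e' = e₁) (h : R.Arc C p ⟨e', s, t⟩) : p = ⟨e, .nil, t⟩ := by
  obtain ⟨k, d, d', hd, hc⟩ := h
  have hb := R.bot_of_box n _ _ _ _ _ _ hn
  have hbot : ∃ j, R.spec j = .bot e' := by
    rcases he with rfl | rfl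
    · exact hb.1
    · exact hb.2
  have hmem : e' ∈ (R.spec n).targets := by
    rw [hn]
    rcases he with rfl | rfl <;> simp [NodeSpec.targets, NodeSpec.doors]
  have hup : d' = .up ∧ k = n := by
    rcases hc.arrive with h | h
    · exact ⟨h.1, R.target_unique _ _ _ h.2 hmem⟩
    · obtain ⟨j, hj⟩ := hbot
      obtain rfl : j = k := R.source_unique (by rw [hj]; simp [NodeSpec.concls]) h.2
      rw [hj] at hc
      cases hc
  obtain ⟨rfl, rfl⟩ := hup
  have hnd := R.targets_nodup k
  have hnd' := R.concls_nodup k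
  rw [hn] at hc hnd hnd'
  generalize hq : (⟨e', s, t⟩ : Pos R.Edge) = q at hc
  simp [NodeSpec.targets, NodeSpec.prems, NodeSpec.doors, NodeSpec.concls] at hnd hnd'
  cases hc <;> simp only [Pos.mk.injEq] at hq <;> grind

theorem history (hT : T.History P) (hc : T.Change D f new) (hU : U.tok = T.changed f new) :
    U.History (P ∪ D) := by
  have hcop := hc.copies_subset hU
  have horig : ∀ q, (∃ p, (p, q) ∈ T.tok) → ∃ p, (p, q) ∈ U.tok := by
    rintro q ⟨p, hp⟩
    rw [hU]
    exact ⟨f p, .inl ⟨p, hp, rfl⟩⟩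
  have hvis : ∀ q, q ∈ P ∪ D ∨ U.On q → (q ∈ P ∨ T.On q) ∨ (∃ p ∈ D, q = f p) ∨ new = some q := by
    rintro q ((h | h) | h)
    · exact .inl (.inl h)
    · exact .inl (.inr (hc.fire q h).1)
    · rcases (on_changed hU).1 h with ⟨p, hp, rfl⟩ | h
      · by_cases hd : p ∈ D
        · exact .inr (.inl ⟨p, hd, rfl⟩)
        · rw [hc.fixed p hd]
          exact .inl (.inr hp)
      · exact .inr (.inr h)
  refine ⟨?_, ?_, ?_, ?_⟩
  · intro p hp hon
    rcases (on_changed hU).1 hon with ⟨q, hq, h⟩ | h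
    · by_cases hd : q ∈ D
      · refine hT.fire_fresh (hc.fire q hd) ?_
        rw [← h]
        exact hp.imp id fun h => (hc.fire p h).1
      · rw [hc.fixed q hd] at h
        subst h
        exact hp.elim (fun h => hT.left p h hq) hd
    · exact hT.start_fresh (hc.new_isStart _ h) (hc.new_orig _ h)
        (hp.imp id fun h => (hc.fire p h).1)
  · intro q hq
    rcases hvis q hq with h | ⟨p, hp, rfl⟩ | h
    · rcases hT.visited q h with ⟨h₁, h₂⟩ | ⟨p, hp, h⟩
      · exact .inl ⟨h₁, horig q h₂⟩
      · exact .inr ⟨p, .inl hp, h⟩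
    · exact .inr ⟨p, .inr hp, (hc.fire p hp).2.1.mono fun _ _ _ => trivial⟩
    · refine .inl ⟨hc.new_isStart q h, q, ?_⟩
      rw [hU]
      exact .inr ⟨rfl, h⟩
  · intro q hq
    rcases hvis q hq with h | ⟨p, hp, rfl⟩ | h
    · exact (hT.good q h).mono hcop
    · have hf := hc.fire p hp
      obtain ⟨n, d, d', hd, hx⟩ := hf.2.1
      refine Good.cross ((hT.good p (.inr hf.1)).mono hcop) (hx.mono fun S t h => hcop S h) ?_
      exact (on_changed hU).2 (.inl ⟨p, hf.1, rfl⟩)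
    · rcases hc.new_copies q h with ⟨h₁, -⟩ | ⟨e, s, h₁, h₂, h₃⟩
      · rw [h₁]
        exact .root _
      · have := (hT.good ⟨e, s, q.box⟩ (.inr h₃)).mono hcop
        rwa [h₁.strE] at this
  · intro n S₀ S₁ e₀ e₁ e aux s s' t hn h₀ h₁
    have hb := R.bot_of_box n _ _ _ _ _ _ hn
    -- A token on a premise of the principal door comes from its conclusion: either that position
    -- was left earlier, or it is left in this change.
    have key : ∀ e' s, e' = e₀ ∨ e' = e₁ → (∃ k, R.spec k = .bot e') → U.On ⟨e', s, t⟩ →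
        (T.On ⟨e', s, t⟩ ∧ ∃ p ∈ P, p = ⟨e, .nil, t⟩) ∨
          ∃ p ∈ D, p = ⟨e, .nil, t⟩ ∧ ⟨e', s, t⟩ = f p := by
      intro e' s he hbot hon
      have hns : ∀ {V : Prop}, R.IsStart ⟨e', s, t⟩ → V := by
        intro V hs
        exfalso
        obtain ⟨k, hk⟩ := hbot
        rcases hs with ⟨-, -, -, hup⟩ | ⟨-, ⟨j, hj⟩, -⟩ | ⟨-, ⟨j, a, hj⟩, -⟩
        · rw [dir_stable_iff.2 (.inr ⟨k, hk⟩)] at hup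
          cases hup
        all_goals
          obtain rfl : j = k := R.source_unique (e := e') (by rw [hj]; simp [NodeSpec.concls])
            (by rw [hk]; simp [NodeSpec.concls])
          rw [hj] at hk
          cases hk
      rcases (on_changed hU).1 hon with ⟨p, hp, h⟩ | h
      · by_cases hd : p ∈ D
        · have := (hc.fire p hd).2.1
          rw [← h] at this
          exact .inr ⟨p, hd, this.to_principal hn he, h⟩
        · rw [hc.fixed p hd] at h
          rw [← h] at hp
          refine .inl ⟨hp, ?_⟩
          rcases hT.visited _ (.inr hp) with h | ⟨p', hp', h⟩
          · exact hns h.1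
          · exact ⟨p', hp', h.to_principal hn he⟩
      · exact hns (hc.new_isStart _ h)
    -- Both tokens old: excluded in `T`. One old and one new: the conclusion would have been left
    -- and yet hold a token. Both new: `f` would have two values at the conclusion.
    rcases key e₀ s (.inl rfl) hb.1 h₀ with ⟨h₂, p, hp, rfl⟩ | ⟨p, hp, rfl, h₂⟩ <;>
      rcases key e₁ s' (.inr rfl) hb.2 h₁ with ⟨h₃, p', hp', rfl⟩ | ⟨p', hp', rfl, h₃⟩
    · exact hT.exclusive hn h₂ h₃
    · exact hT.left _ hp (hc.fire _ hp').1
    · exact hT.left _ hp' (hc.fire _ hp).1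
    · have := congrArg Pos.edge (h₂.trans h₃.symm)
      dsimp only at this
      have hnd := R.targets_nodup n
      rw [hn] at hnd
      simp [NodeSpec.targets, NodeSpec.prems, NodeSpec.doors] at hnd
      exact hnd.1.1 this

variable {D' : Set (Pos R.Edge)} {f' : Pos R.Edge → Pos R.Edge} {new' : Option (Pos R.Edge)}

/-- A change persists after an independent one. -/
theorem persist (hc : T.Change D f new) (hc' : T.Change D' f' new')
    (hU : U.tok = T.changed f new) (hD : Disjoint D D')
    (hnew : ∀ p, new = some p → new' ≠ some p) : U.Change D' f' new' where
  fixed := hc'.fixed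
  fire := fun p hp => by
    have h := hc'.fire p hp
    refine ⟨(on_changed hU).2 (.inl ⟨p, h.1, (hc.fixed p ?_).symm⟩),
      h.2.1.mono fun S t h => hc.copies_subset hU S h, h.2.2⟩
    exact fun hd => Set.disjoint_left.1 hD hd hp
  new_isPos := hc'.new_isPos
  new_isStart := hc'.new_isStart
  new_orig := fun p hp q hq => by
    rw [hU] at hq
    rcases hq with ⟨q', hq', -⟩ | ⟨h, h'⟩
    · exact hc'.new_orig p hp _ hq'
    · dsimp only at h h'
      subst h
      exact hnew _ h' hp
  new_copies := fun p hp => hc.copies_subset hU _ (hc'.new_copies p hp)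

/-- Independent changes commute. -/
theorem commute (hT : T.History P) (hc : T.Change D f new) (hc' : T.Change D' f' new')
    (hD : Disjoint D D') {U' V V' : R.State} (hU : U.tok = T.changed f new)
    (hU' : U'.tok = T.changed f' new') (hV : V.tok = U.changed f' new')
    (hV' : V'.tok = U'.changed f new) : V = V' := by
  -- A moved token lands where `T` has no token, hence outside the domain of the other change.
  have hff : ∀ p, T.On p → f' (f p) = f (f' p) := by
    intro p hp
    by_cases hd : p ∈ D
    · rw [hc'.fixed p (Set.disjoint_left.1 hD hd), hc'.fixed]
      exact fun h => hT.fire_fresh (hc.fire p hd) (.inr (hc'.fire _ h).1)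
    · rw [hc.fixed p hd]
      by_cases hd' : p ∈ D'
      · rw [hc.fixed]
        exact fun h => hT.fire_fresh (hc'.fire p hd') (.inr (hc.fire _ h).1)
      · rw [hc'.fixed p hd', hc.fixed p hd]
  have hn : ∀ p, new = some p → f' p = p := fun p hp => hc'.fixed p fun h =>
    hT.start_fresh (hc.new_isStart p hp) (hc.new_orig p hp) (.inr (hc'.fire p h).1)
  have hn' : ∀ p, new' = some p → f p = p := fun p hp => hc.fixed p fun h =>
    hT.start_fresh (hc'.new_isStart p hp) (hc'.new_orig p hp) (.inr (hc.fire p h).1)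
  ext1
  rw [hV, hV']
  ext ⟨q, o⟩
  simp only [changed, hU, hU', Set.mem_ofPred_eq]
  constructor
  · rintro (⟨p, ⟨r, hr, rfl⟩ | ⟨rfl, h⟩, rfl⟩ | ⟨rfl, h⟩)
    · exact .inl ⟨f' r, .inl ⟨r, hr, rfl⟩, hff r ⟨_, hr⟩⟩
    · rw [hn _ h]
      exact .inr ⟨rfl, h⟩
    · exact .inl ⟨q, .inr ⟨rfl, h⟩, (hn' _ h).symm⟩
  · rintro (⟨p, ⟨r, hr, rfl⟩ | ⟨rfl, h⟩, rfl⟩ | ⟨rfl, h⟩)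
    · exact .inl ⟨f r, .inl ⟨r, hr, rfl⟩, (hff r ⟨_, hr⟩).symm⟩
    · rw [hn' _ h]
      exact .inr ⟨rfl, h⟩
    · exact .inl ⟨q, .inr ⟨rfl, h⟩, (hn _ h).symm⟩

end Change

end Change

theorem _root_.PreNet.initState_history : (R.initState).History ∅ := by
  have hroot : ∀ q, R.initState.On q → R.IsInit q := fun q ⟨o, ho⟩ => ho.1
  refine ⟨fun p hp => absurd hp (Set.notMem_empty p), ?_, ?_, ?_⟩
  · rintro q (h | h)
    · exact absurd h (Set.notMem_empty q)
    · exact .inl ⟨.inl (hroot q h), q, hroot q h, rfl⟩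
  · rintro q (h | h)
    · exact absurd h (Set.notMem_empty q)
    · rw [(hroot q h).2.1.1]
      exact .root _
  · intro n S₀ S₁ e₀ e₁ e aux s s' t hn h _
    have h₁ := (hroot _ h).2.1.2 n
    rw [hn] at h₁
    simp [NodeSpec.targets, NodeSpec.doors] at h₁

end State
end PreNet

/-! ### Images of distributions. -/

namespace SubDist

variable {A B C : Type*}

theorem map_apply_eq_bind (f : A → B) (μ : SubDist A) : μ.map f = μ.bind fun a => dirac (f a) := by
  classical
  refine ext_apply fun b => tsum_congr fun a => ?_
  by_cases h : b = f a
  · rw [if_pos h, h, dirac_self, mul_one]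
  · rw [if_neg h, dirac_ne h, mul_zero]

theorem map_dirac (f : A → B) (a : A) : (dirac a).map f = dirac (f a) := by
  rw [map_apply_eq_bind, dirac_bind]

theorem map_bind (f : A → B) (μ : SubDist A) (F : B → SubDist C) :
    (μ.map f).bind F = μ.bind fun a => F (f a) := by
  rw [map_apply_eq_bind, bind_assoc]
  exact bind_congr fun a _ => dirac_bind _ _

theorem bind_map (f : B → C) (μ : SubDist A) (F : A → SubDist B) :
    (μ.bind F).map f = μ.bind fun a => (F a).map f := by
  simp only [map_apply_eq_bind, bind_assoc]

theorem map_map (f : A → B) (g : B → C) (μ : SubDist A) : (μ.map f).map g = μ.map (g ∘ f) := by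
  rw [map_apply_eq_bind f, bind_map, map_apply_eq_bind]
  exact bind_congr fun a _ => map_dirac _ _

theorem map_congr {f g : A → B} {μ : SubDist A} (h : ∀ a ∈ μ.support, f a = g a) :
    μ.map f = μ.map g := by
  rw [map_apply_eq_bind, map_apply_eq_bind]
  exact bind_congr fun a ha => by rw [h a ha]

theorem mem_support_map {f : A → B} {μ : SubDist A} {b : B} :
    b ∈ (μ.map f).support ↔ ∃ a ∈ μ.support, b = f a := by
  rw [map_apply_eq_bind, mem_support_bind]
  simp only [mem_support_dirac]

theorem map_equiv (e : A ≃ B) {μ : SubDist A} {ν : SubDist B} (h : ∀ a, ν (e a) = μ a) :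
    μ.map e = ν := by
  refine ext_apply fun b => ?_
  rw [map_apply_eq_bind, bind_apply, tsum_eq_single (e.symm b), e.apply_symm_apply, dirac_self,
    mul_one, ← h, e.apply_symm_apply]
  intro a ha
  rw [dirac_ne, mul_zero]
  rintro rfl
  exact ha (e.symm_apply_apply a).symm

theorem dirac_pair {a a' : A} {b b' : B} (h : dirac (a, b) (a', b') ≠ 0) : a' = a ∧ b' = b :=
  Prod.ext_iff.1 (mem_support_dirac.1 h)

end SubDist

/-! ### Actions on the memory, and their commutation. -/

/-- The actions on a memory in one transition. -/
inductive MemAct (I L : Type*)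
  | skip
  | upd (v : List I) (l : L)
  | tst (i : I)

namespace MemAct

open SubDist

variable {I M L : Type*}

def addrs : MemAct I L → Set I
  | skip => ∅
  | upd v _ => {i | i ∈ v}
  | tst i => {i}

/-- The order in which two actions are performed is irrelevant. -/
def Commute (κ κ' : M → SubDist (Bool × M)) : Prop :=
  ∀ m x y n, ∑' m', κ m (x, m') * κ' m' (y, n) = ∑' m', κ' m (y, m') * κ m' (x, n)

theorem Commute.symm {κ κ' : M → SubDist (Bool × M)} (h : Commute κ κ') : Commute κ' κ :=
  fun m x y n => (h m y x n).symm

-- Against a deterministic action one of the two sums has a single term and the other is an image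
-- along `g`; the outcome `true` has probability zero in either order.
open Classical in
theorem Commute.of_det {g : M → M} {κ : M → SubDist (Bool × M)}
    (h : ∀ m y n, κ (g m) (y, n) = ∑' m', if n = g m' then κ m (y, m') else 0) :
    Commute (fun m => dirac (false, g m)) κ := by
  intro m x y n
  dsimp only
  cases x
  · rw [tsum_eq_single (g m), dirac_self, one_mul, h]
    · refine tsum_congr fun m' => ?_
      by_cases hm : n = g m'
      · rw [if_pos hm, hm, dirac_self, mul_one]
      · rw [if_neg hm, dirac_ne (fun h => hm (Prod.ext_iff.1 h).2), mul_zero]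
    · intro m' hm'
      rw [dirac_ne (fun h => hm' (Prod.ext_iff.1 h).2), zero_mul]
  · have h₁ : ∀ m m' : M, dirac (false, m) (true, m') = 0 := fun m m' =>
      dirac_ne (fun h => Bool.noConfusion (Prod.ext_iff.1 h).1)
    simp only [h₁, zero_mul, mul_zero]

/-- The results of two commuting actions, whatever is observed of their outcomes. -/
theorem Commute.bind_eq {Ω : Type*} {κ κ' : M → SubDist (Bool × M)} (h : Commute κ κ') (m : M)
    {g g' : Bool × M → Bool × M → Ω}
    (hg : ∀ b c m₁ m₂ n, g (b, m₁) (c, n) = g' (c, m₂) (b, n)) :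
    ((κ m).bind fun x => (κ' x.2).map (g x)) = (κ' m).bind fun y => (κ y.2).map (g' y) := by
  refine ext_apply fun w => ?_
  -- The observed result ignores the intermediate memory; `m` merely fills its place.
  let D : Bool → Bool → M → ℝ≥0∞ := fun b c n => dirac (g (b, m) (c, n)) w
  have h₁ : ∀ (b c : Bool) (m' n : M), dirac (g (b, m') (c, n)) w = D b c n := fun b c m' n => by
    change _ = dirac (g (b, m) (c, n)) w
    rw [hg b c m' m n, hg b c m m n]
  have h₂ : ∀ (b c : Bool) (m' n : M), dirac (g' (c, m') (b, n)) w = D b c n := fun b c m' n => by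
    rw [← hg b c m m' n]
  simp only [map_apply_eq_bind, bind_apply, ENNReal.tsum_prod', h₁, h₂]
  calc ∑' (b : Bool) (m' : M), κ m (b, m') * ∑' (c : Bool) (n : M), κ' m' (c, n) * D b c n
      = ∑' (b : Bool) (c : Bool) (n : M), (∑' m', κ m (b, m') * κ' m' (c, n)) * D b c n := by
        refine tsum_congr fun b => ?_
        simp only [← ENNReal.tsum_mul_left, ← ENNReal.tsum_mul_right, ← mul_assoc]
        rw [ENNReal.tsum_comm]
        refine tsum_congr fun c => ?_
        rw [ENNReal.tsum_comm]
    _ = ∑' (b : Bool) (c : Bool) (n : M), (∑' m', κ' m (c, m') * κ m' (b, n)) * D b c n := by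
        simp only [h m _ _ _]
    _ = ∑' (c : Bool) (b : Bool) (n : M), (∑' m', κ' m (c, m') * κ m' (b, n)) * D b c n :=
        ENNReal.tsum_comm
    _ = ∑' (c : Bool) (m' : M), κ' m (c, m') * ∑' (b : Bool) (n : M), κ m' (b, n) * D b c n := by
        refine tsum_congr fun b => ?_
        simp only [← ENNReal.tsum_mul_left, ← ENNReal.tsum_mul_right, ← mul_assoc]
        rw [ENNReal.tsum_comm (α := M) (β := Bool)]
        refine tsum_congr fun c => ?_
        rw [ENNReal.tsum_comm]

variable [MulAction (finPerm I) M] (𝓜 : MemoryStructure I M L)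

/-- Actions that are not tests report the dummy outcome `false`. The default `m` of an update is
never taken when the action is `Defined`. -/
noncomputable def eff : MemAct I L → M → SubDist (Bool × M)
  | skip, m => dirac (false, m)
  | upd v l, m => dirac (false, (𝓜.update v l m).getD m)
  | tst i, m => 𝓜.test i m

def Defined : MemAct I L → Prop
  | skip => True
  | upd v l => v.Nodup ∧ v.length = 𝓜.arity l
  | tst _ => True

variable {𝓜}

theorem update_eq {v : List I} {l : L} (h : (upd v l).Defined 𝓜) (m : M) :
    𝓜.update v l m = some ((𝓜.update v l m).getD m) := by
  obtain ⟨m', hm'⟩ := Option.isSome_iff_exists.1 ((𝓜.update_defined v l m).2 h)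
  rw [hm']
  rfl

theorem eff_unique {a : MemAct I L} {m : M} {b : Bool} {n n' : M} (h : eff 𝓜 a m (b, n) ≠ 0)
    (h' : eff 𝓜 a m (b, n') ≠ 0) : n = n' := by
  cases a with
  | skip => exact (dirac_pair h).2.trans (dirac_pair h').2.symm
  | upd v l => exact (dirac_pair h).2.trans (dirac_pair h').2.symm
  | tst i => exact 𝓜.test_unique i m b n n' h h'

theorem commute_skip (a : MemAct I L) : Commute (eff 𝓜 skip) (eff 𝓜 a) := by
  classical
  refine Commute.of_det (g := id) fun m y n => ?_
  rw [tsum_eq_single n]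
  · exact (if_pos rfl).symm
  · exact fun m' hm' => if_neg (Ne.symm hm')

theorem commute_upd_tst {v : List I} {l : L} {j : I} (h : (upd v l).Defined 𝓜) (hj : j ∉ v) :
    Commute (eff 𝓜 (upd v l)) (eff 𝓜 (tst j)) := by
  classical
  refine Commute.of_det (g := fun m => (𝓜.update v l m).getD m) fun m y n => ?_
  refine (𝓜.test_update j v l m _ y n hj (update_eq h m)).trans ?_
  rw [← tsum_subtype_eq_of_support_subset (s := {m₀ | 𝓜.update v l m₀ = some n})]
  · refine tsum_congr fun m₀ => (if_pos ?_).symm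
    have : 𝓜.update v l m₀.1 = some n := m₀.2
    rw [this]
    rfl
  · intro m' hm'
    have : n = (𝓜.update v l m').getD m' := by
      by_contra hn
      exact hm' (if_neg hn)
    change 𝓜.update v l m' = some n
    rw [this]
    exact update_eq h m'

theorem commute_upd_upd {v v' : List I} {l l' : L} (h : (upd v l).Defined 𝓜)
    (h' : (upd v' l').Defined 𝓜) (hv : v.Disjoint v') :
    Commute (eff 𝓜 (upd v l)) (eff 𝓜 (upd v' l')) := by
  intro m x y n
  have key : (𝓜.update v l ((𝓜.update v' l' m).getD m)).getD ((𝓜.update v' l' m).getD m) =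
      (𝓜.update v' l' ((𝓜.update v l m).getD m)).getD ((𝓜.update v l m).getD m) := by
    have := 𝓜.update_update v l v' l' m hv
    rw [update_eq h m, update_eq h' m, Option.bind_some, Option.bind_some,
      update_eq h ((𝓜.update v' l' m).getD m), update_eq h' ((𝓜.update v l m).getD m)] at this
    exact Option.some.inj this
  have aux : ∀ (w w' : List I) (k k' : L) (x y : Bool),
      ∑' m', eff 𝓜 (upd w k) m (x, m') * eff 𝓜 (upd w' k') m' (y, n) =
        dirac (false, false, (𝓜.update w' k' ((𝓜.update w k m).getD m)).getD
          ((𝓜.update w k m).getD m)) (x, y, n) := by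
    intro w w' k k' x y
    rw [tsum_eq_single ((𝓜.update w k m).getD m)]
    · change dirac _ _ * dirac _ _ = _
      by_cases hxy : (x, y, n) = (false, false, (𝓜.update w' k' ((𝓜.update w k m).getD m)).getD
          ((𝓜.update w k m).getD m))
      · rw [hxy, dirac_self]
        simp only [Prod.mk.injEq] at hxy
        rw [hxy.1, hxy.2.1, hxy.2.2, dirac_self, dirac_self, one_mul]
      · rw [dirac_ne hxy]
        by_contra hne
        obtain ⟨h₁, h₂⟩ := mul_ne_zero_iff.1 hne
        exact hxy (by rw [(dirac_pair h₁).1, (dirac_pair h₂).1, (dirac_pair h₂).2])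
    · intro m' hm'
      have : eff 𝓜 (upd w k) m (x, m') = 0 := dirac_ne fun h => hm' (Prod.ext_iff.1 h).2
      rw [this, zero_mul]
  rw [aux, aux, key]
  by_cases hxy : x = y
  · rw [hxy]
  · rw [dirac_ne, dirac_ne]
    · intro h
      simp only [Prod.mk.injEq] at h
      exact hxy (h.2.1.trans h.1.symm)
    · intro h
      simp only [Prod.mk.injEq] at h
      exact hxy (h.1.trans h.2.1.symm)

theorem commute_of_disjoint {a b : MemAct I L} (ha : a.Defined 𝓜) (hb : b.Defined 𝓜)
    (h : Disjoint a.addrs b.addrs) : Commute (eff 𝓜 a) (eff 𝓜 b) := by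
  rw [Set.disjoint_left] at h
  match a, b, ha, hb, h with
  | skip, b, _, _, _ => exact commute_skip b
  | a, skip, _, _, _ => exact (commute_skip a).symm
  | upd v l, upd v' l', ha, hb, h => exact commute_upd_upd ha hb fun _ hi hi' => h hi hi'
  | upd v l, tst j, ha, _, h => exact commute_upd_tst ha fun hi => h hi rfl
  | tst j, upd v l, _, hb, h => exact (commute_upd_tst hb fun hi => h rfl hi).symm
  | tst i, tst j, _, _, h => exact fun m x y n => 𝓜.test_test i j m x y n fun hij => h rfl hij

/-- A permutation fixing a support of `m` and the addresses of the action fixes the resulting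
memory: by equivariance for updates, and for tests also by the uniqueness of the memory for each
boolean. -/
theorem isFresh_eff {a : MemAct I L} (ha : a.Defined 𝓜) {i : I} {m n : M} {b : Bool}
    (hi : IsFresh i m) (hia : i ∉ a.addrs) (h : eff 𝓜 a m (b, n) ≠ 0) : IsFresh i n := by
  obtain ⟨S, hS, hm, hiS⟩ := hi
  cases a with
  | skip =>
    rw [(dirac_pair h).2]
    exact ⟨S, hS, hm, hiS⟩
  | upd v l =>
    have hn : 𝓜.update v l m = some n := by
      rw [(dirac_pair h).2]
      exact update_eq ha m
    refine ⟨S ∪ {i | i ∈ v}, hS.union (List.finite_toSet v), fun σ hσ => ?_, fun h => h.elim hiS hia⟩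
    have := 𝓜.update_equivariant σ v l m
    rw [hm σ fun i hi => hσ i (.inl hi), hn] at this
    have hv : v.map σ.1 = v := by
      conv_rhs => rw [← List.map_id v]
      exact List.map_congr_left fun i hi => hσ i (.inr hi)
    rw [hv, hn] at this
    exact (Option.some.inj this).symm
  | tst j =>
    refine ⟨insert j S, hS.insert j, fun σ hσ => ?_, fun h => h.elim hia hiS⟩
    have := 𝓜.test_equivariant σ j m b n
    rw [hm σ fun i hi => hσ i (.inr hi), hσ j (.inl rfl)] at this
    refine 𝓜.test_unique j m b _ _ ?_ h
    rw [this]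
    exact h

end MemAct

/-! ### Events: transitions described independently of their resulting states. -/

/-- The data of a transition of the machine with memory: the positions `dom` of the tokens that move
along `f` (which depends on the outcome), the position `new` of the token that is added, its address
`addr`, and the action on the memory. -/
@[ext]
structure Event (E I L : Type*) where
  dom : Set (Pos E)
  f : Bool → Pos E → Pos E
  new : Option (Pos E)
  addr : Option I
  mem : MemAct I L

namespace Event

variable {E I L : Type*}

-- The token of a `?d` node is added without an address; `or` then leaves the old value.
open Classical in
noncomputable def newAddr (ev : Event E I L) (a : Pos E → Option I) (q : Pos E) : Option I :=
  if ev.new = some q then ev.addr.or (a q) else a q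

/-- Events that act on distinct tokens and addresses. -/
structure Indep (ev ev' : Event E I L) : Prop where
  dom : Disjoint ev.dom ev'.dom
  new : ∀ p, ev.new = some p → ev'.new ≠ some p
  addr : ∀ i, ev.addr = some i → ev'.addr ≠ some i

theorem Indep.symm {ev ev' : Event E I L} (h : ev.Indep ev') : ev'.Indep ev :=
  ⟨h.dom.symm, fun p h₁ h₂ => h.new p h₂ h₁, fun i h₁ h₂ => h.addr i h₂ h₁⟩

theorem newAddr_eq_some {ev : Event E I L} {a : Pos E → Option I} {q : Pos E} {i : I}
    (h : ev.newAddr a q = some i) : ev.new = some q ∧ ev.addr = some i ∨ a q = some i := by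
  unfold newAddr at h
  split_ifs at h with hq
  · rcases hi : ev.addr with _ | j
    · rw [hi] at h
      exact .inr h
    · rw [hi] at h
      exact .inl ⟨hq, h⟩
  · exact .inr h

theorem newAddr_of_ne {ev : Event E I L} {a : Pos E → Option I} {q : Pos E}
    (h : ev.new ≠ some q) : ev.newAddr a q = a q := if_neg h

theorem newAddr_comm {ev ev' : Event E I L} (h : ev.Indep ev') (a : Pos E → Option I) (q : Pos E) :
    ev'.newAddr (ev.newAddr a) q = ev.newAddr (ev'.newAddr a) q := by
  unfold newAddr
  by_cases h₁ : ev.new = some q <;> by_cases h₂ : ev'.new = some q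
  · exact absurd h₂ (h.new q h₁)
  all_goals simp [h₁, h₂]

end Event

namespace RawProgramNet

open PreNet

variable {I M L : Type*} [MulAction (finPerm I) M] {𝓜 : MemoryStructure I M L}
  {N : RawProgramNet 𝓜}

/-- The invariant of the runs. -/
structure Sound (T : N.RawState) : Prop where
  history : ∃ P, T.siam.History P
  finite : {i | ∃ p, T.addr p = some i}.Finite

/-- The event `ev` is possible in the state `T`. -/
structure Valid (T : N.RawState) (ev : Event N.net.Edge I L) : Prop where
  change : ∀ b, T.siam.Change ev.dom (ev.f b) ev.new
  addr_inj : ∀ i, ev.addr = some i → ∀ q, T.addr q = some i → ev.new = some q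
  mem_addrs : ∀ i ∈ ev.mem.addrs, ∃ p ∈ ev.dom, ∃ o, (p, o) ∈ T.siam.tok ∧ T.addr o = some i
  mem_defined : ev.mem.Defined 𝓜
  mem_choice : ∀ i, ev.mem = .tst i → ∃ n S₀ S₁ e₀ e₁ e aux t,
    N.net.spec n = .botbox S₀ S₁ e₀ e₁ e aux ∧ ∃ p ∈ ev.dom, ev.f false p = ⟨e₀, .nil, t⟩ ∧
      ev.f true p = ⟨e₁, .nil, t⟩

/-- The state `U` results from `T` by the event `ev`, with the outcome `x`. -/
structure Result (T : N.RawState) (ev : Event N.net.Edge I L) (x : Bool × M) (U : N.RawState) :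
    Prop where
  tok : U.siam.tok = T.siam.changed (ev.f x.1) ev.new
  addr : ∀ q, U.addr q = ev.newAddr T.addr q
  mem : U.mem = x.2

theorem Result.unique {T U V : N.RawState} {ev : Event N.net.Edge I L} {x : Bool × M}
    (hU : Result T ev x U) (hV : Result T ev x V) : U = V :=
  RawState.ext (State.ext (hU.tok.trans hV.tok.symm))
    (funext fun q => (hU.addr q).trans (hV.addr q).symm) (hU.mem.trans hV.mem.symm)

-- The default `T` is not used for a valid event in a sound state (`Valid.result_app`).
open Classical in
noncomputable def app (T : N.RawState) (ev : Event N.net.Edge I L) (x : Bool × M) : N.RawState :=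
  if h : ∃ U, Result T ev x U then h.choose else T

/-- The distribution of the states that result from an event. -/
noncomputable def outcome (T : N.RawState) (ev : Event N.net.Edge I L) : SubDist N.RawState :=
  (ev.mem.eff 𝓜 T.mem).map (app T ev)

namespace Valid

variable {T U : N.RawState} {ev ev' : Event N.net.Edge I L} {x : Bool × M}

theorem result_app (hT : Sound T) (h : Valid T ev) (x : Bool × M) :
    Result T ev x (app T ev x) := by
  have hex : ∃ U, Result T ev x U := by
    obtain ⟨P, hP⟩ := hT.history
    obtain ⟨V, hV⟩ := (h.change x.1).exists_state hP
    refine ⟨⟨V, ev.newAddr T.addr, fun p i hp => ?_, fun p q i hp hq => ?_, x.2⟩, hV,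
      fun _ => rfl, rfl⟩
    · rcases Event.newAddr_eq_some hp with h' | h'
      · exact (h.change x.1).new_isStart p h'.1
      · exact T.addr_start p i h'
    · rcases Event.newAddr_eq_some hp with h₁ | h₁ <;> rcases Event.newAddr_eq_some hq with h₂ | h₂
      · exact Option.some.inj (h₁.1.symm.trans h₂.1)
      · exact Option.some.inj (h₁.1.symm.trans (h.addr_inj i h₁.2 q h₂))
      · exact Option.some.inj ((h.addr_inj i h₂.2 p h₁).symm.trans h₂.1)
      · exact T.addr_injective p q i h₁ h₂
  rw [app, dif_pos hex]
  exact hex.choose_spec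

theorem app_eq (hT : Sound T) (h : Valid T ev) (hU : Result T ev x U) : app T ev x = U :=
  (h.result_app hT x).unique hU

theorem sound (hT : Sound T) (h : Valid T ev) (hU : Result T ev x U) : Sound U := by
  obtain ⟨P, hP⟩ := hT.history
  refine ⟨⟨_, (h.change x.1).history hP hU.tok⟩, ?_⟩
  refine (hT.finite.union (Set.Subsingleton.finite
    (s := {i | ev.addr = some i}) fun i hi j hj => Option.some.inj (hi.symm.trans hj))).subset ?_
  · rintro i ⟨p, hp⟩
    rw [hU.addr] at hp
    rcases Event.newAddr_eq_some hp with h | h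
    · exact .inr h.2
    · exact .inl ⟨p, h⟩

theorem tok_persist (hU : Result T ev x U) (h : Valid T ev) {p o : Pos N.net.Edge}
    (hp : p ∉ ev.dom) (ho : (p, o) ∈ T.siam.tok) : (p, o) ∈ U.siam.tok ∧ U.addr o = T.addr o := by
  constructor
  · rw [hU.tok]
    exact .inl ⟨p, ho, ((h.change x.1).fixed p hp).symm⟩
  · rw [hU.addr, Event.newAddr_of_ne]
    exact fun h' => (h.change x.1).new_orig o h' p ho

theorem persist (h : Valid T ev) (h' : Valid T ev') (hi : ev.Indep ev') (hU : Result T ev x U) :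
    Valid U ev' where
  change := fun b => (h.change x.1).persist (h'.change b) hU.tok hi.dom hi.new
  addr_inj := fun i hi' q hq => by
    rw [hU.addr] at hq
    rcases Event.newAddr_eq_some hq with h₁ | h₁
    · exact absurd hi' (hi.addr i h₁.2)
    · exact h'.addr_inj i hi' q h₁
  mem_addrs := fun i hi' => by
    obtain ⟨p, hp, o, ho, hoi⟩ := h'.mem_addrs i hi'
    obtain ⟨h₁, h₂⟩ := tok_persist hU h (Set.disjoint_right.1 hi.dom hp) ho
    exact ⟨p, hp, o, h₁, h₂.trans hoi⟩
  mem_defined := h'.mem_defined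
  mem_choice := h'.mem_choice

/-- Independent events involve distinct addresses in the memory. -/
theorem disjoint_addrs (h : Valid T ev) (h' : Valid T ev') (hi : ev.Indep ev') :
    Disjoint ev.mem.addrs ev'.mem.addrs := by
  refine Set.disjoint_left.2 fun i h₁ h₂ => ?_
  obtain ⟨p, hp, o, ho, hoi⟩ := h.mem_addrs i h₁
  obtain ⟨p', hp', o', ho', hoi'⟩ := h'.mem_addrs i h₂
  obtain rfl := T.addr_injective o o' i hoi hoi'
  obtain rfl := T.siam.injective _ _ _ ho ho'
  exact Set.disjoint_left.1 hi.dom hp hp'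

/-- The intermediate memories are unrelated, since only the memory of the last outcome remains in
the state. -/
theorem app_comm (hT : Sound T) (h : Valid T ev) (h' : Valid T ev') (hi : ev.Indep ev')
    (b c : Bool) (m₁ m₂ n : M) :
    app (app T ev (b, m₁)) ev' (c, n) = app (app T ev' (c, m₂)) ev (b, n) := by
  have hU := h.result_app hT (b, m₁)
  have hU' := h'.result_app hT (c, m₂)
  have hV := (h.persist h' hi hU).result_app (h.sound hT hU) (c, n)
  have hV' := (h'.persist h hi.symm hU').result_app (h'.sound hT hU') (b, n)
  obtain ⟨P, hP⟩ := hT.history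
  refine RawState.ext ?_ (funext fun q => ?_) (hV.mem.trans hV'.mem.symm)
  · exact (h.change b).commute hP (h'.change c) hi.dom hU.tok hU'.tok hV.tok hV'.tok
  · rw [hV.addr, hV'.addr, show (app T ev (b, m₁)).addr = _ from funext hU.addr,
      show (app T ev' (c, m₂)).addr = _ from funext hU'.addr, Event.newAddr_comm hi]

/-- Distinct outcomes of an event are in conflict. -/
theorem conflict_app (hT : Sound T) (h : Valid T ev) {x y : Bool × M}
    (hx : x ∈ (ev.mem.eff 𝓜 T.mem).support) (hy : y ∈ (ev.mem.eff 𝓜 T.mem).support)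
    (hxy : x ≠ y) : (app T ev x).siam.Conflict (app T ev y).siam := by
  obtain ⟨b, m⟩ := x
  obtain ⟨c, m'⟩ := y
  -- The boolean determines the memory, so distinct outcomes differ in their boolean. Then the event
  -- is a test, which sends the token to opposite premises.
  have hbc : b ≠ c := by
    rintro rfl
    exact hxy (by rw [MemAct.eff_unique hx hy])
  cases hm : ev.mem with
  | skip =>
    rw [hm] at hx hy
    exact absurd ((SubDist.dirac_pair hx).1.trans (SubDist.dirac_pair hy).1.symm) hbc
  | upd v l =>
    rw [hm] at hx hy
    exact absurd ((SubDist.dirac_pair hx).1.trans (SubDist.dirac_pair hy).1.symm) hbc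
  | tst i =>
    obtain ⟨n, S₀, S₁, e₀, e₁, e, aux, t, hn, p, hp, h₀, h₁⟩ := h.mem_choice i hm
    have key : ∀ b m, (app T ev (b, m)).siam.On (ev.f b p) := fun b m =>
      (State.on_changed (h.result_app hT (b, m)).tok).2
        (.inl ⟨p, ((h.change b).fire p hp).1, rfl⟩)
    refine ⟨n, S₀, S₁, e₀, e₁, e, aux, .nil, t, hn, ?_⟩
    cases b <;> cases c
    · exact absurd rfl hbc
    · exact .inl ⟨h₀ ▸ key _ _, h₁ ▸ key _ _⟩
    · exact .inr ⟨h₁ ▸ key _ _, h₀ ▸ key _ _⟩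
    · exact absurd rfl hbc

/-- The tokens that witness a conflict are stable. -/
theorem conflict_persist (hU : Result T ev x U) (h : Valid T ev) {V : N.net.State}
    (hc : T.siam.Conflict V) : U.siam.Conflict V := by
  obtain ⟨n, S₀, S₁, e₀, e₁, e, aux, s, t, hn, hc⟩ := hc
  have hb := N.net.bot_of_box n _ _ _ _ _ _ hn
  refine ⟨n, S₀, S₁, e₀, e₁, e, aux, s, t, hn, ?_⟩
  refine hc.imp (fun h' => ⟨?_, h'.2⟩) fun h' => ⟨?_, h'.2⟩
  · exact (h.change x.1).on_stable hU.tok h'.1 (dir_stable_iff.2 (.inr hb.1))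
  · exact (h.change x.1).on_stable hU.tok h'.1 (dir_stable_iff.2 (.inr hb.2))

end Valid

theorem Sound.not_conflict {T : N.RawState} (hT : Sound T) : ¬ T.siam.Conflict T.siam := by
  obtain ⟨P, hP⟩ := hT.history
  rintro ⟨n, S₀, S₁, e₀, e₁, e, aux, s, t, hn, h | h⟩
  · exact hP.exclusive hn h.1 h.2
  · exact hP.exclusive hn h.2 h.1

/-! ### Equivalence of raw states -/

theorem mk_eq_iff {T U : N.RawState} : MState.mk T = MState.mk U ↔ N.stateSetoid.r T U :=
  ⟨fun h => Quotient.exact h, fun h => Quotient.sound h⟩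

theorem Sound.congr {T U : N.RawState} (hT : Sound T) (h : MState.mk T = MState.mk U) :
    Sound U := by
  obtain ⟨σ, -, h₁, h₂, -⟩ := mk_eq_iff.1 h
  refine ⟨h₁ ▸ hT.history, (hT.finite.image σ.1).subset ?_⟩
  rintro i ⟨p, hp⟩
  rw [h₂] at hp
  obtain ⟨j, hj, rfl⟩ := Option.map_eq_some_iff.1 hp
  exact ⟨j, ⟨p, hj⟩, rfl⟩

/-- Independent events can be performed in any order. -/
theorem joined_of_indep {T : N.RawState} {ev ev' : Event N.net.Edge I L} (hT : Sound T)
    (h : Valid T ev) (h' : Valid T ev') (hi : ev.Indep ev')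
    (hrel : ∀ x ∈ (ev.mem.eff 𝓜 T.mem).support, N.machine.rel (MState.mk (app T ev x))
      ((outcome (app T ev x) ev').map MState.mk))
    (hrel' : ∀ x ∈ (ev'.mem.eff 𝓜 T.mem).support, N.machine.rel (MState.mk (app T ev' x))
      ((outcome (app T ev' x) ev).map MState.mk)) :
    N.machine.Joined ((outcome T ev).map MState.mk) ((outcome T ev').map MState.mk) := by
  classical
  have key : ∀ {ev ev' : Event N.net.Edge I L}, Valid T ev → Valid T ev' →
      (∀ x ∈ (ev.mem.eff 𝓜 T.mem).support, N.machine.rel (MState.mk (app T ev x))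
        ((outcome (app T ev x) ev').map MState.mk)) →
      ∃ F : N.MState → SubDist N.MState,
        (∀ b ∈ ((outcome T ev).map MState.mk).support, N.machine.rel b (F b)) ∧
        ((outcome T ev).map MState.mk).bind F = (ev.mem.eff 𝓜 T.mem).bind fun x =>
          (ev'.mem.eff 𝓜 x.2).map fun y => MState.mk (app (app T ev x) ev' y) := by
    intro ev ev' h h' hrel
    let F : N.MState → SubDist N.MState := fun b =>
      if hb : ∃ x ∈ (ev.mem.eff 𝓜 T.mem).support, b = MState.mk (app T ev x) then
        (outcome (app T ev hb.choose) ev').map MState.mk else SubDist.dirac b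
    have hF : ∀ x ∈ (ev.mem.eff 𝓜 T.mem).support,
        F (MState.mk (app T ev x)) = (outcome (app T ev x) ev').map MState.mk := by
      intro x hx
      have hb : ∃ y ∈ (ev.mem.eff 𝓜 T.mem).support,
        MState.mk (app T ev x) = MState.mk (app T ev y) := ⟨x, hx, rfl⟩
      -- Distinct outcomes give states in conflict and a sound state is not in conflict with itself,
      -- so the state determines the outcome and `F` has the intended values.
      have hy : hb.choose = x := by
        by_contra hne
        have hc := h.conflict_app hT hb.choose_spec.1 hx hne
        have hs : (app T ev x).siam = (app T ev hb.choose).siam :=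
          congrArg MState.siam hb.choose_spec.2
        rw [← hs] at hc
        exact (h.sound hT (h.result_app hT x)).not_conflict hc
      have h₁ : F (MState.mk (app T ev x)) = _ := dif_pos hb
      rw [h₁, hy]
    refine ⟨F, fun b hb => ?_, ?_⟩
    · rw [outcome, SubDist.map_map] at hb
      obtain ⟨x, hx, rfl⟩ := SubDist.mem_support_map.1 hb
      rw [Function.comp_apply, hF x hx]
      exact hrel x hx
    · rw [outcome, SubDist.map_map, SubDist.map_bind]
      refine SubDist.bind_congr fun x hx => ?_
      rw [Function.comp_apply, hF x hx, outcome, SubDist.map_map, (h.result_app hT x).mem]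
      rfl
  obtain ⟨F, hF, hF'⟩ := key h h' hrel
  obtain ⟨G, hG, hG'⟩ := key h' h hrel'
  refine ⟨F, G, hF, hG, hF'.trans (Eq.trans ?_ hG'.symm)⟩
  refine (MemAct.commute_of_disjoint h.mem_defined h'.mem_defined
    (h.disjoint_addrs h' hi)).bind_eq T.mem fun b c m₁ m₂ n => ?_
  rw [h.app_comm hT h' hi]

end RawProgramNet

/-! ### Steps of the token machine as changes. -/

theorem Formula.Positive.indicates_atoms {A : Formula} (hA : A.Positive) {s : Stk}
    (hs : s ∈ A.atoms) : s ≠ .delta ∧ s.indicates A = some .one := by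
  induction hA generalizing s with
  | one =>
    simp only [Formula.atoms, List.mem_singleton] at hs
    subst hs
    exact ⟨Stk.noConfusion, rfl⟩
  | tensor _ _ ihA ihB =>
    simp only [Formula.atoms, List.mem_append, List.mem_map] at hs
    rcases hs with ⟨s, hs, rfl⟩ | ⟨s, hs, rfl⟩
    · exact ⟨Stk.noConfusion, (ihA hs).2⟩
    · exact ⟨Stk.noConfusion, (ihB hs).2⟩

namespace PreNet

variable {L : Type*} {R : PreNet L}

theorem dir_mem_syncPositions {n : R.Node} {l ports t} (hn : R.spec n = .sync l ports)
    {p : Pos R.Edge} (hp : p ∈ R.syncPositions ports t) :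
    R.dir p = some .down ∧ p.edge ∈ (R.spec n).targets := by
  simp only [syncPositions, List.mem_flatMap, List.mem_map] at hp
  obtain ⟨x, hx, s, hs, rfl⟩ := hp
  have hty := R.typed n
  rw [hn] at hty
  have hpos := (hty x hx).1
  obtain ⟨h₁, h₂⟩ := hpos.indicates_atoms hs
  refine ⟨(dir_eq_iff (by exact Dir.noConfusion)).2 ⟨h₁, fun k hk => ?_, .one, h₂, rfl⟩, ?_⟩
  · have := R.typed k
    rw [hk] at this
    have h₃ : R.ty x.1 = .bot := this
    rw [h₃] at hpos
    cases hpos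
  · rw [hn]
    exact List.mem_append_left _ (List.mem_map_of_mem hx)

theorem dir_botbox {n : R.Node} {S₀ S₁ e₀ e₁ e aux} (hn : R.spec n = .botbox S₀ S₁ e₀ e₁ e aux)
    (t : List Sig) : R.dir ⟨e, .nil, t⟩ = some .up ∧ e ∈ (R.spec n).concls := by
  have hty := R.typed n
  rw [hn] at hty
  have hmem : e ∈ (R.spec n).concls := by rw [hn]; simp [NodeSpec.concls]
  refine ⟨(dir_eq_iff (by exact Dir.noConfusion)).2 ⟨Stk.noConfusion, fun k hk => ?_, .bot, ?_, rfl⟩,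
    hmem⟩
  · obtain rfl : k = n := R.source_unique (by rw [hk]; simp [NodeSpec.concls]) hmem
    rw [hk] at hn
    cases hn
  · dsimp only
    rw [hty.1]
    rfl

open Classical in
/-- The function that moves a token from `p` to `q`. -/
noncomputable def moveAt (p q r : Pos R.Edge) : Pos R.Edge := if r = p then q else r

theorem moveAt_self (p q : Pos R.Edge) : moveAt p q p = q := if_pos rfl

theorem moveAt_ne {p q r : Pos R.Edge} (h : r ≠ p) : moveAt p q r = r := if_neg h

open Classical in
/-- The function that moves all tokens across a sync node. -/
noncomputable def syncMap (ports : List (R.Edge × R.Edge)) (t : List Sig) (p : Pos R.Edge) :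
    Pos R.Edge :=
  if h : ∃ x ∈ ports, ∃ s ∈ (R.ty x.1).atoms, p = ⟨x.1, s, t⟩ then ⟨h.choose.2, p.stk, t⟩ else p

theorem mem_syncPositions {ports : List (R.Edge × R.Edge)} {t : List Sig} {p : Pos R.Edge} :
    p ∈ R.syncPositions ports t ↔ ∃ x ∈ ports, ∃ s ∈ (R.ty x.1).atoms, p = ⟨x.1, s, t⟩ := by
  simp only [syncPositions, List.mem_flatMap, List.mem_map, eq_comm]

theorem syncMap_of_notMem {ports : List (R.Edge × R.Edge)} {t : List Sig} {p : Pos R.Edge}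
    (h : p ∉ R.syncPositions ports t) : syncMap ports t p = p :=
  dif_neg fun h' => h (mem_syncPositions.2 h')

theorem syncMap_eq {n : R.Node} {l ports t} (hn : R.spec n = .sync l ports) {x : R.Edge × R.Edge}
    (hx : x ∈ ports) {s : Stk} (hs : s ∈ (R.ty x.1).atoms) :
    syncMap ports t ⟨x.1, s, t⟩ = ⟨x.2, s, t⟩ := by
  have h : ∃ y ∈ ports, ∃ s' ∈ (R.ty y.1).atoms, (⟨x.1, s, t⟩ : Pos R.Edge) = ⟨y.1, s', t⟩ :=
    ⟨x, hx, s, hs, rfl⟩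
  -- The premises of a sync node are pairwise distinct, so the position determines the port.
  have hxy : h.choose = x := by
    obtain ⟨hy, s', -, hp⟩ := h.choose_spec
    have hnd := R.targets_nodup n
    rw [hn] at hnd
    simp only [NodeSpec.targets, NodeSpec.prems, NodeSpec.doors, List.map_nil,
      List.append_nil] at hnd
    exact hnd.inj_of_map hy hx (congrArg Pos.edge hp).symm
  rw [syncMap, dif_pos h, hxy]

namespace State

variable {T U : R.State}

/-- The premises of the doors lie one level deeper than `e`, and the conclusions of the box are
distinct. This separates moves through auxiliary doors from tests. -/
theorem _root_.PreNet.aux_ne_principal {n : R.Node} {S₀ S₁ e₀ e₁ e aux}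
    (hn : R.spec n = .botbox S₀ S₁ e₀ e₁ e aux) {x : R.Edge × R.Edge × R.Edge} (hx : x ∈ aux) :
    x.1 ≠ e ∧ x.2.1 ≠ e ∧ x.2.2 ≠ e := by
  have key : ∀ S a, (S, a) ∈ (R.spec n).doors → S ∈ (R.spec n).contents → a ≠ e := by
    rintro S a h hS rfl
    have h₁ := R.str_doors n _ h
    have h₂ := R.str_concls n a (by rw [hn]; simp [NodeSpec.concls])
    have h₃ := R.depth_content n S hS
    dsimp only at h₁
    rw [← h₁, h₂] at h₃
    omega
  rw [hn] at key
  simp only [NodeSpec.doors, NodeSpec.contents, List.mem_cons, List.mem_append, List.mem_map] at key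
  refine ⟨key S₀ _ (.inr (.inr (.inl ⟨x, hx, rfl⟩))) (.inl rfl),
    key S₁ _ (.inr (.inr (.inr ⟨x, hx, rfl⟩))) (.inr (.inl rfl)), ?_⟩
  rintro rfl
  have hnd := R.concls_nodup n
  rw [hn] at hnd
  exact (List.nodup_cons.1 hnd).1 (List.mem_map_of_mem (f := fun x => x.2.2) hx)

/-- The moves of a single token do not cross sync nodes or principal doors of `⊥`-boxes. -/
theorem Move.cross {d : Dir} {p q : Pos R.Edge} (h : T.Move d p q) : ∃ n d',
    (R.spec n).Cross (fun S t => t ∈ T.Copies S) d p d' q ∧ ¬ (R.spec n).IsSync ∧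
      ∀ S₀ S₁ e₀ e₁ e aux, R.spec n = .botbox S₀ S₁ e₀ e₁ e aux → p.edge ≠ e := by
  cases h
  all_goals
    have hsp := ‹R.spec _ = _›
    refine ⟨_, _, (by rw [hsp]; constructor <;> assumption), by rw [hsp]; exact id,
      fun _ _ _ _ _ _ h => ?_⟩
    have h' := h
    rw [hsp] at h'
    cases h'
  case bot_d0 => exact (aux_ne_principal hsp ‹_ ∈ _›).1
  case bot_d1 => exact (aux_ne_principal hsp ‹_ ∈ _›).2.1
  case bot_u0 => exact (aux_ne_principal hsp ‹_ ∈ _›).2.2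
  case bot_u1 => exact (aux_ne_principal hsp ‹_ ∈ _›).2.2

theorem Move.mono (hC : ∀ S, T.Copies S ⊆ U.Copies S) {d : Dir} {p q : Pos R.Edge}
    (h : T.Move d p q) : U.Move d p q := by
  cases h
  case bot_u0 h₁ h₂ h₃ => exact .bot_u0 h₁ h₂ (hC _ h₃)
  case bot_u1 h₁ h₂ h₃ => exact .bot_u1 h₁ h₂ (hC _ h₃)
  all_goals
    have hsp := ‹R.spec _ = _›
    first
    | exact .ax_l hsp | exact .ax_r hsp | exact .cut_l hsp | exact .cut_r hsp
    | exact .tensor_dl hsp | exact .tensor_dr hsp | exact .tensor_ul hsp | exact .tensor_ur hsp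
    | exact .par_dl hsp | exact .par_dr hsp | exact .par_ul hsp | exact .par_ur hsp
    | exact .der_d hsp | exact .der_u hsp | exact .contr_dl hsp | exact .contr_dr hsp
    | exact .contr_ul hsp | exact .contr_ur hsp | exact .bang_d hsp | exact .bang_u hsp
    | exact .bang_aux_d hsp ‹_› | exact .bang_aux_u hsp ‹_› | exact .ybox_d hsp ‹_›
    | exact .ybox_u hsp ‹_› | exact .ybox_call hsp | exact .ybox_return hsp
    | exact .ybox_aux_d hsp ‹_› | exact .ybox_aux_u hsp ‹_› | exact .bot_d0 hsp ‹_›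
    | exact .bot_d1 hsp ‹_›

/-- Of the two branchings at a `⊥`-box, the history excludes that both copies are open, and the
choice at the principal door is not a `Move`. -/
theorem Move.det {P : Set (Pos R.Edge)} (hT : T.History P) {d : Dir} {p q q' : Pos R.Edge}
    (h : T.Move d p q) (h' : T.Move d p q') : q = q' := by
  obtain ⟨n, d₁, hc, -, hn⟩ := h.cross
  obtain ⟨n', d₂, hc', -, -⟩ := h'.cross
  obtain rfl : n = n' := by
    rcases hc.exit with ⟨hd, hp⟩ | ⟨hd, hp⟩ <;> rcases hc'.exit with ⟨hd', hp'⟩ | ⟨hd', hp'⟩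
    · exact R.target_unique _ _ _ hp hp'
    · exact absurd (hd.symm.trans hd') Dir.noConfusion
    · exact absurd (hd.symm.trans hd') Dir.noConfusion
    · exact R.source_unique hp hp'
  rcases hc.fwd_det (R.concls_nodup n) (R.targets_nodup n) hc' rfl with
    h | ⟨S₀, S₁, e₀, e₁, e, aux, hsp, h | h⟩
  · exact h
  · exact absurd h.2 (hT.not_both_copies hsp h.1)
  · exact absurd h (hn _ _ _ _ _ _ hsp)

/-- A move of the tokens of `D` along `f` in terms of the relation `r`. -/
theorem movesTo_iff {r : Pos R.Edge → Pos R.Edge → Prop} {D : Set (Pos R.Edge)}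
    {f : Pos R.Edge → Pos R.Edge} (hr : ∀ p q, r p q ↔ p ∈ D ∧ q = f p) (hf : ∀ p ∉ D, f p = p) :
    T.MovesTo r U ↔ U.tok = T.changed f none := by
  unfold MovesTo changed
  refine Eq.congr_right (Set.ext fun x => ?_)
  simp only [Set.mem_ofPred_eq, reduceCtorEq, and_false, or_false, hr]
  refine exists_congr fun p => and_congr_right fun _ => ?_
  by_cases hp : p ∈ D
  · simp [hp]
  · simp [hp, hf p hp]

theorem movesTo_moveAt {p q : Pos R.Edge} :
    T.MovesTo (fun x y => x = p ∧ y = q) U ↔ U.tok = T.changed (moveAt p q) none := by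
  refine movesTo_iff (D := {p}) (fun x y => ?_) fun x hx => moveAt_ne hx
  refine and_congr_right fun hx => ?_
  rw [hx, moveAt_self]

theorem movesTo_syncMap {n : R.Node} {l ports t} (hn : R.spec n = .sync l ports) :
    T.MovesTo (fun p q => ∃ x ∈ ports, ∃ s ∈ (R.ty x.1).atoms,
      p = ⟨x.1, s, t⟩ ∧ q = ⟨x.2, s, t⟩) U ↔ U.tok = T.changed (syncMap ports t) none := by
  refine movesTo_iff (D := {p | p ∈ R.syncPositions ports t}) (fun x y => ?_) fun x hx =>
    syncMap_of_notMem hx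
  constructor
  · rintro ⟨z, hz, s, hs, rfl, rfl⟩
    exact ⟨mem_syncPositions.2 ⟨z, hz, s, hs, rfl⟩, (syncMap_eq hn hz hs).symm⟩
  · rintro ⟨hx, rfl⟩
    obtain ⟨z, hz, s, hs, rfl⟩ := mem_syncPositions.1 hx
    exact ⟨z, hz, s, hs, rfl, syncMap_eq hn hz hs⟩

theorem changed_id (p : Pos R.Edge) : T.changed id (some p) = insert (p, p) T.tok := by
  ext ⟨q, o⟩
  simp only [changed, Set.mem_ofPred_eq, id, Option.some.injEq, Set.mem_insert_iff, Prod.mk.injEq]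
  constructor
  · rintro (⟨_, h, rfl⟩ | ⟨rfl, rfl⟩)
    · exact .inr h
    · exact .inl ⟨rfl, rfl⟩
  · rintro (⟨rfl, rfl⟩ | h)
    · exact .inr ⟨rfl, rfl⟩
    · exact .inl ⟨q, h, rfl⟩

theorem GenStep.change {p : Pos R.Edge} (h : T.GenStep p U) (hp : R.IsOnes p ∨ R.IsDer p) :
    T.Change ∅ id (some p) where
  fixed := fun _ _ => rfl
  fire := fun _ h => absurd h (Set.notMem_empty _)
  new_isPos := fun q hq => by
    obtain rfl := Option.some.inj hq
    exact hp.elim (·.1) (·.1)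
  new_isStart := fun q hq => by
    obtain rfl := Option.some.inj hq
    exact .inr hp
  new_orig := fun q hq => by
    obtain rfl := Option.some.inj hq
    exact h.1
  new_copies := fun q hq => by
    obtain rfl := Option.some.inj hq
    exact h.2.1

theorem change_moveAt {d : Dir} {p q : Pos R.Edge} (h₁ : T.On p) (h₂ : R.dir p = some d)
    {n : R.Node} {d' : Dir} (h₃ : (R.spec n).Cross (fun S t => t ∈ T.Copies S) d p d' q)
    (hU : U.tok = T.changed (moveAt p q) none) : T.Change {p} (moveAt p q) none where
  fixed := fun _ hx => moveAt_ne hx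
  fire := fun x hx => by
    obtain rfl : x = p := hx
    rw [moveAt_self]
    refine ⟨h₁, ⟨n, d, d', h₂, h₃⟩, ?_⟩
    obtain ⟨o, ho⟩ := h₁
    -- That `q` is a position is read off the given state `U`, which has a token there.
    refine U.isPos q o ?_
    rw [hU]
    exact .inl ⟨x, ho, (moveAt_self _ _).symm⟩
  new_isPos := fun _ h => by cases h
  new_isStart := fun _ h => by cases h
  new_orig := fun _ h => by cases h
  new_copies := fun _ h => by cases h

theorem change_syncMap {n : R.Node} {l ports t} (hn : R.spec n = .sync l ports)
    (h : ∀ p ∈ R.syncPositions ports t, T.On p) (hU : U.tok = T.changed (syncMap ports t) none) :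
    T.Change {p | p ∈ R.syncPositions ports t} (syncMap ports t) none where
  fixed := fun _ hx => syncMap_of_notMem hx
  fire := fun p hp => by
    have hd := (dir_mem_syncPositions hn hp).1
    have hon := h p hp
    obtain ⟨x, hx, s, hs, rfl⟩ := mem_syncPositions.1 hp
    refine ⟨hon, ⟨n, .down, .down, hd, ?_⟩, ?_⟩
    · rw [syncMap_eq hn hx hs, hn]
      exact .sync hx
    · obtain ⟨o, ho⟩ := hon
      refine U.isPos _ o ?_
      rw [hU]
      exact .inl ⟨_, ho, rfl⟩
  new_isPos := fun _ h => by cases h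
  new_isStart := fun _ h => by cases h
  new_orig := fun _ h => by cases h
  new_copies := fun _ h => by cases h

end State
end PreNet

/-! ### Lists related entry by entry. -/

theorem List.Forall₂.exists_left {α β : Type*} {r : α → β → Prop} {l : List α} {v : List β}
    (h : List.Forall₂ r l v) {b : β} (hb : b ∈ v) : ∃ a ∈ l, r a b := by
  induction h with
  | nil => cases hb
  | cons h₁ _ ih =>
    rcases List.mem_cons.1 hb with rfl | hb
    · exact ⟨_, List.mem_cons_self, h₁⟩
    · obtain ⟨a, ha, hab⟩ := ih hb
      exact ⟨a, List.mem_cons_of_mem _ ha, hab⟩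

theorem List.Forall₂.right_unique' {α β : Type*} {r : α → β → Prop}
    (hr : ∀ a b b', r a b → r a b' → b = b') {l : List α} {v v' : List β}
    (h : List.Forall₂ r l v) (h' : List.Forall₂ r l v') : v = v' := by
  induction h generalizing v' with
  | nil => cases h'; rfl
  | cons h₁ _ ih =>
    cases h' with
    | cons h₂ h₃ => rw [hr _ _ _ h₁ h₂, ih h₃]

theorem List.Forall₂.imp_mem {α β : Type*} {r r' : α → β → Prop} {l : List α} {v : List β}
    (h : List.Forall₂ r l v) (H : ∀ a ∈ l, ∀ b, r a b → r' a b) : List.Forall₂ r' l v := by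
  induction h with
  | nil => exact .nil
  | cons h₁ _ ih =>
    exact .cons (H _ List.mem_cons_self _ h₁) (ih fun a ha => H a (List.mem_cons_of_mem _ ha))

/-! ### Transitions of the machine with memory as events. -/

namespace RawProgramNet

open PreNet

variable {I M L : Type*} [MulAction (finPerm I) M] {𝓜 : MemoryStructure I M L}
  {N : RawProgramNet 𝓜}

/-- The creation of the token of a `one` node or of a `?d` node. -/
def genEvent (p : Pos N.net.Edge) (a : Option I) : Event N.net.Edge I L :=
  ⟨∅, fun _ => id, some p, a, .skip⟩

/-- The events that correspond to the transitions of the machine. -/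
inductive Kind (T : N.RawState) : Event N.net.Edge I L → Prop
  | active {n e t i} : N.net.spec n = .one e → N.ind (.one e) = some i →
      Kind T (genEvent ⟨e, .nil, t⟩ (some i))
  | fresh {n e t i} : N.net.spec n = .one e → N.ind (.one e) = none →
      (∀ q, T.addr q ≠ some i) → IsFresh i T.mem → (∀ x, N.ind x ≠ some i) →
      Kind T (genEvent ⟨e, .nil, t⟩ (some i))
  | der {p} : N.net.IsDer p → Kind T (genEvent p none)
  | sync {n l ports t v} : N.net.spec n = .sync l ports →
      List.Forall₂ (fun p i => ∃ o, (p, o) ∈ T.siam.tok ∧ T.addr o = some i)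
        (N.net.syncPositions ports t) v →
      Kind T ⟨{p | p ∈ N.net.syncPositions ports t}, fun _ => syncMap ports t, none, none, .upd v l⟩
  | test {n S₀ S₁ e₀ e₁ e aux t o i} : N.net.spec n = .botbox S₀ S₁ e₀ e₁ e aux →
      (⟨e, .nil, t⟩, o) ∈ T.siam.tok → T.addr o = some i →
      Kind T ⟨{⟨e, .nil, t⟩}, fun b => moveAt ⟨e, .nil, t⟩ ⟨bif b then e₁ else e₀, .nil, t⟩,
        none, none, .tst i⟩
  | move {d p q} : N.net.dir p = some d → T.siam.Move d p q →
      Kind T ⟨{p}, fun _ => moveAt p q, none, none, .skip⟩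

/-- The event `ev` is a possible transition of the machine. -/
structure Possible (T : N.RawState) (ev : Event N.net.Edge I L) : Prop where
  kind : Kind T ev
  valid : Valid T ev

theorem outcome_eq_dirac {T U : N.RawState} (hT : Sound T) {ev : Event N.net.Edge I L}
    (hv : Valid T ev) {m : M} (he : ev.mem.eff 𝓜 T.mem = SubDist.dirac (false, m))
    (hU : Result T ev (false, m) U) : outcome T ev = SubDist.dirac U := by
  rw [outcome, he, SubDist.map_dirac, hv.app_eq hT hU]

theorem valid_genEvent {T : N.RawState} {p : Pos N.net.Edge} {a : Option I}
    (h : T.siam.Change ∅ id (some p)) (ha : ∀ i, a = some i → ∀ q, T.addr q = some i → p = q) :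
    Valid T (genEvent p a) where
  change := fun _ => h
  addr_inj := fun i hi q hq => congrArg some (ha i hi q hq)
  mem_addrs := fun _ h => absurd h (Set.notMem_empty _)
  mem_defined := trivial
  mem_choice := fun _ h => by cases h

open Classical in
theorem newAddr_genEvent {p : Pos N.net.Edge} {i : I} (a : Pos N.net.Edge → Option I)
    (q : Pos N.net.Edge) :
    (genEvent p (some i) : Event N.net.Edge I L).newAddr a q = if q = p then some i else a q := by
  by_cases h : q = p
  · subst h
    rw [if_pos rfl]
    exact if_pos rfl
  · rw [if_neg h]
    exact if_neg fun h' => h (Option.some.inj h').symm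

theorem newAddr_genEvent_none {p : Pos N.net.Edge} (a : Pos N.net.Edge → Option I)
    (q : Pos N.net.Edge) : (genEvent p none : Event N.net.Edge I L).newAddr a q = a q := by
  unfold Event.newAddr
  split_ifs <;> rfl

/-- The event of a link transition. -/
theorem link_event {T U : N.RawState} (hT : Sound T) {n e t i} (hn : N.net.spec n = .one e)
    (hg : T.siam.GenStep ⟨e, .nil, t⟩ U.siam)
    (ha : ∀ q, U.addr q = open Classical in if q = ⟨e, .nil, t⟩ then some i else T.addr q)
    (hm : U.mem = T.mem) : Valid T (genEvent ⟨e, .nil, t⟩ (some i)) ∧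
      SubDist.dirac U = outcome T (genEvent ⟨e, .nil, t⟩ (some i)) := by
  have hp : N.net.IsPos ⟨e, .nil, t⟩ := U.siam.isPos _ ⟨e, .nil, t⟩ (by
    rw [hg.2.2]
    exact Set.mem_insert _ _)
  have hv : Valid T (genEvent ⟨e, .nil, t⟩ (some i)) := by
    refine valid_genEvent (hg.change (.inl ⟨hp, ⟨n, hn⟩, rfl⟩)) fun j hj q hq => ?_
    obtain rfl := Option.some.inj hj
    by_contra hne
    have h₁ := ha q
    have h₂ := ha ⟨e, .nil, t⟩
    rw [if_neg (Ne.symm hne)] at h₁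
    rw [if_pos rfl] at h₂
    -- The address is not in use elsewhere because the addresses of the resulting state are still
    -- injective.
    exact hne (U.addr_injective _ _ _ h₂ (h₁.trans hq))
  refine ⟨hv, (outcome_eq_dirac hT hv (m := T.mem) rfl ⟨?_, fun q => ?_, hm⟩).symm⟩
  · exact hg.2.2.trans (State.changed_id _).symm
  · rw [newAddr_genEvent]
    exact ha q

theorem RawStep.exists_event {T : N.RawState} (hT : Sound T) {ν : SubDist N.RawState}
    (h : RawStep T ν) : ∃ ev, Possible T ev ∧ ν = outcome T ev := by
  cases h with
  | link_active hn hg hi ha hm =>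
    obtain ⟨hv, ho⟩ := link_event hT hn hg ha hm
    exact ⟨_, ⟨.active hn hi, hv⟩, ho⟩
  | link_fresh hn hg hi h₁ h₂ h₃ ha hm =>
    obtain ⟨hv, ho⟩ := link_event hT hn hg ha hm
    exact ⟨_, ⟨.fresh hn hi h₁ h₂ h₃, hv⟩, ho⟩
  | @update U n l ports t v hn hs hf hu ha =>
    have hU := (State.movesTo_syncMap hn).1 hs.2
    have hd := Option.isSome_iff_exists.2 ⟨_, hu⟩
    have hc := State.change_syncMap hn hs.1 hU
    have hv : Valid T ⟨{p | p ∈ N.net.syncPositions ports t}, fun _ => syncMap ports t, none, none,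
        .upd v l⟩ := ⟨fun _ => hc, nofun, fun i hi => hf.exists_left hi,
          (𝓜.update_defined v l T.mem).1 hd, nofun⟩
    refine ⟨_, ⟨.sync hn hf, hv⟩, (outcome_eq_dirac hT hv (m := U.mem) ?_
      ⟨hU, fun q => congrFun ha q, rfl⟩).symm⟩
    simp only [MemAct.eff, hu, Option.getD_some]
  | @test n S₀ S₁ e₀ e₁ e aux t o i T₀ T₁ hn h₀ h₁ ho hi =>
    have hU₀ := State.movesTo_moveAt.1 h₀.2
    have hU₁ := State.movesTo_moveAt.1 h₁.2
    have hd := (dir_botbox hn t).1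
    have hc₀ := State.change_moveAt h₀.1 hd (by rw [hn]; exact .choice0) hU₀
    have hc₁ := State.change_moveAt h₁.1 hd (by rw [hn]; exact .choice1) hU₁
    have hv : Valid T ⟨{⟨e, .nil, t⟩}, fun b => moveAt ⟨e, .nil, t⟩ ⟨bif b then e₁ else e₀, .nil, t⟩,
        none, none, .tst i⟩ := by
      refine ⟨fun b => ?_, nofun, fun j hj => ?_, trivial, fun _ _ => ?_⟩
      · cases b
        · exact hc₀
        · exact hc₁
      · obtain rfl : j = i := hj
        exact ⟨_, rfl, o, ho, hi⟩
      · exact ⟨n, S₀, S₁, e₀, e₁, e, aux, t, hn, _, rfl, moveAt_self _ _, moveAt_self _ _⟩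
    refine ⟨_, ⟨.test hn ho hi, hv⟩, ?_⟩
    refine SubDist.map_congr fun x _ => ?_
    symm
    refine hv.app_eq hT ⟨?_, fun q => rfl, rfl⟩
    rcases x with ⟨_ | _, m⟩
    · exact hU₀
    · exact hU₁
  | @der U p hp hg ha hm =>
    have hv : Valid T (genEvent p none) :=
      valid_genEvent (hg.change (.inr hp)) fun i hi => by cases hi
    refine ⟨_, ⟨.der hp, hv⟩, (outcome_eq_dirac hT hv (m := T.mem) rfl ⟨?_, fun q => ?_, hm⟩).symm⟩
    · exact hg.2.2.trans (State.changed_id _).symm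
    · rw [newAddr_genEvent_none, ha]
  | @move U hs ha hm =>
    obtain ⟨d, p, q, hon, hd, hmv, hto⟩ := hs
    have hU := State.movesTo_moveAt.1 hto
    obtain ⟨n, d', hx, -, -⟩ := hmv.cross
    have hc := State.change_moveAt hon hd hx hU
    have hv : Valid T ⟨{p}, fun _ => moveAt p q, none, none, .skip⟩ :=
      ⟨fun _ => hc, nofun, fun _ h => absurd h (Set.notMem_empty _), trivial,
        nofun⟩
    exact ⟨_, ⟨.move hd hmv, hv⟩,
      (outcome_eq_dirac hT hv (m := T.mem) rfl ⟨hU, fun q => congrFun ha q, hm⟩).symm⟩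

/-- With `RawStep.exists_event` this identifies transitions with possible events; it turns an event
that persists after another one into an actual reduction. -/
theorem Possible.rawStep {T : N.RawState} (hT : Sound T) {ev : Event N.net.Edge I L}
    (h : Possible T ev) : RawStep T (outcome T ev) := by
  obtain ⟨hk, hv⟩ := h
  have hgen : ∀ {p a}, Valid T (genEvent p a) → T.siam.GenStep p
      (app T (genEvent p a) (false, T.mem)).siam := by
    intro p a hv
    have hr := hv.result_app hT (false, T.mem)
    have hc := hv.change false
    exact ⟨hc.new_orig p rfl, hc.new_copies p rfl, hr.tok.trans (State.changed_id p)⟩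
  have hout : ∀ {ev : Event N.net.Edge I L}, Valid T ev → ev.mem = .skip →
      outcome T ev = SubDist.dirac (app T ev (false, T.mem)) := by
    intro ev hv he
    refine outcome_eq_dirac hT hv ?_ (hv.result_app hT _)
    rw [he]
    rfl
  cases hk with
  | active hn hi =>
    have hr := hv.result_app hT (false, T.mem)
    rw [hout hv rfl]
    exact .link_active hn (hgen hv) hi (fun q => (hr.addr q).trans (newAddr_genEvent _ _)) hr.mem
  | fresh hn hi h₁ h₂ h₃ =>
    have hr := hv.result_app hT (false, T.mem)
    rw [hout hv rfl]
    exact .link_fresh hn (hgen hv) hi h₁ h₂ h₃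
      (fun q => (hr.addr q).trans (newAddr_genEvent _ _)) hr.mem
  | der hp =>
    have hr := hv.result_app hT (false, T.mem)
    rw [hout hv rfl]
    exact .der hp (hgen hv) (funext fun q => (hr.addr q).trans (newAddr_genEvent_none _ _)) hr.mem
  | @sync n l ports t v hn hf =>
    have hr := hv.result_app hT (false, (𝓜.update v l T.mem).getD T.mem)
    rw [outcome_eq_dirac hT hv rfl hr]
    refine .update hn ⟨fun p hp => ((hv.change false).fire p hp).1,
      (State.movesTo_syncMap hn).2 hr.tok⟩ hf ?_ (funext hr.addr)
    rw [hr.mem]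
    exact MemAct.update_eq hv.mem_defined T.mem
  | @test n S₀ S₁ e₀ e₁ e aux t o i hn ho hi =>
    have h₀ := hv.result_app hT (false, T.mem)
    have h₁ := hv.result_app hT (true, T.mem)
    have := RawStep.test hn ⟨⟨o, ho⟩, State.movesTo_moveAt.2 h₀.tok⟩
      ⟨⟨o, ho⟩, State.movesTo_moveAt.2 h₁.tok⟩ ho hi
    refine cast (congrArg (RawStep T) ?_) this
    refine SubDist.map_congr fun x _ => ?_
    symm
    refine hv.app_eq hT ⟨?_, fun q => rfl, rfl⟩
    rcases x with ⟨_ | _, m⟩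
    · exact h₀.tok
    · exact h₁.tok
  | @move d p q hd hm =>
    have hr := hv.result_app hT (false, T.mem)
    rw [hout hv rfl]
    exact .move ⟨d, p, q, ((hv.change false).fire p rfl).1, hd, hm,
      State.movesTo_moveAt.2 hr.tok⟩ (funext hr.addr) hr.mem

/-- Tokens and addresses that `ev'` uses are untouched, and open copies stay open. A fresh address
remains fresh: `ev` does not assign it, and the addresses on which `ev` acts in the memory already
belong to tokens. -/
theorem Possible.persist {T U : N.RawState} {ev ev' : Event N.net.Edge I L} {x : Bool × M}
    (hv : Valid T ev) (h' : Possible T ev') (hi : ev.Indep ev')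
    (hx : x ∈ (ev.mem.eff 𝓜 T.mem).support) (hU : Result T ev x U) : Possible U ev' := by
  refine ⟨?_, hv.persist h'.valid hi hU⟩
  cases h'.kind with
  | active hn hj => exact .active hn hj
  | @fresh n e t i hn hj h₁ h₂ h₃ =>
    refine .fresh hn hj (fun q hq => ?_) ?_ h₃
    · rw [hU.addr] at hq
      rcases Event.newAddr_eq_some hq with h | h
      · exact hi.addr i h.2 rfl
      · exact h₁ q h
    · rw [hU.mem]
      refine MemAct.isFresh_eff hv.mem_defined h₂ (fun h => ?_) hx
      obtain ⟨p, -, o, -, ho⟩ := hv.mem_addrs i h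
      exact h₁ o ho
  | der hp => exact .der hp
  | sync hn hf =>
    refine .sync hn (hf.imp_mem fun p hp i hpi => ?_)
    obtain ⟨o, ho, hoi⟩ := hpi
    obtain ⟨h₁, h₂⟩ := Valid.tok_persist hU hv (Set.disjoint_right.1 hi.dom hp) ho
    exact ⟨o, h₁, h₂.trans hoi⟩
  | test hn ho hoi =>
    obtain ⟨h₁, h₂⟩ := Valid.tok_persist hU hv (Set.disjoint_right.1 hi.dom rfl) ho
    exact .test hn h₁ (h₂.trans hoi)
  | move hd hm => exact .move hd (hm.mono ((hv.change x.1).copies_subset hU.tok))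

theorem Kind.gen_or_move {T : N.RawState} {ev : Event N.net.Edge I L} (h : Kind T ev) :
    (ev.dom = ∅ ∧ ∃ p a, ev = genEvent p a) ∨ (ev.new = none ∧ ev.addr = none) := by
  cases h with
  | active | fresh | der => exact .inl ⟨rfl, _, _, rfl⟩
  | sync | test | move => exact .inr ⟨rfl, rfl⟩

/-- Two events that move a common token are equal. -/
theorem Possible.move_move {T : N.RawState} (hT : Sound T) {ev ev' : Event N.net.Edge I L}
    (h : Possible T ev) (h' : Possible T ev') {p : Pos N.net.Edge} (hp : p ∈ ev.dom)
    (hp' : p ∈ ev'.dom) : ev = ev' := by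
  have huniq : ∀ p i i', (∃ o, (p, o) ∈ T.siam.tok ∧ T.addr o = some i) →
      (∃ o, (p, o) ∈ T.siam.tok ∧ T.addr o = some i') → i = i' := by
    rintro p i i' ⟨o, ho, hi⟩ ⟨o', ho', hi'⟩
    rw [T.siam.functional _ _ _ ho ho', hi'] at hi
    exact (Option.some.inj hi).symm
  -- Sync crossings, tests and single moves never compete for a token: its direction selects the
  -- node that it meets, and the sort of that node or the door decides the kind of transition.
  have hsm : ∀ {n l ports t d q}, N.net.spec n = .sync l ports →
      p ∈ N.net.syncPositions ports t → N.net.dir p = some d → ¬ T.siam.Move d p q := by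
    intro n l ports t d q hn hp hd hm
    obtain ⟨h₁, h₂⟩ := dir_mem_syncPositions hn hp
    obtain ⟨k, d', hx, hk, -⟩ := hm.cross
    rcases hx.exit with ⟨rfl, he⟩ | ⟨rfl, he⟩
    · obtain rfl := N.net.target_unique _ _ _ h₂ he
      rw [hn] at hk
      exact hk trivial
    · rw [h₁] at hd
      cases hd
  have htm : ∀ {n S₀ S₁ e₀ e₁ e aux t d q}, N.net.spec n = .botbox S₀ S₁ e₀ e₁ e aux →
      N.net.dir ⟨e, .nil, t⟩ = some d → ¬ T.siam.Move d ⟨e, .nil, t⟩ q := by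
    intro n S₀ S₁ e₀ e₁ e aux t d q hn hd hm
    obtain ⟨h₁, h₂⟩ := dir_botbox hn t
    obtain ⟨k, d', hx, -, hk⟩ := hm.cross
    rcases hx.exit with ⟨rfl, he⟩ | ⟨rfl, he⟩
    · rw [h₁] at hd
      cases hd
    · obtain rfl := N.net.source_unique h₂ he
      exact hk _ _ _ _ _ _ hn rfl
  have hst : ∀ {n l ports t n' S₀ S₁ e₀ e₁ e aux t'}, N.net.spec n = .sync l ports →
      p ∈ N.net.syncPositions ports t → N.net.spec n' = .botbox S₀ S₁ e₀ e₁ e aux →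
      p ≠ ⟨e, .nil, t'⟩ := by
    rintro n l ports t n' S₀ S₁ e₀ e₁ e aux t' hn hp hn' rfl
    have h₁ := (dir_mem_syncPositions hn hp).1
    rw [(dir_botbox hn' t').1] at h₁
    cases h₁
  obtain ⟨P, hP⟩ := hT.history
  cases h.kind with
  | active | fresh | der => exact absurd hp (Set.notMem_empty _)
  | sync hn hf =>
    cases h'.kind with
    | active | fresh | der => exact absurd hp' (Set.notMem_empty _)
    | sync hn' hf' =>
      have hp₁ : p ∈ N.net.syncPositions _ _ := hp
      have hp₂ : p ∈ N.net.syncPositions _ _ := hp'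
      obtain rfl := N.net.target_unique _ _ _ (dir_mem_syncPositions hn hp).2
        (dir_mem_syncPositions hn' hp').2
      rw [hn] at hn'
      cases hn'
      obtain ⟨x, -, s, -, hx⟩ := mem_syncPositions.1 hp₁
      obtain ⟨x', -, s', -, hx'⟩ := mem_syncPositions.1 hp₂
      obtain rfl := congrArg Pos.box (hx.symm.trans hx')
      rw [hf.right_unique' huniq hf']
    | test hn' => exact absurd hp' (hst hn hp hn')
    | move hd hm =>
      obtain rfl : p = _ := hp'
      exact absurd hm (hsm hn hp hd)
  | test hn ho hi =>
    obtain rfl : p = _ := hp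
    cases h'.kind with
    | active | fresh | der => exact absurd hp' (Set.notMem_empty _)
    | sync hn' => exact absurd rfl (hst hn' hp' hn)
    | test hn' ho' hi' =>
      have he := congrArg Pos.edge (Set.mem_singleton_iff.1 hp')
      have ht := congrArg Pos.box (Set.mem_singleton_iff.1 hp')
      dsimp only at he ht
      subst he ht
      obtain rfl := N.net.source_unique (dir_botbox hn []).2 (dir_botbox hn' []).2
      rw [hn] at hn'
      cases hn'
      rw [huniq _ _ _ ⟨_, ho, hi⟩ ⟨_, ho', hi'⟩]
    | move hd hm =>
      obtain rfl := Set.mem_singleton_iff.1 hp'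
      exact absurd hm (htm hn hd)
  | move hd hm =>
    obtain rfl : p = _ := hp
    cases h'.kind with
    | active | fresh | der => exact absurd hp' (Set.notMem_empty _)
    | sync hn' => exact absurd hm (hsm hn' hp' hd)
    | test hn' =>
      obtain rfl := Set.mem_singleton_iff.1 hp'
      exact absurd hm (htm hn' hd)
    | move hd' hm' =>
      obtain rfl := Set.mem_singleton_iff.1 hp'
      rw [hd] at hd'
      obtain rfl := Option.some.inj hd'
      rw [hm.det hP hm']

end RawProgramNet

/-! ### Transpositions of fresh addresses. -/

section Nominal

variable {I M : Type*} [MulAction (finPerm I) M]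

open Classical in
theorem swap_mem_finPerm (i j : I) : Equiv.swap i j ∈ finPerm I := by
  refine (Set.toFinite {i, j}).subset fun k hk => ?_
  by_contra h
  simp only [Set.mem_insert_iff, Set.mem_singleton_iff, not_or] at h
  exact hk (Equiv.swap_apply_of_ne_of_ne h.1 h.2)

open Classical in
/-- The transposition of two addresses, as a finitary permutation. -/
noncomputable def finSwap (i j : I) : finPerm I := ⟨Equiv.swap i j, swap_mem_finPerm i j⟩

theorem finSwap_apply_of_ne {i j k : I} (h : k ≠ i) (h' : k ≠ j) : (finSwap i j).1 k = k := by
  classical exact Equiv.swap_apply_of_ne_of_ne h h'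

theorem finSwap_smul_of_supports {S : Set I} {m : M} (hS : Supports S m) {i j : I} (hi : i ∉ S)
    (hj : j ∉ S) : finSwap i j • m = m :=
  hS _ fun _ hk => finSwap_apply_of_ne (fun h => hi (h ▸ hk)) fun h => hj (h ▸ hk)

/-- The transposition of two fresh addresses does not change a memory. -/
theorem finSwap_smul [Infinite I] {m : M} {i j : I} (hi : IsFresh i m) (hj : IsFresh j m) :
    finSwap i j • m = m := by
  classical
  obtain ⟨S, hS, hSm, hiS⟩ := hi
  obtain ⟨S', hS', hSm', hjS'⟩ := hj
  -- The addresses `i` and `j` may avoid different supports. A third address `k` outside both splits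
  -- the transposition of `i` and `j` into transpositions that each avoid one of these supports.
  obtain ⟨k, hk⟩ := ((hS.union hS').union (Set.toFinite {i, j})).exists_notMem
  simp only [Set.mem_union, Set.mem_insert_iff, Set.mem_singleton_iff, not_or] at hk
  obtain ⟨⟨hkS, hkS'⟩, hki, hkj⟩ := hk
  by_cases hij : i = j
  · subst hij
    exact finSwap_smul_of_supports hSm hiS hiS
  · have h : finSwap i j = finSwap k i * finSwap j k * finSwap k i :=
      Subtype.ext (Equiv.swap_mul_swap_mul_swap (Ne.symm hkj) (Ne.symm hij)).symm
    rw [h, mul_smul, mul_smul, finSwap_smul_of_supports hSm hkS hiS,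
      finSwap_smul_of_supports hSm' hjS' hkS', finSwap_smul_of_supports hSm hkS hiS]

theorem IsFresh.smul {m : M} {i : I} (h : IsFresh i m) (σ : finPerm I) :
    IsFresh (σ.1 i) (σ • m) := by
  obtain ⟨S, hS, hSm, hi⟩ := h
  refine ⟨σ.1 '' S, hS.image _, fun τ hτ => ?_, fun ⟨j, hj, hji⟩ => hi (σ.1.injective hji ▸ hj)⟩
  have : (σ⁻¹ * τ * σ) • m = m := by
    refine hSm _ fun j hj => ?_
    change σ.1⁻¹ (τ.1 (σ.1 j)) = j
    rw [hτ _ ⟨j, hj, rfl⟩]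
    exact σ.1.symm_apply_apply j
  rw [mul_smul, mul_smul, inv_smul_eq_iff] at this
  exact this

end Nominal

/-! ### Finiteness of the inputs of a net. -/

/-- The paths to the units and the modalities of a formula are finitely many. -/
theorem Formula.finite_paths (A : Formula) :
    {w | ∃ s : Stk, s.path = w ∧ (s.indicates A).isSome}.Finite := by
  have hmod : ∀ {A B : Formula}, {w | ∃ s : Stk, s.path = w ∧ (s.indicates A).isSome}.Finite →
      (∀ s : Stk, (s.indicates B).isSome → ∃ (σ : Sig) (s' : Stk), s = .sig σ s' ∧
        (s' ≠ .delta → (s'.indicates A).isSome)) →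
      {w | ∃ s : Stk, s.path = w ∧ (s.indicates B).isSome}.Finite := by
    intro A B ih hB
    refine ((ih.image (PathStep.mod :: ·)).insert [.mod]).subset ?_
    rintro _ ⟨s, rfl, hs⟩
    obtain ⟨σ, s', rfl, hs'⟩ := hB s hs
    by_cases hd : s' = .delta
    · subst hd
      exact .inl rfl
    · exact .inr ⟨_, ⟨s', rfl, hs' hd⟩, rfl⟩
  induction A with
  | one | bot =>
    refine (Set.finite_singleton []).subset ?_
    rintro _ ⟨s, rfl, hs⟩
    cases s with
    | nil => rfl
    | sig σ s => cases s <;> cases hs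
    | _ => cases hs
  | tensor A B hA hB | par A B hA hB =>
    refine ((hA.image (PathStep.l :: ·)).union (hB.image (PathStep.r :: ·))).subset ?_
    rintro _ ⟨s, rfl, hs⟩
    cases s with
    | l s => exact .inl ⟨_, ⟨s, rfl, hs⟩, rfl⟩
    | r s => exact .inr ⟨_, ⟨s, rfl, hs⟩, rfl⟩
    | sig σ s => cases s <;> cases hs
    | _ => cases hs
  | bang A hA =>
    refine hmod hA fun s hs => ?_
    cases s with
    | sig σ s => exact ⟨σ, s, rfl, fun h => by rwa [Stk.indicates_sig_bang h] at hs⟩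
    | _ => cases hs
  | quest A hA =>
    refine hmod hA fun s hs => ?_
    cases s with
    | sig σ s => exact ⟨σ, s, rfl, fun h => by rwa [Stk.indicates_sig_quest h] at hs⟩
    | _ => cases hs

theorem PreNet.finite_input {L : Type*} (R : PreNet L) : {x | R.IsInput x}.Finite := by
  have := R.finite_edge
  refine ((Set.finite_range Input.one).union (Set.finite_iUnion fun e =>
    (R.ty e).finite_paths.image (Input.bot e))).subset ?_
  rintro (e | ⟨e, w⟩) hx
  · exact .inl ⟨e, rfl⟩
  · obtain ⟨-, s, hs, hi⟩ := hx
    exact .inr (Set.mem_iUnion.2 ⟨e, w, ⟨s, hs, by rw [hi]; rfl⟩, rfl⟩)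

/-! ### Joinability of the transitions of a state. -/

namespace RawProgramNet

open PreNet

variable {I M L : Type*} [MulAction (finPerm I) M] {𝓜 : MemoryStructure I M L}
  {N : RawProgramNet 𝓜}

theorem finite_ind (N : RawProgramNet 𝓜) : {i | ∃ x, N.ind x = some i}.Finite := by
  refine ((N.net.finite_input.image N.ind).preimage (Option.some_injective I).injOn).subset ?_
  rintro i ⟨x, hx⟩
  exact ⟨x, N.ind_input x i hx, hx⟩

/-- The choice of the fresh address is irrelevant, up to the equivalence of states. -/
theorem fresh_swap [Infinite I] {T : N.RawState} (hT : Sound T) {n e t i j}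
    (hn : N.net.spec n = .one e) (hind : N.ind (.one e) = none)
    (h : Possible T (genEvent ⟨e, .nil, t⟩ (some i)))
    (hi₁ : ∀ q, T.addr q ≠ some i) (hi₂ : IsFresh i T.mem) (hi₃ : ∀ x, N.ind x ≠ some i)
    (hj₁ : ∀ q, T.addr q ≠ some j) (hj₂ : IsFresh j T.mem) (hj₃ : ∀ x, N.ind x ≠ some j) :
    Possible T (genEvent ⟨e, .nil, t⟩ (some j)) ∧
      (outcome T (genEvent ⟨e, .nil, t⟩ (some j))).map MState.mk =
        (outcome T (genEvent ⟨e, .nil, t⟩ (some i))).map MState.mk := by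
  have hv : Valid T (genEvent ⟨e, .nil, t⟩ (some j)) := valid_genEvent (h.valid.change false) (by
    rintro k hk q hq
    obtain rfl := Option.some.inj hk
    exact absurd hq (hj₁ q))
  have hri := h.valid.result_app hT (false, T.mem)
  have hrj := hv.result_app hT (false, T.mem)
  refine ⟨⟨.fresh hn hind hj₁ hj₂ hj₃, hv⟩, ?_⟩
  rw [outcome_eq_dirac hT hv rfl hrj, outcome_eq_dirac hT h.valid rfl hri, SubDist.map_dirac,
    SubDist.map_dirac]
  -- The transposition fixes the memory, the addresses in use and those assigned by the net; it only
  -- changes the address of the new token.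
  refine congrArg SubDist.dirac (mk_eq_iff.2 ⟨finSwap j i, fun x k hk => ?_, ?_, fun q => ?_, ?_⟩)
  · exact finSwap_apply_of_ne (fun h => hj₃ x (h ▸ hk)) fun h => hi₃ x (h ▸ hk)
  · exact State.ext (hri.tok.trans hrj.tok.symm)
  · rw [hri.addr, hrj.addr, newAddr_genEvent, newAddr_genEvent]
    split_ifs
    · classical exact congrArg some (Equiv.swap_apply_left j i).symm
    · rcases hq : T.addr q with _ | k
      · rfl
      · have hkj : k ≠ j := fun h => hj₁ q (h ▸ hq)
        have hki : k ≠ i := fun h => hi₁ q (h ▸ hq)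
        exact congrArg some (finSwap_apply_of_ne hkj hki).symm
  · rw [hri.mem, hrj.mem]
    exact (finSwap_smul hj₂ hi₂).symm

/-- Two possible events are equal or independent, up to the choice of a fresh address. -/
theorem Possible.exists_indep [Infinite I] {T : N.RawState} (hT : Sound T)
    {ev ev' : Event N.net.Edge I L} (h : Possible T ev) (h' : Possible T ev') :
    (outcome T ev).map MState.mk = (outcome T ev').map MState.mk ∨
      ∃ ev'', Possible T ev'' ∧
        (outcome T ev'').map MState.mk = (outcome T ev').map MState.mk ∧ ev.Indep ev'' := by
  rcases h.kind.gen_or_move with ⟨hdom, p, a, rfl⟩ | ⟨hnew, haddr⟩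
  swap
  · rcases h'.kind.gen_or_move with ⟨hdom', p', a', rfl⟩ | ⟨hnew', haddr'⟩
    · refine .inr ⟨_, h', rfl, ⟨?_, fun p hp => ?_, fun i hi => ?_⟩⟩
      · rw [hdom']
        exact Set.disjoint_empty _
      · rw [hnew] at hp
        cases hp
      · rw [haddr] at hi
        cases hi
    · by_cases hd : Disjoint ev.dom ev'.dom
      · refine .inr ⟨_, h', rfl, ⟨hd, fun p hp => ?_, fun i hi => ?_⟩⟩
        · rw [hnew] at hp
          cases hp
        · rw [haddr] at hi
          cases hi
      · obtain ⟨p, hp, hp'⟩ := Set.not_disjoint_iff.1 hd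
        rw [h.move_move hT h' hp hp']
        exact .inl rfl
  rcases h'.kind.gen_or_move with ⟨hdom', p', a', rfl⟩ | ⟨hnew', haddr'⟩
  swap
  · refine .inr ⟨_, h', rfl, ⟨Set.empty_disjoint _, fun q _ hq' => ?_, fun i _ hi' => ?_⟩⟩
    · rw [hnew'] at hq'
      cases hq'
    · rw [haddr'] at hi'
      cases hi'
  have hindep : ∀ {b b' : Option I}, p ≠ p' → (∀ i, b = some i → b' ≠ some i) →
      (genEvent p b : Event N.net.Edge I L).Indep (genEvent p' b') := fun hpp hb =>
    ⟨Set.empty_disjoint _, fun q hq hq' =>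
      hpp ((Option.some.inj hq).trans (Option.some.inj hq').symm), hb⟩
  have hnode : ∀ {n k : N.net.Node} {e : N.net.Edge}, N.net.spec n = .one e →
      ∀ a, N.net.spec k ≠ .der a e := by
    intro n k e hn a hk
    obtain rfl : n = k := N.net.source_unique (e := e) (by rw [hn]; simp [NodeSpec.concls])
      (by rw [hk]; simp [NodeSpec.concls])
    rw [hn] at hk
    cases hk
  generalize hE : (genEvent p a : Event N.net.Edge I L) = E at h
  generalize hE' : (genEvent p' a' : Event N.net.Edge I L) = E' at h'
  have hk := h.kind
  have hk' := h'.kind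
  by_cases hpp : p = p'
  · subst hpp
    -- The position determines the node, and `ind` whether its address is prescribed. Two creations
    -- in one position can therefore differ only in the fresh address.
    left
    cases hk <;> cases hk' <;> simp only [genEvent, Event.mk.injEq, Option.some.injEq, reduceCtorEq,
      and_false, false_and] at hE hE'
    case active.active n e t i hn hi n' e' t' i' hn' hi' =>
      obtain ⟨-, -, rfl, rfl, -⟩ := hE
      obtain ⟨-, -, h₁, rfl, -⟩ := hE'
      cases h₁
      rw [hi] at hi'
      cases hi'
      rfl
    case active.fresh n e t i hn hi n' e' t' i' hn' hi' _ _ _ =>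
      obtain ⟨-, -, rfl, rfl, -⟩ := hE
      obtain ⟨-, -, h₁, rfl, -⟩ := hE'
      cases h₁
      rw [hi] at hi'
      cases hi'
    case fresh.active n e t i hn hi _ _ _ n' e' t' i' hn' hi' =>
      obtain ⟨-, -, rfl, rfl, -⟩ := hE
      obtain ⟨-, -, h₁, rfl, -⟩ := hE'
      cases h₁
      rw [hi] at hi'
      cases hi'
    case active.der hn _ _ hp =>
      obtain ⟨-, -, rfl, rfl, -⟩ := hE
      obtain ⟨-, -, rfl, rfl, -⟩ := hE'
      obtain ⟨-, ⟨k, b, hk⟩, -⟩ := hp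
      exact absurd hk (hnode hn b)
    case fresh.der hn _ _ _ _ _ hp =>
      obtain ⟨-, -, rfl, rfl, -⟩ := hE
      obtain ⟨-, -, rfl, rfl, -⟩ := hE'
      obtain ⟨-, ⟨k, b, hk⟩, -⟩ := hp
      exact absurd hk (hnode hn b)
    case der.active hp _ _ _ _ hn _ =>
      obtain ⟨-, -, rfl, rfl, -⟩ := hE
      obtain ⟨-, -, rfl, rfl, -⟩ := hE'
      obtain ⟨-, ⟨k, b, hk⟩, -⟩ := hp
      exact absurd hk (hnode hn b)
    case der.fresh hp _ _ _ _ hn _ _ _ _ =>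
      obtain ⟨-, -, rfl, rfl, -⟩ := hE
      obtain ⟨-, -, rfl, rfl, -⟩ := hE'
      obtain ⟨-, ⟨k, b, hk⟩, -⟩ := hp
      exact absurd hk (hnode hn b)
    case der.der =>
      obtain ⟨-, -, rfl, rfl, -⟩ := hE
      obtain ⟨-, -, rfl, rfl, -⟩ := hE'
      rfl
    case fresh.fresh n e t i hn hi h₁ h₂ h₃ n' e' t' i' hn' hi' h₁' h₂' h₃' =>
      obtain ⟨-, -, rfl, rfl, -⟩ := hE
      obtain ⟨-, -, h₄, rfl, -⟩ := hE'
      cases h₄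
      exact (fresh_swap hT hn' hi' h' h₁' h₂' h₃' h₁ h₂ h₃).2
  · right
    by_cases haa : ∀ i, a = some i → a' ≠ some i
    · exact ⟨_, h', rfl, hE' ▸ hE ▸ hindep hpp haa⟩
    · simp only [not_forall, not_not] at haa
      obtain ⟨i₀, rfl, rfl⟩ := haa
      cases hk' <;> simp only [genEvent, Event.mk.injEq, Option.some.injEq, reduceCtorEq,
        and_false, false_and] at hE'
      case active n' e' t' i' hn' hi' =>
        exfalso
        obtain ⟨-, -, rfl, rfl, -⟩ := hE'
        cases hk <;> simp only [genEvent, Event.mk.injEq, Option.some.injEq, reduceCtorEq,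
          and_false, false_and] at hE
        case active n e t i hn hi =>
          obtain ⟨-, -, rfl, rfl, -⟩ := hE
          have he : e = e' := Input.one.inj (N.ind_injective _ _ _ hi hi')
          subst he
          -- Nodes with a prescribed address are at the surface, where box stacks are empty, so each
          -- has a single starting position.
          have hroot := (N.ind_input _ _ hi).1
          have hlen : ∀ {t}, N.net.IsPos ⟨e, .nil, t⟩ → t = [] := by
            intro t ht
            have := ht.2
            dsimp only at this
            rw [hroot, N.net.expDepth_root] at this
            exact List.length_eq_zero_iff.1 this
          have h₁ := (h.valid.change false).new_isPos _ rfl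
          have h₂ := (h'.valid.change false).new_isPos _ rfl
          exact hpp (by rw [hlen h₁, hlen h₂])
        case fresh _ _ _ hi =>
          obtain ⟨-, -, rfl, rfl, -⟩ := hE
          exact hi _ hi'
      case fresh n' e' t' i' hn' hi' h₁' h₂' h₃' =>
        obtain ⟨-, -, rfl, rfl, -⟩ := hE'
        -- Both creations took the fresh address `i₀`, so the second one is given another. Only
        -- finitely many addresses are excluded: those in use in `T`, those assigned by the net, a
        -- support of the memory, and `i₀`.
        obtain ⟨S, hS, hSm⟩ := 𝓜.nominal T.mem
        obtain ⟨j, hj⟩ := (((hT.finite.union N.finite_ind).union hS).union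
          (Set.finite_singleton i₀)).exists_notMem
        simp only [Set.mem_union, Set.mem_ofPred_eq, Set.mem_singleton_iff, not_or,
          not_exists] at hj
        obtain ⟨h₁, h₂⟩ := fresh_swap hT hn' hi' h' h₁' h₂' h₃' hj.1.1.1 ⟨S, hS, hSm, hj.1.2⟩
          hj.1.1.2
        refine ⟨_, h₁, h₂, hE ▸ hindep hpp fun i hi hi' => ?_⟩
        exact hj.2 ((Option.some.inj hi').trans (Option.some.inj hi).symm)

theorem Possible.rel {T : N.RawState} (hT : Sound T) {ev : Event N.net.Edge I L}
    (h : Possible T ev) : N.machine.rel (MState.mk T) ((outcome T ev).map MState.mk) :=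
  ⟨T, _, rfl, h.rawStep hT, rfl⟩

theorem Possible.joined [Infinite I] {T : N.RawState} (hT : Sound T)
    {ev ev' : Event N.net.Edge I L} (h : Possible T ev) (h' : Possible T ev') :
    (outcome T ev).map MState.mk = (outcome T ev').map MState.mk ∨
      N.machine.Joined ((outcome T ev).map MState.mk) ((outcome T ev').map MState.mk) := by
  rcases h.exists_indep hT h' with heq | ⟨ev'', h'', heq, hi⟩
  · exact .inl heq
  · rw [← heq]
    have key : ∀ {ev ev' : Event N.net.Edge I L}, Possible T ev → Possible T ev' → ev.Indep ev' →
        ∀ x ∈ (ev.mem.eff 𝓜 T.mem).support, N.machine.rel (MState.mk (app T ev x))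
          ((outcome (app T ev x) ev').map MState.mk) := by
      intro ev ev' h h' hi x hx
      have hU := h.valid.result_app hT x
      exact (Possible.persist h.valid h' hi hx hU).rel (h.valid.sound hT hU)
    exact .inr (joined_of_indep hT h.valid h''.valid hi (key h h'' hi) (key h'' h hi.symm))

/-! ### Renaming of addresses -/

/-- The state in which the addresses are renamed. -/
def rename (σ : finPerm I) (T : N.RawState) : N.RawState where
  siam := T.siam
  addr := fun p => (T.addr p).map σ.1
  addr_start := fun p i hp => by
    obtain ⟨j, hj, -⟩ := Option.map_eq_some_iff.1 hp
    exact T.addr_start p j hj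
  addr_injective := fun p q i hp hq => by
    obtain ⟨j, hj, rfl⟩ := Option.map_eq_some_iff.1 hp
    obtain ⟨k, hk, hkj⟩ := Option.map_eq_some_iff.1 hq
    obtain rfl := σ.1.injective hkj
    exact T.addr_injective p q k hj hk
  mem := σ • T.mem

theorem mk_rename {σ : finPerm I} (hσ : ∀ x i, N.ind x = some i → σ.1 i = i) (T : N.RawState) :
    MState.mk (rename σ T) = MState.mk T :=
  ((mk_eq_iff (T := T) (U := rename σ T)).2 ⟨σ, hσ, rfl, fun _ => rfl, rfl⟩).symm

theorem exists_rename {T U : N.RawState} (h : MState.mk T = MState.mk U) :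
    ∃ σ : finPerm I, (∀ x i, N.ind x = some i → σ.1 i = i) ∧ U = rename σ T := by
  obtain ⟨σ, h₁, h₂, h₃, h₄⟩ := mk_eq_iff.1 h
  exact ⟨σ, h₁, RawState.ext h₂ (funext h₃) h₄⟩

/-- Tests and updates are equivariant, freshness is preserved by permutations, and prescribed
addresses are fixed by `σ`. -/
theorem RawStep.rename {σ : finPerm I} (hσ : ∀ x i, N.ind x = some i → σ.1 i = i)
    {T : N.RawState} {ν : SubDist N.RawState} (h : RawStep T ν) :
    ∃ ν', RawStep (rename σ T) ν' ∧ ν'.map MState.mk = ν.map MState.mk := by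
  have hdirac : ∀ {U : N.RawState}, RawStep (RawProgramNet.rename σ T)
      (SubDist.dirac (RawProgramNet.rename σ U)) → ∃ ν', RawStep (RawProgramNet.rename σ T) ν' ∧
        ν'.map MState.mk = (SubDist.dirac U).map MState.mk := fun h =>
    ⟨_, h, by rw [SubDist.map_dirac, SubDist.map_dirac, mk_rename hσ]⟩
  have haddr : ∀ {U : N.RawState} {i : I} {p : Pos N.net.Edge},
      (∀ q, U.addr q = open Classical in if q = p then some i else T.addr q) →
      ∀ q, (RawProgramNet.rename σ U).addr q = open Classical in if q = p then some (σ.1 i) else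
        (RawProgramNet.rename σ T).addr q := by
    intro U i p h q
    change (U.addr q).map σ.1 = _
    rw [h]
    split_ifs <;> rfl
  have hmem : ∀ {U : N.RawState}, U.mem = T.mem →
      (RawProgramNet.rename σ U).mem = (RawProgramNet.rename σ T).mem :=
    fun h => congrArg (σ • ·) h
  have haddr' : ∀ {U : N.RawState}, U.addr = T.addr →
      (RawProgramNet.rename σ U).addr = (RawProgramNet.rename σ T).addr :=
    fun h => funext fun q => congrArg (Option.map σ.1) (congrFun h q)
  have hne : ∀ {o : Option I} {i : I}, o ≠ some i → o.map σ.1 ≠ some (σ.1 i) := by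
    intro o i h h'
    obtain ⟨j, hj, hji⟩ := Option.map_eq_some_iff.1 h'
    exact h (σ.1.injective hji ▸ hj)
  cases h with
  | link_active hn hg hi ha hm =>
    refine hdirac (.link_active hn hg hi (fun q => ?_) (hmem hm))
    rw [haddr ha, hσ _ _ hi]
  | @link_fresh U n e t i hn hg hi h₁ h₂ h₃ ha hm =>
    refine hdirac (.link_fresh hn hg hi (fun q => hne (h₁ q)) (h₂.smul σ) (fun x hx => ?_)
      (haddr ha) (hmem hm))
    have h₄ := hσ x _ hx
    rw [σ.1.injective h₄] at hx
    exact h₃ x hx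
  | @update U n l ports t v hn hs hf hu ha =>
    refine hdirac (.update (v := v.map σ.1) hn hs ?_ ?_ (haddr' ha))
    · rw [List.forall₂_map_right_iff]
      refine hf.imp fun p i ⟨o, ho, hi⟩ => ⟨o, ho, ?_⟩
      exact congrArg (Option.map σ.1) hi
    · refine (𝓜.update_equivariant σ v l T.mem).trans ?_
      rw [hu]
      rfl
  | @test n S₀ S₁ e₀ e₁ e aux t o i T₀ T₁ hn h₀ h₁ ho hi =>
    have hs : RawStep (RawProgramNet.rename σ T) _ :=
      .test (T := RawProgramNet.rename σ T) hn h₀ h₁ ho (congrArg (Option.map σ.1) hi)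
    refine ⟨_, hs, ?_⟩
    let φ : Bool × M ≃ Bool × M := Equiv.prodCongr (Equiv.refl Bool) (MulAction.toPerm σ)
    have hφ : (𝓜.test i T.mem).map φ = 𝓜.test (σ.1 i) (RawProgramNet.rename σ T).mem :=
      SubDist.map_equiv φ fun a => 𝓜.test_equivariant σ i T.mem a.1 a.2
    change SubDist.map _ (SubDist.map _ (𝓜.test (σ.1 i) (RawProgramNet.rename σ T).mem)) = _
    rw [← hφ, SubDist.map_map, SubDist.map_map, SubDist.map_map]
    refine SubDist.map_congr fun x _ => ?_
    symm
    exact mk_eq_iff.2 ⟨σ, hσ, rfl, fun _ => rfl, rfl⟩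
  | der hp hg ha hm => exact hdirac (.der hp hg (haddr' ha) (hmem hm))
  | move hs ha hm => exact hdirac (.move hs (haddr' ha) (hmem hm))

/-! ### The runs of the machine -/

/-- Every raw state that represents the state `a` is sound. -/
def MSound (a : N.MState) : Prop := ∀ T, MState.mk T = a → Sound T

/-- Renaming carries every reduction of a class to one chosen representative, on which different
reductions can be compared. -/
theorem MSound.exists_event {a : N.MState} (ha : MSound a) {T : N.RawState} (hT : MState.mk T = a)
    {μ : SubDist N.MState} (h : N.machine.rel a μ) :
    ∃ ev, Possible T ev ∧ μ = (outcome T ev).map MState.mk := by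
  obtain ⟨T', ν, hT', hs, rfl⟩ := h
  obtain ⟨σ, hσ, rfl⟩ := exists_rename (hT'.trans hT.symm)
  obtain ⟨ν', hs', hν⟩ := hs.rename hσ
  obtain ⟨ev, hev, rfl⟩ := hs'.exists_event (ha _ hT)
  exact ⟨ev, hev, hν.symm⟩

theorem MState.exists_rep (a : N.MState) : ∃ T, MState.mk T = a := Quotient.exists_rep a

theorem mem_support_outcome {T : N.RawState} {ev : Event N.net.Edge I L} {b : N.MState}
    (h : b ∈ ((outcome T ev).map MState.mk).support) :
    ∃ x ∈ (ev.mem.eff 𝓜 T.mem).support, b = MState.mk (app T ev x) := by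
  rw [outcome, SubDist.map_map] at h
  exact SubDist.mem_support_map.1 h

theorem MSound.closed {a b : N.MState} {μ : SubDist N.MState} (ha : MSound a)
    (h : N.machine.rel a μ) (hb : b ∈ μ.support) : MSound b := by
  obtain ⟨T, hT⟩ := a.exists_rep
  obtain ⟨ev, hev, rfl⟩ := ha.exists_event hT h
  obtain ⟨x, -, rfl⟩ := mem_support_outcome hb
  have hr := hev.valid.result_app (ha T hT) x
  exact fun U hU => (hev.valid.sound (ha T hT) hr).congr hU.symm

theorem isConflict_msound : N.machine.IsConflict MSound fun a b => a.siam.Conflict b.siam where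
  closed := MSound.closed
  symm := by
    rintro a b ⟨n, S₀, S₁, e₀, e₁, e, aux, s, t, hn, h⟩
    exact ⟨n, S₀, S₁, e₀, e₁, e, aux, s, t, hn, h.symm.imp And.symm And.symm⟩
  irrefl := by
    intro a ha
    obtain ⟨T, rfl⟩ := a.exists_rep
    exact (ha T rfl).not_conflict
  persist := by
    intro a c μ b ha hc h hb
    obtain ⟨T, rfl⟩ := a.exists_rep
    obtain ⟨ev, hev, rfl⟩ := ha.exists_event rfl h
    obtain ⟨x, -, rfl⟩ := mem_support_outcome hb
    exact hev.valid.conflict_persist (hev.valid.result_app (ha T rfl) x) hc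
  outcomes := by
    intro a μ b c ha h hb hc hbc
    obtain ⟨T, rfl⟩ := a.exists_rep
    obtain ⟨ev, hev, rfl⟩ := ha.exists_event rfl h
    obtain ⟨x, hx, rfl⟩ := mem_support_outcome hb
    obtain ⟨y, hy, rfl⟩ := mem_support_outcome hc
    exact hev.valid.conflict_app (ha T rfl) hx hy fun hxy => hbc (by rw [hxy])

theorem MSound.joined [Infinite I] {a : N.MState} (ha : MSound a) (μ ξ : SubDist N.MState)
    (hμ : N.machine.rel a μ) (hξ : N.machine.rel a ξ) : μ = ξ ∨ N.machine.Joined μ ξ := by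
  obtain ⟨T, hT⟩ := a.exists_rep
  obtain ⟨ev, hev, rfl⟩ := ha.exists_event hT hμ
  obtain ⟨ev', hev', rfl⟩ := ha.exists_event hT hξ
  exact hev.joined (ha T hT) hev'

theorem msound_init (h : N.InitInjective) : MSound (N.init h) := by
  have hs : Sound (N.rawInit h) := by
    refine ⟨⟨_, PreNet.initState_history⟩, N.finite_ind.subset ?_⟩
    rintro i ⟨p, hp⟩
    change N.initAddr p = some i at hp
    unfold initAddr at hp
    split_ifs at hp
    exact ⟨_, hp⟩
  exact fun T hT => hs.congr hT.symm

end RawProgramNet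

/-! ### Invariants and prolongations of runs. -/

namespace PARS

variable {A : Type*} {P : PARS A}

theorem Reach.invariant {Q : A → Prop} (hQ : ∀ a μ b, Q a → P.rel a μ → b ∈ μ.support → Q b)
    {a : A} {μ : SubDist A} (h : P.Reach a μ) (ha : Q a) : ∀ b ∈ μ.support, Q b := by
  classical
  induction h with
  | single h => exact fun b hb => hQ _ _ b ha h hb
  | refl a =>
    intro b hb
    rwa [SubDist.mem_support_dirac.1 hb]
  | @trans a b μ ρ ν _ _ hν ih ih' =>
    intro x hx
    by_cases hx' : x ≠ b ∧ μ x ≠ 0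
    · exact ih ha x hx'.2
    · have h₀ : (if x = b then 0 else μ x) = 0 := by
        split_ifs with hxb
        · rfl
        · by_contra h
          exact hx' ⟨hxb, h⟩
      change ν x ≠ 0 at hx
      rw [hν x] at hx
      have h₁ : μ b * ρ x ≠ 0 := by
        intro h
        refine hx ?_
        rw [h, add_zero]
        convert h₀
      obtain ⟨h₂, h₃⟩ := mul_ne_zero_iff.1 h₁
      exact ih' (ih ha b h₂) x h₃

theorem Reach.step {a b : A} {μ ρ : SubDist A} (h : P.Reach a μ) (hb : b ∈ μ.support)
    (h' : P.rel b ρ) {c : A} (hc : c ∈ ρ.support) : ∃ ν, P.Reach a ν ∧ c ∈ ν.support := by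
  classical
  -- Only `b` is reduced, so averaging `F` replaces the mass of `b` as the transitivity rule of
  -- `Reach` prescribes.
  let F : A → SubDist A := fun x => if x = b then ρ else SubDist.dirac x
  have hF : F b = ρ := if_pos rfl
  refine ⟨μ.bind F, .trans h (.single h') fun x => ?_,
    SubDist.mem_support_bind.2 ⟨b, hb, hF.symm ▸ hc⟩⟩
  have h₁ : ∀ y, μ y * F y x = (if y = x then (if x = b then 0 else μ x) else 0) +
      if y = b then μ b * ρ x else 0 := by
    intro y
    by_cases hy : y = b
    · subst hy
      rw [hF, if_pos rfl]
      by_cases hx : y = x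
      · subst hx
        simp
      · simp [hx]
    · have : F y = SubDist.dirac y := if_neg hy
      rw [this, if_neg hy, add_zero]
      by_cases hx : y = x
      · subst hx
        rw [SubDist.dirac_self, if_pos rfl, if_neg hy, mul_one]
      · rw [SubDist.dirac_ne (Ne.symm hx), if_neg hx, mul_zero]
  rw [SubDist.bind_apply, tsum_congr h₁, ENNReal.tsum_add, tsum_ite_eq, tsum_ite_eq]

end PARS

/-! ### Reachable states, and the main theorem. -/

namespace RawProgramNet

variable {I M L : Type*} [MulAction (finPerm I) M] {𝓜 : MemoryStructure I M L}
  {N : RawProgramNet 𝓜}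

theorem Reachable.msound {h : N.InitInjective} {a : N.MState} (ha : N.Reachable h a) :
    MSound a := by
  obtain ⟨μ, hμ, ha⟩ := ha
  exact hμ.invariant (fun _ _ _ => MSound.closed) (msound_init h) a ha

theorem reachable_init (h : N.InitInjective) : N.Reachable h (N.init h) :=
  ⟨_, .refl _, SubDist.mem_support_dirac.2 rfl⟩

/-- Reachable states are sound, and soundness gives everything but closure, which is the
prolongation of a run by one step. -/
theorem isConflict_reachable (h : N.InitInjective) :
    N.machine.IsConflict (N.Reachable h) fun a b => a.siam.Conflict b.siam where
  closed := fun ⟨_, hμ, ha⟩ hr hb => hμ.step ha hr hb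
  symm := isConflict_msound.symm
  irrefl := fun ha => isConflict_msound.irrefl ha.msound
  persist := fun ha => isConflict_msound.persist ha.msound
  outcomes := fun ha => isConflict_msound.outcomes ha.msound

end RawProgramNet

theorem mainTheorem8 {I M L : Type*} [Countable I] [Infinite I] [Finite L]
    [MulAction (finPerm I) M] (𝓜 : MemoryStructure I M L) (N : RawProgramNet 𝓜)
    (h : N.InitInjective) :
    -- the distributions of the runs are conflict distributions
    (∀ T, N.Reachable h T → SubDist.dirac T ∈ N.conflictDists h) ∧
    (∀ μ ∈ N.conflictDists h, ∀ ν, N.machine.Lift μ ν → ν ∈ N.conflictDists h) ∧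
    -- diamond property, confluence, uniqueness of normal forms, uniformity
    N.machine.DiamondOn (N.conflictDists h) ∧
    N.machine.ConfluentOn (N.conflictDists h) ∧
    N.machine.UniqueNFOn (N.reachableDists h) ∧
    N.machine.UniformOn (N.reachableDists h) ∧
    -- all runs have the same degree of termination
    (∀ k ρ τ, N.machine.LiftN k (SubDist.dirac (N.init h)) ρ →
      N.machine.LiftN k (SubDist.dirac (N.init h)) τ → N.machine.nf ρ = N.machine.nf τ) ∧
    ∃ p ≤ 1, N.machine.Converges (SubDist.dirac (N.init h)) p ∧
      ∀ ρ : ℕ → SubDist N.MState, ρ 0 = SubDist.dirac (N.init h) →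
        (∀ n, N.machine.Lift (ρ n) (ρ (n + 1))) →
        Tendsto (fun n => N.machine.nf (ρ n)) atTop (𝓝 p) := by
  have hC := RawProgramNet.isConflict_reachable h
  -- The class of conflict distributions of the general theory unfolds to `conflictDists`, and its
  -- distributions on elements satisfying the invariant to `reachableDists`.
  obtain ⟨hdiamond, hconf, hunique⟩ := hC.main fun a ha => ha.msound.joined
  have hinit : SubDist.dirac (N.init h) ∈ N.reachableDists h := fun T hT => by
    rw [SubDist.mem_support_dirac.1 hT]
    exact RawProgramNet.reachable_init h
  refine ⟨fun T hT => PARS.IsConflict.dirac_mem hT, fun μ hμ ν hν => hC.lift_mem hμ hν, hdiamond,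
    hconf, hunique, hunique.uniformOn, fun k ρ τ hρ hτ => ?_, hunique.converges hinit⟩
  rw [PARS.nf, hunique _ hinit k ρ τ hρ hτ]
  rfl
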